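/- Let $n\ge 3$ and $d\ge 1$ be integers, let $p_1>p_2>\dots>p_n$ be relatively prime positive integers, $\mathfrak P=(p_1,\dots,p_n)$, and let $\lambda\in\mathbb Z$. On $\mathbb C^n$ put $\nu_n=dx_1\wedge\dots\wedge dx_n$, $S=\sum_i p_ix_i\,\partial/\partial x_i$ and $R_n=\sum_i x_i\,\partial/\partial x_i$. Let $\mathcal F_2(d+1,n)$ be the space of two-dimensional foliations of degree $d+1$ on $\mathbb P^n$, that is, the set of classes, up to non-zero scalars, of integrable $(n-2)$-forms $\Omega$ on $\mathbb C^{n+1}$ with homogeneous coefficients of degree $d+2$, with $i_{R_{n+1}}\Omega=0$ and with singular set of codimension at least $2$; it is a subset of the projective space of homogeneous forms of this kind with $i_{R_{n+1}}\Omega=0$ and carries the Zariski topology. Let $\mathcal F(\mathfrak P,\lambda,d+1)\subset\mathcal F_2(d+1,n)$ be the set of the foliations which, in some affine chart $\mathbb C^n\subset\mathbb P^n$ (a chart $x\mapsto T(x_1:\dots:x_n:1)$ with $T\in\mathrm{Aut}(\mathbb P^n)$), are defined by the form $i_Si_X\nu_n$ for some polynomial vector field $X$ on $\mathbb C^n$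 with $[S,X]=\lambda X$, and let $\overline{\mathcal F(\mathfrak P,\lambda,d+1)}$ be its Zariski closure in $\mathcal F_2(d+1,n)$. Let $W_0$ be the finite-dimensional complex vector space of polynomial vector fields $Y$ on $\mathbb C^n$ such that $[S,Y]=\lambda Y$, $\operatorname{div}Y=0$, $\deg Y\le d+1$ and $i_{R_n}i_Si_{\hat Y_{d+1}}\nu_n=0$, where $\hat Y_{d+1}$ is the homogeneous part of $Y$ of degree $d+1$; let $V_0=\mathbb P(W_0)$ be its projectivization, of dimension $\dim W_0-1$. 1. If $d\ge 2$ and $\mathcal F(\mathfrak P,\lambda,d+1)\neq\emptyset$, then $\dim\overline{\mathcal F(\mathfrak P,\lambda,d+1)}=\dim V_0+n^2+n$. 2. If $d=1$, $\lambda\ne 0$ and $\mathcal F(\mathfrak P,\lambda,2)\neq\emptyset$, then $\dim\overline{\mathcal F(\mathfrak P,\lambda,2)}=\dim V_0+n^2+n-1$. 3. If $d=1$ and $\lambda=0$, then $\dim\overline{\mathcal F(\mathfrak P,0,2)}=n^2+2n-2$. -/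

import Mathlib

open scoped LinearAlgebra.Projectivization

noncomputable section

namespace ProjFol

/-! ### Algebraic vector fields and differential forms on affine space `ℂ^m` -/

/-- Polynomial functions on `ℂ^m`. -/
abbrev Poly (m : ℕ) : Type := MvPolynomial (Fin m) ℂ

/-- Polynomial vector fields `∑ Xᵢ ∂/∂xᵢ` on `ℂ^m`, given by their components. -/
abbrev VField (m : ℕ) : Type := Fin m → Poly m

/-- Polynomial differential `q`-forms on `ℂ^m`: alternating `q`-linear maps, over the ring of
polynomials, from vector fields to polynomials. -/
abbrev Form (m q : ℕ) : Type := VField m [⋀^Fin q]→ₗ[Poly m] Poly m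

/-- The Lie bracket `[X, Y]`, with `i`-th component `X(Yᵢ) - Y(Xᵢ)`. -/
def bracket {m : ℕ} (X Y : VField m) : VField m := fun i =>
  ∑ j, (X j * MvPolynomial.pderiv j (Y i) - Y j * MvPolynomial.pderiv j (X i))

/-- The divergence `∑ ∂Xᵢ/∂xᵢ`. -/
def divergence {m : ℕ} (X : VField m) : Poly m := ∑ i, MvPolynomial.pderiv i (X i)

/-- The radial vector field `∑ xᵢ ∂/∂xᵢ`. -/
def radial (m : ℕ) : VField m := fun i => MvPolynomial.X i

/-- The diagonal vector field `S = ∑ pᵢ xᵢ ∂/∂xᵢ`. -/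
def diagField {m : ℕ} (p : Fin m → ℕ) : VField m := fun i => p i • MvPolynomial.X i

/-- The part of a vector field which is homogeneous of degree `k`. -/
def homPart {m : ℕ} (k : ℕ) (Y : VField m) : VField m := fun i =>
  MvPolynomial.homogeneousComponent k (Y i)

/-- The coordinate vector field `∂/∂xᵢ`. -/
def coordField {m : ℕ} (i : Fin m) : VField m := Pi.single i 1

/-- The coefficient of a form on `dx_{I 0} ∧ ⋯ ∧ dx_{I (q-1)}`. -/
def coeffForm {m q : ℕ} (Ω : Form m q) (I : Fin q → Fin m) : Poly m :=
  Ω fun k => coordField (I k)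

/-- `i_Z Ω = 0`: the form `Ω` vanishes as soon as one of its arguments is `Z`. -/
def ContractZero {m q : ℕ} (Z : VField m) (Ω : Form m q) : Prop :=
  ∀ (w : Fin q → VField m) (i : Fin q), w i = Z → Ω w = 0

/-- The volume form `dx₁ ∧ ⋯ ∧ dx_m`. -/
def volForm (m : ℕ) : Form m m := Matrix.detRowAlternating

/-- The form `i_S i_X (dx₁ ∧ ⋯ ∧ dx_{q+2})`, of degree `q`. -/
def contractVol {q : ℕ} (S X : VField (q + 2)) : Form (q + 2) q :=
  ((volForm (q + 2)).curryLeft X).curryLeft S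

/-- The differential `df`, as a linear form on vector fields. -/
def differential {m : ℕ} (f : Poly m) : VField m →ₗ[Poly m] Poly m :=
  ∑ j, MvPolynomial.pderiv j f • LinearMap.proj j

/-- The form `df₁ ∧ ⋯ ∧ df_q`. -/
def wedgeDiff {m q : ℕ} (f : Fin q → Poly m) : Form m q :=
  (Matrix.detRowAlternating : (Fin q → Poly m) [⋀^Fin q]→ₗ[Poly m] Poly m).compLinearMap
    (LinearMap.pi fun k => differential (f k))

/-- The exterior derivative `d(∑ Ω_I dx_I) = ∑ dΩ_I ∧ dx_I`, the sum being over increasing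
multi-indices `I`. -/
def extDer {m q : ℕ} (Ω : Form m q) : Form m (q + 1) :=
  ∑ I : Fin q ↪o Fin m,
    wedgeDiff (Fin.cons (coeffForm Ω I) fun k => MvPolynomial.X (I k))

/-- The pull-back of a form on `ℂ^m` under a polynomial map `φ : ℂ^k → ℂ^m`:
`φ^*(∑ Ω_I dx_I) = ∑ (Ω_I ∘ φ) dφ_I`, the sum being over increasing multi-indices `I`. -/
def pullback {m k q : ℕ} (φ : Fin m → Poly k) (Ω : Form m q) : Form k q :=
  ∑ I : Fin q ↪o Fin m,
    MvPolynomial.aeval φ (coeffForm Ω I) • wedgeDiff fun j => φ (I j)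

/-- Integrability of a `q`-form. The first relation says `(i_v Ω) ∧ Ω = 0` for every
`(q-1)`-vector `v` (Plücker's relations: `Ω` is decomposable at its non-singular points), the second
one `(i_v Ω) ∧ dΩ = 0` (Frobenius' condition). The one-form `i_v Ω` is written as
`u ↦ Ω (w₁, …, u, …, w_q)`, with `u` in the `i`-th place. -/
def IsIntegrable {m q : ℕ} (Ω : Form m q) : Prop :=
  ∀ (w : Fin q → VField m) (i : Fin q),
    (∀ u : Fin (q + 1) → VField m,
      ∑ k : Fin (q + 1), (-1 : Poly m) ^ (k : ℕ) *
        (Ω (Function.update w i (u k)) * Ω fun j => u (k.succAbove j)) = 0) ∧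
    (∀ u : Fin (q + 2) → VField m,
      ∑ k : Fin (q + 2), (-1 : Poly m) ^ (k : ℕ) *
        (Ω (Function.update w i (u k)) * extDer Ω fun j => u (k.succAbove j)) = 0)

/-- The ideal of the singular set of `Ω`, generated by the coefficients of `Ω`. -/
def singIdeal {m q : ℕ} (Ω : Form m q) : Ideal (Poly m) := Ideal.span (Set.range (coeffForm Ω))

/-! ### The Zariski topology of a projective space -/

/-- The Zariski topology on the projectivization `ℙ(V)`: a basis is given by the sets where a
homogeneous polynomial function on `V` (a homogeneous polynomial in linear forms on `V`) does not
vanish. -/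
@[reducible] def zariskiTopology (V : Type*) [AddCommGroup V] [Module ℂ V] : TopologicalSpace (ℙ ℂ V) :=
  TopologicalSpace.generateFrom
    {U | ∃ (k : ℕ) (f : MvPolynomial (Module.Dual ℂ V) ℂ), f.IsHomogeneous k ∧
      U = {x | MvPolynomial.eval (fun l : Module.Dual ℂ V => l x.rep) f ≠ 0}}

/-- The Zariski closure of `A` in a subset `B` of `ℙ(V)`. -/
def zariskiClosureIn {V : Type*} [AddCommGroup V] [Module ℂ V] (A B : Set (ℙ ℂ V)) :
    Set (ℙ ℂ V) :=
  letI := zariskiTopology V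
  closure A ∩ B

/-- The dimension of a subset of `ℙ(V)`: the Krull dimension of its Zariski topology (`⊥` for the
empty set). -/
def zariskiDim {V : Type*} [AddCommGroup V] [Module ℂ V] (A : Set (ℙ ℂ V)) : WithBot ℕ∞ :=
  letI := zariskiTopology V
  topologicalKrullDim A

/-! ### Foliations on `ℙ^n` -/

/-- The vector space of `q`-forms `Ω` on `ℂ^{n+1}` whose coefficients are homogeneous polynomials of
degree `e + 1` and which satisfy `i_R Ω = 0`, where `R` is the radial vector field. -/
def twistedForms (n q e : ℕ) : Submodule ℂ (Form (n + 1) q) where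
  carrier := {Ω | (∀ I, (coeffForm Ω I).IsHomogeneous (e + 1)) ∧ ContractZero (radial (n + 1)) Ω}
  add_mem' := by
    rintro a b ⟨ha, ha'⟩ ⟨hb, hb'⟩
    refine ⟨fun I => (ha I).add (hb I), fun w i h => ?_⟩
    simp [ha' w i h, hb' w i h]
  zero_mem' := ⟨fun I => MvPolynomial.isHomogeneous_zero _ _ _, fun w i h => rfl⟩
  smul_mem' := by
    rintro c a ⟨ha, ha'⟩
    refine ⟨fun I => ?_, fun w i h => ?_⟩
    · have : coeffForm (c • a) I = MvPolynomial.C c * coeffForm a I :=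
        MvPolynomial.smul_eq_C_mul _ _
      rw [this]
      simpa using (MvPolynomial.isHomogeneous_C _ c).mul (ha I)
    · simp [ha' w i h]

/-- The space of foliations of codimension `q` and degree `e` on `ℙ^n`: classes, up to non-zero
scalars, of integrable forms in `twistedForms n q e` with singular set of codimension at least 2. -/
def foliations (n q e : ℕ) : Set (ℙ ℂ (twistedForms n q e)) :=
  {x | ∃ (Ω : twistedForms n q e) (hΩ : Ω ≠ 0), x = Projectivization.mk ℂ Ω hΩ ∧
    IsIntegrable Ω.1 ∧ 2 ≤ (singIdeal Ω.1).height}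

/-- The affine chart `(x₁, …, x_n) ↦ T (x₁ : ⋯ : x_n : 1)` of `ℙ^n` given by `T ∈ GL(n+1, ℂ)`, in
homogeneous coordinates. -/
def affineChart {n : ℕ} (T : GL (Fin (n + 1)) ℂ) : Fin (n + 1) → Poly n := fun i =>
  ∑ j, MvPolynomial.C (T.1 i j) *
    (Fin.snoc (α := fun _ => Poly n) (fun k => MvPolynomial.X k) 1 : Fin (n + 1) → Poly n) j

/-- With `n = q + 2`: the set of two-dimensional foliations of degree `e` on `ℙ^n` which, in some
affine chart, are defined by `i_S i_X (dx₁ ∧ ⋯ ∧ dx_n)`, where `S = ∑ pᵢ xᵢ ∂/∂xᵢ` and `X` is a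
polynomial vector field with `[S, X] = lam X`. -/
def affFamily {q : ℕ} (p : Fin (q + 2) → ℕ) (lam : ℤ) (e : ℕ) :
    Set (ℙ ℂ (twistedForms (q + 2) q e)) :=
  {x | x ∈ foliations (q + 2) q e ∧
    ∃ (Ω : twistedForms (q + 2) q e) (hΩ : Ω ≠ 0), x = Projectivization.mk ℂ Ω hΩ ∧
      ∃ (T : GL (Fin (q + 2 + 1)) ℂ) (X : VField (q + 2)),
        bracket (diagField p) X = lam • X ∧
        pullback (affineChart T) Ω.1 = contractVol (diagField p) X}

/-- The Zariski closure of the family in the space of foliations. -/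
def affFamilyClosure {q : ℕ} (p : Fin (q + 2) → ℕ) (lam : ℤ) (e : ℕ) :
    Set (ℙ ℂ (twistedForms (q + 2) q e)) :=
  zariskiClosureIn (affFamily p lam e) (foliations (q + 2) q e)

/-- The space `W₀` of polynomial vector fields `Y` on `ℂ^{q+2}` with `[S, Y] = lam Y`,
`div Y = 0`, `deg Y ≤ d + 1` and `i_R i_S i_Z (dx₁ ∧ ⋯ ∧ dx_{q+2}) = 0`, where `Z` is the homogeneous
part of degree `d + 1` of `Y`. -/
def W₀ {q : ℕ} (p : Fin (q + 2) → ℕ) (lam : ℤ) (d : ℕ) : Submodule ℂ (VField (q + 2)) where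
  carrier := {Y | bracket (diagField p) Y = lam • Y ∧ divergence Y = 0 ∧
    (∀ i, (Y i).totalDegree ≤ d + 1) ∧
    ContractZero (radial (q + 2)) (contractVol (diagField p) (homPart (d + 1) Y))}
  add_mem' := by
    rintro a b ⟨h1, h2, h3, h4⟩ ⟨k1, k2, k3, k4⟩
    refine ⟨?_, ?_, ?_, ?_⟩
    · rw [smul_add, ← h1, ← k1]
      funext i
      simp only [bracket, Pi.add_apply, map_add, ← Finset.sum_add_distrib]
      exact Finset.sum_congr rfl fun j _ => by ring
    · have : divergence (a + b) = divergence a + divergence b := by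
        simp [divergence, Finset.sum_add_distrib]
      rw [this, h2, k2, add_zero]
    · exact fun i => (MvPolynomial.totalDegree_add _ _).trans (max_le (h3 i) (k3 i))
    · intro w i h
      have : homPart (d + 1) (a + b) = homPart (d + 1) a + homPart (d + 1) b := by
        funext j; simp [homPart]
      have e1 := h4 w i h
      have e2 := k4 w i h
      simp only [contractVol] at e1 e2 ⊢
      simp [this, e1, e2]
  zero_mem' := by
    refine ⟨?_, ?_, ?_, ?_⟩
    · funext i; simp [bracket]
    · simp [divergence]
    · simp
    · intro w i h
      have : homPart (d + 1) (0 : VField (q + 2)) = 0 := by funext j; simp [homPart]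
      simp [contractVol, this]
  smul_mem' := by
    rintro c a ⟨h1, h2, h3, h4⟩
    refine ⟨?_, ?_, ?_, ?_⟩
    · rw [smul_comm, ← h1]
      funext i
      simp only [bracket, Pi.smul_apply, Finset.smul_sum, MvPolynomial.smul_eq_C_mul,
        MvPolynomial.pderiv_C_mul]
      exact Finset.sum_congr rfl fun j _ => by ring
    · have : divergence (c • a) = c • divergence a := by
        simp [divergence, Finset.smul_sum]
      rw [this, h2, smul_zero]
    · exact fun i => (MvPolynomial.totalDegree_smul_le c _).trans (h3 i)
    · intro w i h
      have : homPart (d + 1) (c • a) =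
          (MvPolynomial.C c : Poly (q + 2)) • homPart (d + 1) a := by
        funext j; simp [homPart, MvPolynomial.smul_eq_C_mul]
      have e1 := h4 w i h
      simp only [contractVol] at e1 ⊢
      simp [this, e1]

/-- The dimension of the projective space `V₀ = ℙ(W₀)`. It is used only when `W₀ ≠ 0`. -/
def dimV₀ {q : ℕ} (p : Fin (q + 2) → ℕ) (lam : ℤ) (d : ℕ) : ℕ :=
  Module.finrank ℂ (W₀ p lam d) - 1

end ProjFol

end

/-! Put n = q + 2, A = diag(p_1, …, p_n, 0), R the radial field and ν the volume form of ℂ^(n+1). In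
homogeneous coordinates the affine condition becomes linear: a twisted form restricts in the
standard chart to i_S i_X ν_n with [S, X] = λX exactly when it is i_A i_Z i_R ν with Z homogeneous
of degree d and [A, Z] = λZ (`mem_weightForms_iff`). These forms make up a vector space U
(`weightForms`). Normalizing X modulo multiples of S so that its divergence vanishes, and reading
off its behaviour at the hyperplane at infinity, identifies U with W₀ (`finrank_weightForms`), so
that dim V₀ = dim U − 1 when U ≠ 0.

All forms in U are integrable, and having no divisorial zeros is an open condition. Hence the family
is the orbit under GL(n+1) of an open subset of ℙ(U), nonempty as soon as U contains one form
without divisorial zeros. Its dimension is the generic rank of (T, Ω) ↦ T^*Ω on matrices × U, minus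
one. At (1, Ω) the differential is (B, Ω') ↦ L_BΩ + Ω', with kernel isomorphic to K(Ω) = {B : L_BΩ ∈
U} (`symMat`). This gives the dimension (n+1)² + dim U − dim K(Ω) − 1
(`zariskiDim_affFamilyClosure`).

It remains to find K(Ω). Diagonal matrices commute with A and belong to it (`diagMat_le_symMat`), so
dim K(Ω) ≥ n + 1. Conversely, contract L_BΩ ∈ U with A: only the term containing [A, B] survives,
and since Ω has no divisorial zeros this forces i_A i_[A,B] i_R ν = gΩ for a polynomial g
(`exists_thetaComm_eq_mul`). The left side has degree 3 and Ω has degree d + 2. If d ≥ 2, then g =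
0, the off-diagonal part of [A, B] vanishes, and B is diagonal because the weights are distinct; so
dim K(Ω) = n + 1. If d = 1, then g is constant and Z is given by a matrix M. For λ ≠ 0 the constant
g accounts for at most one further dimension, and M supplies it, because L_MΩ = tr(M)Ω; so dim K(Ω)
= n + 2. For λ = 0 the matrix M is diagonal, which again forces B to be diagonal; here U consists of
diagonal fields modulo R and A, of dimension n − 1, and a Vandermonde determinant shows that the
field with eigenvalues p_i² defines a form without divisorial zeros.

Ranks become Krull dimensions through algebraic independence. A strict chain of irreducible closed
sets produces algebraically independent polynomials in the parameters (`zariskiDim_closureIn_le`),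
independent derivatives produce such a chain (`le_zariskiDim`), and in characteristic zero algebraic
independence is detected by the Jacobian matrix. -/

noncomputable section

namespace ProjFol

/-! ### Algebraic independence and Jacobians -/

/-- A derivation which vanishes on a set `s` such that the domain `A` is algebraic over `ℂ[s]`
vanishes identically. -/
theorem derivation_eq_zero_of_isAlgebraic_adjoin {A M : Type*} [CommRing A] [IsDomain A]
    [Algebra ℂ A] [AddCommGroup M] [Module A M] [Module ℂ M] [IsScalarTower ℂ A M]
    [Module.IsTorsionFree A M] (s : Set A)
    [Algebra.IsAlgebraic (Algebra.adjoin ℂ s) A] (D : Derivation ℂ A M) (hD : ∀ b ∈ s, D b = 0)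
    (y : A) : D y = 0 := by
  have hR : ∀ b ∈ Algebra.adjoin ℂ s, D b = 0 := by
    intro b hb
    induction hb using Algebra.adjoin_induction with
    | mem x hx => exact hD x hx
    | algebraMap r => simp
    | add x y _ _ hx hy => simp [hx, hy]
    | mul x y _ _ hx hy => simp [hx, hy]
  let D' : Derivation (Algebra.adjoin ℂ s) A M :=
    { toFun := D
      map_add' := D.map_add
      map_smul' := fun r x => by
        change D ((r : A) * x) = (r : A) • D x
        rw [D.leibniz, hR r r.2, smul_zero, add_zero]
      map_one_eq_zero' := D.map_one_eq_zero
      leibniz' := D.leibniz }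
  have hy : IsAlgebraic (Algebra.adjoin ℂ s) y := Algebra.IsAlgebraic.isAlgebraic y
  obtain ⟨P, hP, hPy⟩ := hy
  have : CharZero (Algebra.adjoin ℂ s) := 
    charZero_of_injective_algebraMap (algebraMap ℂ (Algebra.adjoin ℂ s)).injective
  have : IsAddTorsionFree (Algebra.adjoin ℂ s) := inferInstance
  -- Differentiating a relation P(y) = 0 gives P'(y) D(y) = 0. Either P'(y) ≠ 0, or P' is a relation
  -- of smaller degree; in characteristic zero P' = 0 only for constants.
  have main : ∀ (n : ℕ) (P : Polynomial (Algebra.adjoin ℂ s)), P.natDegree ≤ n → P ≠ 0 →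
      Polynomial.aeval y P = 0 → D' y = 0 := by
    intro n
    induction n with
    | zero =>
      intro P hn hP hPy
      rw [Polynomial.eq_C_of_natDegree_le_zero hn] at hPy hP
      simp only [Polynomial.aeval_C] at hPy
      exfalso
      apply hP
      have : P.coeff 0 = 0 := Subtype.ext hPy
      rw [this, map_zero]
    | succ n ih =>
      intro P hn hP hPy
      have h := D'.map_aeval P y
      rw [hPy, map_zero] at h
      by_cases hd : Polynomial.aeval y (Polynomial.derivative P) = 0
      · by_cases hP' : Polynomial.derivative P = 0
        · have : P.natDegree = 0 := Polynomial.derivative_eq_zero.1 hP'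
          rw [Polynomial.eq_C_of_natDegree_le_zero this.le] at hPy hP
          simp only [Polynomial.aeval_C] at hPy
          exfalso
          apply hP
          have : P.coeff 0 = 0 := Subtype.ext hPy
          rw [this, map_zero]
        · refine ih _ ?_ hP' hd
          have := Polynomial.natDegree_derivative_le P
          omega
      · exact (smul_eq_zero.1 h.symm).resolve_left hd
  exact main _ P le_rfl hP hPy

/-- Extend the family to a transcendence basis of ℂ[σ], which has as many members as σ. Its
gradients span K^σ over the fraction field K: a nonzero functional killing them would give a nonzero
derivation vanishing on a transcendence basis. By counting they form a basis, so the gradients of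
the original family are independent over K. The polynomial δ is a common denominator for a right
inverse of the Jacobian matrix, which therefore specializes wherever δ does not vanish. -/
theorem exists_jacobian_linearIndependent {σ ι : Type} [Fintype σ] [Fintype ι]
    {x : ι → MvPolynomial σ ℂ} (hx : AlgebraicIndependent ℂ x) :
    ∃ δ : MvPolynomial σ ℂ, δ ≠ 0 ∧ ∀ a : σ → ℂ, MvPolynomial.eval a δ ≠ 0 →
      LinearIndependent ℂ fun i j => MvPolynomial.eval a (MvPolynomial.pderiv j (x i)) := by
  classical
  let A := MvPolynomial σ ℂ
  let K := FractionRing A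
  let d : Derivation ℂ A (σ → K) :=
    { toFun := fun f j => algebraMap A K (MvPolynomial.pderiv j f)
      map_add' := fun f g => by funext j; simp
      map_smul' := fun c f => by
        funext j
        change algebraMap A K (MvPolynomial.pderiv j (c • f)) =
          c • algebraMap A K (MvPolynomial.pderiv j f)
        rw [Derivation.map_smul, algebraMap.smul]
      map_one_eq_zero' := by funext j; simp
      leibniz' := fun f g => by
        funext j
        simp [Algebra.smul_def] }
  have hxs : AlgebraicIndepOn ℂ id (Set.range x) := hx.coe_range
  obtain ⟨u, hsu, hu⟩ := exists_isTranscendenceBasis_superset hxs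
  have hcard : Cardinal.mk u = Cardinal.mk σ := by
    have h1 := hu.cardinalMk_eq_trdeg
    have h2 : Algebra.trdeg ℂ A = Cardinal.lift.{0} (Cardinal.mk σ) :=
      MvPolynomial.trdeg_of_isDomain
    rw [h1, h2, Cardinal.lift_id]
  have : Finite u := by
    rw [← Cardinal.lt_aleph0_iff_finite, hcard]
    exact Cardinal.lt_aleph0_of_finite σ
  have : Fintype u := Fintype.ofFinite u
  have halg : Algebra.IsAlgebraic (Algebra.adjoin ℂ u) A := by
    have := hu.isAlgebraic
    rwa [Subtype.range_coe] at this
  let M : Submodule K (σ → K) := Submodule.span K (Set.range fun b : u => d b)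
  have hMtop : M = ⊤ := by
    by_contra hne
    obtain ⟨φ, hφ, hMφ⟩ := M.exists_le_ker_of_lt_top (lt_top_iff_ne_top.2 hne)
    let D : Derivation ℂ A K := (φ.restrictScalars A).compDer d
    have hD : ∀ y, D y = 0 := derivation_eq_zero_of_isAlgebraic_adjoin u D fun b hb =>
      hMφ (Submodule.subset_span ⟨⟨b, hb⟩, rfl⟩)
    refine hφ (LinearMap.pi_ext' fun j => LinearMap.ext_ring ?_)
    have := hD (MvPolynomial.X j)
    change φ (d (MvPolynomial.X j)) = 0 at this
    rw [LinearMap.comp_apply, LinearMap.single_apply, LinearMap.zero_comp, LinearMap.zero_apply,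
      ← this]
    congr 1
    funext k
    change (Pi.single j (1 : K) : σ → K) k = algebraMap A K (MvPolynomial.pderiv k (MvPolynomial.X j))
    rw [MvPolynomial.pderiv_X]
    rcases eq_or_ne k j with rfl | hkj
    · simp
    · rw [Pi.single_eq_of_ne hkj, Pi.single_eq_of_ne hkj.symm, map_zero]
  have hcard' : Fintype.card u = Module.finrank K (σ → K) := by
    rw [Module.finrank_fintype_fun_eq_card]
    exact Fintype.card_eq.2 (Cardinal.eq.1 hcard)
  have hind : LinearIndependent K fun b : u => d b :=
    linearIndependent_of_top_le_span_of_card_eq_finrank hMtop.ge hcard'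
  have hind' : LinearIndependent K fun i : ι => d (x i) :=
    hind.comp (fun i => ⟨x i, hsu ⟨i, rfl⟩⟩) fun i j h =>
      hx.injective (congrArg Subtype.val h)
  -- a right inverse with denominators cleared
  let J : Matrix ι σ K := fun i => d (x i)
  obtain ⟨N, hN⟩ : ∃ N : Matrix σ ι K, J * N = 1 := by
    rw [← Matrix.mulVec_surjective_iff_exists_right_inverse]
    have : LinearIndependent K J.row := hind'
    rw [← Matrix.coe_mulVecLin, ← LinearMap.range_eq_top]
    apply Submodule.eq_top_of_finrank_eq
    have h1 := this.rank_matrix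
    rw [Matrix.rank] at h1
    rw [h1, Module.finrank_fintype_fun_eq_card]
  obtain ⟨δ, hδ⟩ := IsLocalization.exist_integer_multiples_of_finite (nonZeroDivisors A)
    fun ji : σ × ι => N ji.1 ji.2
  choose N' hN' using hδ
  refine ⟨δ, nonZeroDivisors.ne_zero δ.2, fun a ha => ?_⟩
  have hJN : (Matrix.of fun i j => MvPolynomial.pderiv j (x i)) *
      (Matrix.of fun j i => N' (j, i)) = (δ : A) • (1 : Matrix ι ι A) := by
    ext1 i k
    apply IsFractionRing.injective A K
    have := congrFun (congrFun hN i) k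
    rw [Matrix.mul_apply] at this ⊢
    simp only [Matrix.of_apply, map_sum, map_mul, hN', Matrix.smul_apply, smul_eq_mul]
    have h2 : algebraMap A K ((1 : Matrix ι ι A) i k) = (1 : Matrix ι ι K) i k := by
      simp only [Matrix.one_apply]; split_ifs <;> simp
    rw [h2, ← this, Finset.mul_sum]
    refine Finset.sum_congr rfl fun j _ => ?_
    change algebraMap A K (MvPolynomial.pderiv j (x i)) * ((δ : A) • N j k) =
      algebraMap A K δ * (algebraMap A K (MvPolynomial.pderiv j (x i)) * N j k)
    rw [Algebra.smul_def]
    ring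
  have hev : (Matrix.of fun i j => MvPolynomial.eval a (MvPolynomial.pderiv j (x i))) *
      (Matrix.of fun j i => MvPolynomial.eval a (N' (j, i))) =
        MvPolynomial.eval a (δ : A) • (1 : Matrix ι ι ℂ) := by
    ext i k
    have := congrArg (MvPolynomial.eval a) (congrFun (congrFun hJN i) k)
    simp only [Matrix.mul_apply, Matrix.of_apply, map_sum, map_mul, Matrix.smul_apply,
      smul_eq_mul] at this ⊢
    rw [this]
    congr 1
    simp only [Matrix.one_apply]; split_ifs <;> simp
  rw [← Matrix.of_row (fun i j => MvPolynomial.eval a (MvPolynomial.pderiv j (x i)))]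
  apply Matrix.vecMul_injective_iff.1
  intro v w hvw
  have := congrArg (fun z => Matrix.vecMul z
    (Matrix.of fun j i => MvPolynomial.eval a (N' (j, i)))) hvw
  simp only [Matrix.vecMul_vecMul, hev, Matrix.vecMul_smul, Matrix.vecMul_one] at this
  exact smul_right_injective _ ha this

theorem eq_C_of_pderiv_eq_zero {ι : Type} {G : MvPolynomial ι ℂ}
    (h : ∀ i, MvPolynomial.pderiv i G = 0) : G = MvPolynomial.C (G.coeff 0) := by
  classical
  ext m
  rw [MvPolynomial.coeff_C]
  split_ifs with hm
  · rw [hm]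
  · obtain ⟨i, hi⟩ : ∃ i, m i ≠ 0 := by
      by_contra! hcon
      exact hm (Finsupp.ext fun i => (hcon i).symm)
    have h1 := congrArg (MvPolynomial.coeff (m - Finsupp.single i 1)) (h i)
    rw [MvPolynomial.coeff_pderiv, MvPolynomial.coeff_zero, tsub_add_cancel_of_le
      (Finsupp.single_le_iff.2 (Nat.one_le_iff_ne_zero.2 hi))] at h1
    exact (mul_eq_zero.1 h1).resolve_right (Nat.cast_add_one_ne_zero _)

theorem pderiv_aeval {σ ι : Type} [Fintype ι] (g : ι → MvPolynomial σ ℂ) (k : σ)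
    (G : MvPolynomial ι ℂ) : MvPolynomial.pderiv k (MvPolynomial.aeval g G) =
      ∑ i, MvPolynomial.aeval g (MvPolynomial.pderiv i G) * MvPolynomial.pderiv k (g i) := by
  classical
  induction G using MvPolynomial.induction_on with
  | C a => simp [MvPolynomial.algebraMap_eq]
  | add p q hp hq => simp only [map_add, hp, hq, Finset.sum_add_distrib, add_mul]
  | mul_X p i hp =>
    rw [map_mul, Derivation.leibniz, hp]
    have h1 : ∑ j, MvPolynomial.aeval g p * MvPolynomial.aeval g
        ((Pi.single j 1 : ι → MvPolynomial ι ℂ) i) *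
        MvPolynomial.pderiv k (g j) = MvPolynomial.aeval g p * MvPolynomial.pderiv k (g i) := by
      rw [Finset.sum_eq_single i]
      · rw [Pi.single_eq_same, map_one, mul_one]
      · intro j _ hj
        rw [Pi.single_eq_of_ne hj.symm, map_zero, mul_zero, zero_mul]
      · simp
    simp only [mul_assoc] at h1
    simp only [map_mul, MvPolynomial.aeval_X, Derivation.leibniz, smul_eq_mul,
      MvPolynomial.pderiv_X, map_add, add_mul, Finset.sum_add_distrib, h1, Finset.mul_sum,
      mul_assoc]

/-- Differentiating a relation G(g) = 0 shows that the ∂G/∂x_i, evaluated at g, form a left kernel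
vector of the Jacobian matrix; if this kernel is trivial they are relations of smaller degree, and
descent ends at a constant. Independence at the single point `a` suffices for the kernel: a constant
right inverse N of the Jacobian at `a` makes det(J·N) nonzero at `a`. -/
theorem algebraicIndependent_of_jacobian {σ ι : Type} [Fintype σ] [Fintype ι]
    (g : ι → MvPolynomial σ ℂ) (a : σ → ℂ)
    (ha : LinearIndependent ℂ fun i j => MvPolynomial.eval a (MvPolynomial.pderiv j (g i))) :
    AlgebraicIndependent ℂ g := by
  classical
  let J : Matrix ι σ (MvPolynomial σ ℂ) := Matrix.of fun i j => MvPolynomial.pderiv j (g i)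
  obtain ⟨N, hN⟩ : ∃ N : Matrix σ ι ℂ, J.map (MvPolynomial.eval a) * N = 1 := by
    rw [← Matrix.mulVec_surjective_iff_exists_right_inverse, ← Matrix.coe_mulVecLin,
      ← LinearMap.range_eq_top]
    apply Submodule.eq_top_of_finrank_eq
    have : LinearIndependent ℂ (J.map (MvPolynomial.eval a)).row := ha
    have h1 := this.rank_matrix
    rw [Matrix.rank] at h1
    rw [h1, Module.finrank_fintype_fun_eq_card]
  have hdet : (J * (N.map MvPolynomial.C : Matrix σ ι (MvPolynomial σ ℂ))).det ≠ 0 := by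
    intro h0
    have h1 := congrArg (MvPolynomial.eval a) h0
    rw [RingHom.map_det, map_zero, RingHom.mapMatrix_apply, Matrix.map_mul] at h1
    have h2 : (N.map MvPolynomial.C).map (MvPolynomial.eval a) = N := by
      ext i j; simp
    rw [h2, hN, Matrix.det_one] at h1
    exact one_ne_zero h1
  have hJ : ∀ c : ι → MvPolynomial σ ℂ, Matrix.vecMul c J = 0 → c = 0 := by
    intro c hc
    apply Matrix.eq_zero_of_vecMul_eq_zero hdet
    rw [← Matrix.vecMul_vecMul, hc, Matrix.zero_vecMul]
  have main : ∀ (n : ℕ) (G : MvPolynomial ι ℂ), G.totalDegree ≤ n → MvPolynomial.aeval g G = 0 →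
      G = 0 := by
    intro n
    induction n with
    | zero =>
      intro G hn hG
      rw [MvPolynomial.totalDegree_eq_zero_iff_eq_C.1 (Nat.le_zero.1 hn)] at hG ⊢
      rw [MvPolynomial.aeval_C] at hG
      have : G.coeff 0 = 0 := by
        rwa [MvPolynomial.algebraMap_eq, MvPolynomial.C_eq_zero] at hG
      rw [this, map_zero]
    | succ n ih =>
      intro G hn hG
      have h1 : (fun i => MvPolynomial.aeval g (MvPolynomial.pderiv i G)) = 0 := by
        apply hJ
        funext k
        have := pderiv_aeval g k G
        rw [hG, map_zero] at this
        exact this.symm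
      have h2 : ∀ i, MvPolynomial.pderiv i G = 0 := fun i => by
        refine ih _ ?_ (congrFun h1 i)
        refine Finset.sup_le fun m hm => ?_
        rw [MvPolynomial.mem_support_iff, MvPolynomial.coeff_pderiv] at hm
        have h3 := MvPolynomial.le_totalDegree
          (MvPolynomial.mem_support_iff.2 (left_ne_zero_of_mul hm))
        have h4 : ((m + Finsupp.single i 1).sum fun _ e => e) = (m.sum fun _ e => e) + 1 := by
          rw [Finsupp.sum_add_index' (fun _ => rfl) (fun _ _ _ => rfl)]
          simp
        omega
      rw [eq_C_of_pderiv_eq_zero h2] at hG ⊢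
      rw [MvPolynomial.aeval_C, MvPolynomial.algebraMap_eq, MvPolynomial.C_eq_zero] at hG
      rw [hG, map_zero]
  rw [algebraicIndependent_iff]
  exact fun G hG => main _ G le_rfl hG

/-- Given elements which are algebraically independent modulo a prime ideal, a smaller prime ideal
admits one more such element. -/
theorem exists_algebraicIndependent_cons {P : Type*} [CommRing P] [Algebra ℂ P] {I J : Ideal P}
    [hI : I.IsPrime] (hIJ : I < J) {k : ℕ} (f : Fin k → P)
    (hf : ∀ G : MvPolynomial (Fin k) ℂ, MvPolynomial.aeval f G ∈ J → G = 0) :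
    ∃ x : P, ∀ G : MvPolynomial (Fin (k + 1)) ℂ,
      MvPolynomial.aeval (Fin.cons x f : Fin (k + 1) → P) G ∈ I → G = 0 := by
  obtain ⟨x, hxJ, hxI⟩ := SetLike.exists_of_lt hIJ
  refine ⟨x, ?_⟩
  -- View G as a polynomial in the new variable. Modulo J only its constant coefficient survives,
  -- since x ∈ J, so that coefficient is zero; G is then divisible by the variable, and x can be
  -- cancelled modulo the prime I because x ∉ I.
  have main : ∀ (n : ℕ) (G : Polynomial (MvPolynomial (Fin k) ℂ)), G.natDegree ≤ n →
      Polynomial.eval₂ (MvPolynomial.aeval f : MvPolynomial (Fin k) ℂ →ₐ[ℂ] P).toRingHom x G ∈ I →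
      G = 0 := by
    intro n
    induction n with
    | zero =>
      intro G hn hG
      rw [Polynomial.eq_C_of_natDegree_le_zero hn, Polynomial.eval₂_C] at hG
      rw [Polynomial.eq_C_of_natDegree_le_zero hn, hf _ (hIJ.le hG), map_zero]
    | succ n ih =>
      intro G hn hG
      rw [← Polynomial.divX_mul_X_add G, Polynomial.eval₂_add, Polynomial.eval₂_mul,
        Polynomial.eval₂_X, Polynomial.eval₂_C] at hG
      have h0 : G.coeff 0 = 0 := by
        apply hf
        have := J.sub_mem (hIJ.le hG) (J.mul_mem_left
          (Polynomial.eval₂ (MvPolynomial.aeval f : MvPolynomial (Fin k) ℂ →ₐ[ℂ] P).toRingHom x G.divX)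
          hxJ)
        rwa [add_sub_cancel_left] at this
      rw [h0, map_zero, add_zero] at hG
      have h1 := ih G.divX (by rw [Polynomial.natDegree_divX_eq_natDegree_tsub_one]; omega)
        ((hI.mem_or_mem hG).resolve_right hxI)
      rw [← Polynomial.divX_mul_X_add G, h1, h0, map_zero, zero_mul, add_zero]
  intro G hG
  have hG' := main _ (MvPolynomial.finSuccEquiv ℂ k G) le_rfl (by
    convert hG using 1
    have : (Polynomial.eval₂RingHom (MvPolynomial.aeval f : MvPolynomial (Fin k) ℂ →ₐ[ℂ] P).toRingHom
        x).comp (MvPolynomial.finSuccEquiv ℂ k).toRingEquiv.toRingHom =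
        (MvPolynomial.aeval (Fin.cons x f : Fin (k + 1) → P) :
          MvPolynomial (Fin (k + 1)) ℂ →ₐ[ℂ] P).toRingHom := by
      apply MvPolynomial.ringHom_ext
      · intro r
        change Polynomial.eval₂ _ x (MvPolynomial.finSuccEquiv ℂ k (MvPolynomial.C r)) = _
        rw [MvPolynomial.finSuccEquiv_apply]
        simp
      · intro i
        change Polynomial.eval₂ _ x (MvPolynomial.finSuccEquiv ℂ k (MvPolynomial.X i)) =
          MvPolynomial.aeval (Fin.cons x f : Fin (k + 1) → P) (MvPolynomial.X i)
        refine Fin.cases ?_ (fun j => ?_) i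
        · simp [MvPolynomial.finSuccEquiv_X_zero]
        · simp [MvPolynomial.finSuccEquiv_X_succ]
    exact congrArg (fun h => h G) this)
  exact (map_eq_zero_iff _ (MvPolynomial.finSuccEquiv ℂ k).injective).1 hG'

/-! ### Dimension of subsets of a projective space -/

/-- The value at a vector of a polynomial in linear forms. -/
def polyEval {V : Type*} [AddCommGroup V] [Module ℂ V] (v : V) :
    MvPolynomial (Module.Dual ℂ V) ℂ →+* ℂ :=
  MvPolynomial.eval fun l => l v

section Zariski

variable {V : Type} [AddCommGroup V] [Module ℂ V]

theorem polyEval_smul_of_isHomogeneous {f : MvPolynomial (Module.Dual ℂ V) ℂ} {k : ℕ}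
    (hf : f.IsHomogeneous k) (c : ℂ) (v : V) : polyEval (c • v) f = c ^ k * polyEval v f := by
  simp only [polyEval, map_smul, smul_eq_mul, MvPolynomial.eval_eq, Finset.mul_sum]
  refine Finset.sum_congr rfl fun m hm => ?_
  have hk : ∑ i ∈ m.support, m i = k := by
    have := hf (MvPolynomial.mem_support_iff.1 hm)
    rw [Finsupp.weight_apply, Finsupp.sum] at this
    simpa using this
  simp only [mul_pow, Finset.prod_mul_distrib, Finset.prod_pow_eq_pow_sum, hk]
  ring

/-- Restricted to the line ℂv, f is a polynomial in c whose k-th coefficient is the value at v of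
the part of degree k. This lets relations that are not homogeneous be tested on cones. -/
theorem forall_polyEval_smul_eq_zero_iff (f : MvPolynomial (Module.Dual ℂ V) ℂ) (v : V) :
    (∀ c : ℂ, polyEval (c • v) f = 0) ↔
      ∀ k, polyEval v (MvPolynomial.homogeneousComponent k f) = 0 := by
  have key : ∀ c : ℂ, polyEval (c • v) f =
      (∑ k ∈ Finset.range (f.totalDegree + 1), Polynomial.C
        (polyEval v (MvPolynomial.homogeneousComponent k f)) * Polynomial.X ^ k).eval c := by
    intro c
    conv_lhs => rw [← MvPolynomial.sum_homogeneousComponent f]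
    rw [map_sum, Polynomial.eval_finsetSum]
    refine Finset.sum_congr rfl fun k _ => ?_
    rw [polyEval_smul_of_isHomogeneous (MvPolynomial.homogeneousComponent_isHomogeneous k f)]
    rw [Polynomial.eval_mul, Polynomial.eval_C, Polynomial.eval_pow, Polynomial.eval_X, mul_comm]
  constructor
  · intro h k
    have h0 : (∑ k ∈ Finset.range (f.totalDegree + 1), Polynomial.C
        (polyEval v (MvPolynomial.homogeneousComponent k f)) * Polynomial.X ^ k) = 0 :=
      Polynomial.funext fun c => by rw [← key, h, Polynomial.eval_zero]
    have := congrArg (fun p => Polynomial.coeff p k) h0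
    simp only [Polynomial.finsetSum_coeff, Polynomial.coeff_C_mul_X_pow, Polynomial.coeff_zero] at this
    by_cases hk : k < f.totalDegree + 1
    · rwa [Finset.sum_ite_eq, if_pos (Finset.mem_range.2 hk)] at this
    · rw [MvPolynomial.homogeneousComponent_eq_zero _ _ (by omega), map_zero]
  · intro h c
    rw [key]
    simp [h]

theorem isClosed_polyEval_eq_zero {f : MvPolynomial (Module.Dual ℂ V) ℂ} {k : ℕ}
    (hf : f.IsHomogeneous k) :
    @IsClosed _ (zariskiTopology V) {x : ℙ ℂ V | polyEval x.rep f = 0} := by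
  let _ := zariskiTopology V
  rw [← isOpen_compl_iff]
  exact TopologicalSpace.isOpen_generateFrom_of_mem ⟨k, f, hf, rfl⟩

theorem isTopologicalBasis_zariski :
    @TopologicalSpace.IsTopologicalBasis _ (zariskiTopology V)
      {U : Set (ℙ ℂ V) | ∃ (k : ℕ) (f : MvPolynomial (Module.Dual ℂ V) ℂ), f.IsHomogeneous k ∧
        U = {x | polyEval x.rep f ≠ 0}} := by
  let _ := zariskiTopology V
  have h := TopologicalSpace.isTopologicalBasis_of_subbasis_of_inter
    (r := {U : Set (ℙ ℂ V) | ∃ (k : ℕ) (f : MvPolynomial (Module.Dual ℂ V) ℂ), f.IsHomogeneous k ∧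
        U = {x | polyEval x.rep f ≠ 0}}) rfl ?_
  · rwa [Set.insert_eq_of_mem] at h
    refine ⟨0, 1, MvPolynomial.isHomogeneous_one _ _, ?_⟩
    simp
  · rintro _ ⟨k, f, hf, rfl⟩ _ ⟨l, g, hg, rfl⟩
    refine ⟨k + l, f * g, hf.mul hg, ?_⟩
    ext x
    simp

theorem exists_homogeneous_of_notMem_closure {C : Set (ℙ ℂ V)} {x : ℙ ℂ V}
    (hx : x ∉ @closure _ (zariskiTopology V) C) :
    ∃ (k : ℕ) (f : MvPolynomial (Module.Dual ℂ V) ℂ), f.IsHomogeneous k ∧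
      (∀ y ∈ C, polyEval y.rep f = 0) ∧ polyEval x.rep f ≠ 0 := by
  let _ := zariskiTopology V
  obtain ⟨_, ⟨k, f, hf, rfl⟩, hxf, hsub⟩ :=
    isTopologicalBasis_zariski.exists_subset_of_mem_open (a := x) (u := (closure C)ᶜ) hx
      isClosed_closure.isOpen_compl
  refine ⟨k, f, hf, fun y hy => ?_, hxf⟩
  by_contra hne
  exact hsub hne (subset_closure hy)

/-- The polynomials in linear forms which vanish on the cone over a subset of `ℙ(V)`. -/
def coneIdeal (Z : Set (ℙ ℂ V)) : Ideal (MvPolynomial (Module.Dual ℂ V) ℂ) where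
  carrier := {f | ∀ x ∈ Z, ∀ c : ℂ, polyEval (c • x.rep) f = 0}
  add_mem' := fun {f g} hf hg x hx c => by rw [map_add, hf x hx c, hg x hx c, add_zero]
  zero_mem' := fun x hx c => map_zero _
  smul_mem' := fun r f hf x hx c => by
    rw [smul_eq_mul, map_mul, hf x hx c, mul_zero]

theorem mem_coneIdeal_iff {Z : Set (ℙ ℂ V)} {f : MvPolynomial (Module.Dual ℂ V) ℂ} :
    f ∈ coneIdeal Z ↔
      ∀ x ∈ Z, ∀ k, polyEval x.rep (MvPolynomial.homogeneousComponent k f) = 0 := by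
  change (∀ x ∈ Z, ∀ c : ℂ, polyEval (c • x.rep) f = 0) ↔ _
  simp only [forall_polyEval_smul_eq_zero_iff]

theorem mem_coneIdeal_of_isHomogeneous {Z : Set (ℙ ℂ V)}
    {f : MvPolynomial (Module.Dual ℂ V) ℂ} {k : ℕ} (hf : f.IsHomogeneous k) :
    f ∈ coneIdeal Z ↔ ∀ x ∈ Z, polyEval x.rep f = 0 := by
  refine ⟨fun h x hx => by simpa using h x hx 1, fun h x hx c => ?_⟩
  rw [polyEval_smul_of_isHomogeneous hf, h x hx, mul_zero]

/-- The ideal of a cone is homogeneous, so primality need only be tested on homogeneous elements,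
where it says that two nonempty open subsets of Z defined by forms meet. -/
theorem isPrime_coneIdeal {Z : Set (ℙ ℂ V)} (hZ : @IsIrreducible _ (zariskiTopology V) Z) :
    (coneIdeal Z).IsPrime := by
  let _ := zariskiTopology V
  let _ : GradedAlgebra (MvPolynomial.homogeneousSubmodule (Module.Dual ℂ V) ℂ) :=
    MvPolynomial.gradedAlgebra
  have hom : (coneIdeal Z).IsHomogeneous
      (MvPolynomial.homogeneousSubmodule (Module.Dual ℂ V) ℂ) := by
    intro i f hf
    have : ((DirectSum.decompose (MvPolynomial.homogeneousSubmodule (Module.Dual ℂ V) ℂ) f) i :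
        MvPolynomial (Module.Dual ℂ V) ℂ) = MvPolynomial.homogeneousComponent i f :=
      MvPolynomial.decomposition.decompose'_apply f i
    rw [this, mem_coneIdeal_of_isHomogeneous (MvPolynomial.homogeneousComponent_isHomogeneous i f)]
    exact fun x hx => mem_coneIdeal_iff.1 hf x hx i
  refine hom.isPrime_of_homogeneous_mem_or_mem ?_ ?_
  · intro h
    obtain ⟨x, hx⟩ := hZ.nonempty
    have h1 : (1 : MvPolynomial (Module.Dual ℂ V) ℂ) ∈ coneIdeal Z := by rw [h]; trivial
    have := h1 x hx 1
    simp at this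
  · rintro f g ⟨i, hf⟩ ⟨j, hg⟩ hfg
    rw [MvPolynomial.mem_homogeneousSubmodule] at hf hg
    rw [mem_coneIdeal_of_isHomogeneous hf, mem_coneIdeal_of_isHomogeneous hg]
    rw [mem_coneIdeal_of_isHomogeneous (hf.mul hg)] at hfg
    by_contra! hcon
    obtain ⟨⟨x, hx, hxf⟩, y, hy, hyg⟩ := hcon
    obtain ⟨z, hz, hzf, hzg⟩ := hZ.isPreirreducible {x | polyEval x.rep f ≠ 0}
      {x | polyEval x.rep g ≠ 0} (isClosed_polyEval_eq_zero hf).isOpen_compl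
      (isClosed_polyEval_eq_zero hg).isOpen_compl ⟨x, hx, hxf⟩ ⟨y, hy, hyg⟩
    have := hfg z hz
    rw [map_mul] at this
    exact (mul_ne_zero hzf hzg) this

/-! ### Upper bound for the dimension of a polynomial family -/

/-- A map to a vector space all of whose coordinates are polynomial functions. -/
def IsPolyMap {σ : Type} (F : (σ → ℂ) → V) : Prop :=
  ∀ l : Module.Dual ℂ V, ∃ P : MvPolynomial σ ℂ, ∀ y, MvPolynomial.eval y P = l (F y)

/-- `w` is the derivative of `F` at `a` in the direction `b`. -/
def HasDirDeriv {σ : Type} (F : (σ → ℂ) → V) (a b : σ → ℂ) (w : V) : Prop :=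
  ∀ l : Module.Dual ℂ V, HasDerivAt (fun t : ℂ => l (F (a + t • b))) (l w) 0

theorem hasDerivAt_eval_line {σ : Type} [Fintype σ] (P : MvPolynomial σ ℂ) (a b : σ → ℂ) :
    HasDerivAt (fun t : ℂ => MvPolynomial.eval (a + t • b) P)
      (∑ j, b j * MvPolynomial.eval a (MvPolynomial.pderiv j P)) 0 := by
  classical
  induction P using MvPolynomial.induction_on with
  | C c => simpa using hasDerivAt_const (0 : ℂ) c
  | add p q hp hq =>
    simp only [map_add, mul_add, Finset.sum_add_distrib]
    exact hp.add hq
  | mul_X p i hp =>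
    have h1 : HasDerivAt (fun t : ℂ => a i + t * b i) (b i) 0 := by
      simpa using ((hasDerivAt_id (0 : ℂ)).mul_const (b i)).const_add (a i)
    have h2 := hp.mul h1
    have e1 : (fun t : ℂ => MvPolynomial.eval (a + t • b) (p * MvPolynomial.X i)) =
        (fun t : ℂ => MvPolynomial.eval (a + t • b) p) * fun t => a i + t * b i := by
      funext t; simp
    rw [e1]
    refine h2.congr_deriv (Eq.symm ?_)
    have e2 : ∀ j, MvPolynomial.pderiv j (p * MvPolynomial.X i) =
        p * (Pi.single j 1 : σ → MvPolynomial σ ℂ) i +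
          MvPolynomial.X i * MvPolynomial.pderiv j p := fun j => by
      rw [Derivation.leibniz, MvPolynomial.pderiv_X, smul_eq_mul, smul_eq_mul]
    simp only [e2, map_add, map_mul, MvPolynomial.eval_X, mul_add, Finset.sum_add_distrib,
      zero_smul, add_zero, zero_mul]
    rw [add_comm]
    congr 1
    · rw [Finset.sum_mul]
      exact Finset.sum_congr rfl fun _ _ => by ring
    · rw [Finset.sum_eq_single i]
      · rw [Pi.single_eq_same, map_one]; ring
      · intro j _ hj
        rw [Pi.single_eq_of_ne hj.symm]; simp
      · simp

theorem HasDirDeriv.sum_pderiv {σ : Type} [Fintype σ] {F : (σ → ℂ) → V} {a b : σ → ℂ} {w : V}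
    (h : HasDirDeriv F a b w) {l : Module.Dual ℂ V} {P : MvPolynomial σ ℂ}
    (hP : ∀ y, MvPolynomial.eval y P = l (F y)) :
    ∑ j, b j * MvPolynomial.eval a (MvPolynomial.pderiv j P) = l w := by
  have h1 := hasDerivAt_eval_line P a b
  simp only [hP] at h1
  exact h1.unique (h l)

/-- A family of points of a projective space which depends polynomially on parameters has dimension
at most the generic rank of the differential, minus one. -/
theorem zariskiDim_closureIn_le {σ : Type} [Fintype σ] {F : (σ → ℂ) → V} (hF : IsPolyMap F)
    (cone : ∀ (c : ℂ) (y : σ → ℂ), ∃ y', F y' = c • F y) {h : MvPolynomial σ ℂ} (hh : h ≠ 0)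
    {D : ℕ} (L : (σ → ℂ) → (σ → ℂ) →ₗ[ℂ] V)
    (hL : ∀ a, MvPolynomial.eval a h ≠ 0 → ∀ b, HasDirDeriv F a b (L a b))
    (hr : ∀ a, MvPolynomial.eval a h ≠ 0 → Module.finrank ℂ (LinearMap.range (L a)) ≤ D + 1)
    {A B : Set (ℙ ℂ V)} (hA : ∀ x ∈ A, ∃ (y : σ → ℂ) (hy : F y ≠ 0), x = Projectivization.mk ℂ (F y) hy) :
    zariskiDim (zariskiClosureIn A B) ≤ (D : WithBot ℕ∞) := by
  classical
  let _ := zariskiTopology V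
  choose P hP using hF
  let φ : MvPolynomial (Module.Dual ℂ V) ℂ →ₐ[ℂ] MvPolynomial σ ℂ := MvPolynomial.aeval P
  have hφ : ∀ f y, MvPolynomial.eval y (φ f) = polyEval (F y) f := by
    intro f y
    have : (MvPolynomial.eval y).comp φ.toRingHom = polyEval (F y) := by
      apply MvPolynomial.ringHom_ext
      · intro r
        simp [φ, polyEval]
      · intro l
        change MvPolynomial.eval y (MvPolynomial.aeval P (MvPolynomial.X l)) = _
        rw [MvPolynomial.aeval_X, hP]
        simp [polyEval]
    exact congrArg (fun g => g f) this
  -- polynomials which vanish on the image vanish on the closure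
  have hker : ∀ f, φ f = 0 → f ∈ coneIdeal (zariskiClosureIn A B) := by
    intro f hf
    rw [mem_coneIdeal_iff]
    intro x hx k
    have hx' : x ∈ closure A := hx.1
    have hcl := isClosed_polyEval_eq_zero (V := V)
      (MvPolynomial.homogeneousComponent_isHomogeneous k f)
    refine closure_minimal (t := {x : ℙ ℂ V | polyEval x.rep
      (MvPolynomial.homogeneousComponent k f) = 0}) ?_ hcl hx'
    intro z hz
    obtain ⟨y, hy, rfl⟩ := hA z hz
    obtain ⟨u, hu⟩ := Projectivization.exists_smul_eq_mk_rep ℂ (F y) hy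
    have h1 : ∀ c : ℂ, polyEval (c • F y) f = 0 := by
      intro c
      obtain ⟨y', hy'⟩ := cone c y
      rw [← hy', ← hφ, hf, map_zero]
    have h2 := (forall_polyEval_smul_eq_zero_iff f (F y)).1 h1 k
    change polyEval _ _ = 0
    rw [← hu, Units.smul_def, polyEval_smul_of_isHomogeneous
      (MvPolynomial.homogeneousComponent_isHomogeneous k f), h2, mul_zero]
  unfold zariskiDim topologicalKrullDim Order.krullDim
  refine iSup_le fun c => ?_
  let I : Fin (c.length + 1) → Ideal (MvPolynomial (Module.Dual ℂ V) ℂ) := fun i =>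
    coneIdeal (Subtype.val '' (c i : Set (zariskiClosureIn A B)))
  have hirr : ∀ i, IsIrreducible (Subtype.val '' (c i : Set (zariskiClosureIn A B))) := fun i =>
    (c i).isIrreducible.image _ continuous_subtype_val.continuousOn
  have hprime : ∀ i, (I i).IsPrime := fun i => isPrime_coneIdeal (hirr i)
  -- A larger set has a smaller ideal; the inclusion is strict because a point outside a closed set
  -- is separated from it by a homogeneous polynomial.
  have hlt : ∀ i j, i < j → I j < I i := by
    intro i j hij
    have hc := c.strictMono hij
    refine lt_of_le_of_ne (fun f hf x hx => ?_) fun heq => ?_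
    · obtain ⟨y, hy, rfl⟩ := hx
      exact hf _ ⟨y, hc.le hy, rfl⟩
    · obtain ⟨y, hyj, hyi⟩ := SetLike.exists_of_lt hc
      have : (y : ℙ ℂ V) ∉ closure (Subtype.val '' (c i : Set (zariskiClosureIn A B))) := by
        rw [← closure_subtype, (c i).isClosed.closure_eq]
        exact hyi
      obtain ⟨k, f, hf, hfi, hfy⟩ := exists_homogeneous_of_notMem_closure this
      have h1 : f ∈ I i := (mem_coneIdeal_of_isHomogeneous hf).2 hfi
      rw [← heq] at h1
      exact hfy ((mem_coneIdeal_of_isHomogeneous hf).1 h1 _ ⟨y, hyj, rfl⟩)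
  -- Each strict descent in the chain of primes adds one element independent modulo the smaller
  -- prime. The descent starts one level above the ideal of the smallest set, at the ideal of the
  -- vertex 0 of the cone, which is why `c.length + 1` elements result.
  have hind : ∀ (i : ℕ) (hi : i < c.length + 1),
      ∃ f : Fin (i + 1) → MvPolynomial (Module.Dual ℂ V) ℂ,
      ∀ G : MvPolynomial (Fin (i + 1)) ℂ, MvPolynomial.aeval f G ∈ I ⟨i, hi⟩ → G = 0 := by
    intro i
    induction i with
    | zero =>
      intro hi
      have h0 : I ⟨0, hi⟩ < RingHom.ker (polyEval (0 : V)) := by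
        obtain ⟨x, hx⟩ := (hirr ⟨0, hi⟩).nonempty
        refine lt_of_le_of_ne (fun f hf => ?_) fun heq => ?_
        · have := hf x hx 0
          rwa [zero_smul] at this
        · obtain ⟨l, hl⟩ : ∃ l : Module.Dual ℂ V, l x.rep ≠ 0 := by
            by_contra! hcon
            exact x.rep_nonzero ((Module.forall_dual_apply_eq_zero_iff ℂ _).1 hcon)
          have h1 : (MvPolynomial.X l : MvPolynomial (Module.Dual ℂ V) ℂ) ∈ I ⟨0, hi⟩ := by
            rw [heq, RingHom.mem_ker]
            simp [polyEval]
          have := h1 x hx 1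
          simp [polyEval, hl] at this
      have := hprime ⟨0, hi⟩
      obtain ⟨x, hx⟩ := exists_algebraicIndependent_cons h0 (Fin.elim0 : Fin 0 → _) (fun G hG => by
        rw [MvPolynomial.eq_C_of_isEmpty G] at hG ⊢
        rw [RingHom.mem_ker, MvPolynomial.aeval_C, MvPolynomial.algebraMap_eq, polyEval,
          MvPolynomial.eval_C] at hG
        rw [hG, map_zero])
      exact ⟨_, hx⟩
    | succ i ih =>
      intro hi
      obtain ⟨f, hf⟩ := ih (by omega)
      have := hprime ⟨i + 1, hi⟩
      obtain ⟨x, hx⟩ := exists_algebraicIndependent_cons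
        (hlt ⟨i, by omega⟩ ⟨i + 1, hi⟩ (by simp [Fin.lt_def])) f hf
      exact ⟨_, hx⟩
  obtain ⟨f, hf⟩ := hind c.length (by omega)
  -- The kernel of φ lies in the last prime of the chain, so independence modulo that prime passes
  -- to the pulled-back polynomials in the parameters.
  have hai : AlgebraicIndependent ℂ fun i => φ (f i) := by
    rw [algebraicIndependent_iff]
    intro G hG
    refine hf G ?_
    have h1 : φ (MvPolynomial.aeval f G) = 0 := by
      rw [← hG, ← AlgHom.comp_apply, MvPolynomial.comp_aeval]
    intro x hx
    obtain ⟨y, hy, rfl⟩ := hx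
    exact hker _ h1 _ y.2
  obtain ⟨δ, hδ, hδ'⟩ := exists_jacobian_linearIndependent hai
  obtain ⟨a, ha⟩ : ∃ a, MvPolynomial.eval a (δ * h) ≠ 0 := by
    by_contra! hcon
    exact mul_ne_zero hδ hh (MvPolynomial.funext fun a => by rw [hcon, map_zero])
  rw [map_mul] at ha
  have hli := hδ' a (left_ne_zero_of_mul ha)
  have hha := right_ne_zero_of_mul ha
  -- gradients factor through the range of the differential
  let R := LinearMap.range (L a)
  have hgrad : ∀ f : MvPolynomial (Module.Dual ℂ V) ℂ, ∃ m : Module.Dual ℂ V,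
      ∀ b : σ → ℂ, ∑ j, b j * MvPolynomial.eval a (MvPolynomial.pderiv j (φ f)) = m (L a b) := by
    intro f
    induction f using MvPolynomial.induction_on with
    | C r => exact ⟨0, fun b => by simp [φ]⟩
    | add p q hp hq =>
      obtain ⟨m, hm⟩ := hp
      obtain ⟨m', hm'⟩ := hq
      exact ⟨m + m', fun b => by
        simp only [map_add, mul_add, Finset.sum_add_distrib, hm, hm', LinearMap.add_apply]⟩
    | mul_X p l hp =>
      obtain ⟨m, hm⟩ := hp
      have hl := fun b => (hL a hha b).sum_pderiv (hP l)
      refine ⟨MvPolynomial.eval a (φ p) • l + MvPolynomial.eval a (P l) • m, fun b => ?_⟩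
      have hX : φ (MvPolynomial.X l) = P l := MvPolynomial.aeval_X _ _
      simp only [map_mul, hX, Derivation.leibniz, smul_eq_mul, map_add, LinearMap.add_apply,
        LinearMap.smul_apply, ← hl, ← hm, Finset.mul_sum, ← Finset.sum_add_distrib]
      exact Finset.sum_congr rfl fun _ _ => by ring
  choose m hm using hgrad
  -- Independent gradients induce independent functionals on the range of `L a`, whose dimension
  -- therefore bounds `c.length + 1`.
  have hli2 : LinearIndependent ℂ fun i : Fin (c.length + 1) =>
      (m (f i)).comp R.subtype := by
    rw [Fintype.linearIndependent_iff] at hli ⊢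
    intro g hg
    apply hli g
    funext j
    have h1 := LinearMap.congr_fun hg ⟨L a (Pi.single j 1), ⟨_, rfl⟩⟩
    simp only [LinearMap.sum_apply, LinearMap.smul_apply, LinearMap.comp_apply,
      Submodule.subtype_apply, ← hm, LinearMap.zero_apply, Pi.single_apply, ite_mul, one_mul,
      zero_mul, Finset.sum_ite_eq', Finset.mem_univ, if_true] at h1
    simpa using h1
  have h2 := hli2.fintype_card_le_finrank
  rw [Fintype.card_fin, Subspace.dual_finrank_eq] at h2
  have h3 := h2.trans (hr a hha)
  have h4 : c.length ≤ D := by omega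
  exact_mod_cast h4

/-! ### Lower bound for the dimension of a polynomial family -/

theorem eval_aeval_apply {σ τ : Type} (ψ : τ → MvPolynomial σ ℂ) (z : σ → ℂ)
    (P : MvPolynomial τ ℂ) : MvPolynomial.eval z (MvPolynomial.aeval ψ P) =
      MvPolynomial.eval (fun k => MvPolynomial.eval z (ψ k)) P := by
  have : (MvPolynomial.eval z).comp (MvPolynomial.aeval ψ).toRingHom =
      MvPolynomial.eval fun k => MvPolynomial.eval z (ψ k) := by
    apply MvPolynomial.ringHom_ext
    · intro r; simp
    · intro l; simp
  exact congrArg (fun g => g P) this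

theorem IsPolyMap.comp {σ τ : Type} {F : (τ → ℂ) → V} (hF : IsPolyMap F)
    (ψ : τ → MvPolynomial σ ℂ) : IsPolyMap fun z => F fun k => MvPolynomial.eval z (ψ k) := by
  intro l
  obtain ⟨P, hP⟩ := hF l
  exact ⟨MvPolynomial.aeval ψ P, fun z => by rw [eval_aeval_apply, hP]⟩

theorem exists_dual_family {ι : Type} [Finite ι] [DecidableEq ι] {w : ι → V} (hw : LinearIndependent ℂ w) :
    ∃ l : ι → Module.Dual ℂ V, ∀ i j, l i (w j) = if i = j then 1 else 0 := by
  let b := Module.Basis.span hw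
  choose l hl using fun i => LinearMap.exists_extend (b.coord i)
  refine ⟨l, fun i j => ?_⟩
  have h1 : l i (w j) = b.coord i (b j) := by
    rw [← hl i, LinearMap.comp_apply, Submodule.subtype_apply, Module.Basis.span_apply]
  rw [h1, Module.Basis.coord_apply, Module.Basis.repr_self, Finsupp.single_apply]
  simp only [eq_comm]

/-- Extension of a vector of parameters by zero. -/
def extendZero {D : ℕ} (k : ℕ) (z : Fin k → ℂ) : Fin D → ℂ := fun j =>
  if h : (j : ℕ) < k then z ⟨j, h⟩ else 0

/-- The dimension of a subset of a projective space is bounded below by the rank of the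
differential, minus one, of a polynomial family of points of the subset. -/
theorem le_zariskiDim {D : ℕ} {F : (Fin (D + 1) → ℂ) → V} (hF : IsPolyMap F)
    {a : Fin (D + 1) → ℂ} (ha : ∀ j, j ≠ 0 → a j = 0) {w : Fin (D + 1) → V}
    (hw : ∀ j, HasDirDeriv F a (Pi.single j 1) (w j)) (hli : LinearIndependent ℂ w)
    (cone : ∀ (c : ℂ) (y : Fin (D + 1) → ℂ), ∃ y', (∀ j, y j = 0 → y' j = 0) ∧ F y' = c • F y)
    {h : MvPolynomial (Fin (D + 1)) ℂ} (hh : MvPolynomial.eval a h ≠ 0) {Z : Set (ℙ ℂ V)}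
    (hZ : ∀ y, MvPolynomial.eval y h ≠ 0 → ∃ hy : F y ≠ 0, Projectivization.mk ℂ (F y) hy ∈ Z) :
    (D : WithBot ℕ∞) ≤ zariskiDim Z := by
  classical
  let _ := zariskiTopology V
  let ψ : (k : ℕ) → Fin (D + 1) → MvPolynomial (Fin k) ℂ := fun k j =>
    if h : (j : ℕ) < k then MvPolynomial.X ⟨j, h⟩ else 0
  have hψ : ∀ k z, (fun j => MvPolynomial.eval z (ψ k j)) = extendZero k z := by
    intro k z
    funext j
    simp only [ψ, extendZero]
    split_ifs <;> simp
  have evalψ : ∀ k z P, MvPolynomial.eval z (MvPolynomial.aeval (ψ k) P) =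
      MvPolynomial.eval (extendZero k z) P := fun k z P => by rw [eval_aeval_apply, hψ]
  have hext : ∀ (k : ℕ) (y : Fin (D + 1) → ℂ), (∀ j : Fin (D + 1), k ≤ j → y j = 0) →
      k ≤ D + 1 → ∃ z : Fin k → ℂ, extendZero k z = y := by
    intro k y hy hk
    refine ⟨fun i => y ⟨i, by omega⟩, ?_⟩
    funext j
    simp only [extendZero]
    split_ifs with h1
    · rfl
    · exact (hy j (by omega)).symm
  have hvan : ∀ (k : ℕ) (z : Fin k → ℂ) (j : Fin (D + 1)), k ≤ j →
      extendZero (D := D + 1) k z j = 0 := by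
    intro k z j hj
    simp only [extendZero]
    rw [dif_neg (by omega)]
  -- `T k` collects the points obtained when only the first k parameters may be nonzero. The
  -- closures of T 1, …, T (D + 1) will form the chain; by `ha` the base point already gives a point
  -- of T 1.
  let T : ℕ → Set Z := fun k => {x | ∃ z : Fin k → ℂ, MvPolynomial.eval (extendZero k z) h ≠ 0 ∧
    ∃ hy : F (extendZero k z) ≠ 0, x.1 = Projectivization.mk ℂ (F (extendZero k z)) hy}
  have hval : ∀ {k : ℕ} {f : MvPolynomial (Module.Dual ℂ V) ℂ}, f.IsHomogeneous k →
      ∀ (v : V) (hv : v ≠ 0), polyEval (Projectivization.mk ℂ v hv).rep f = 0 ↔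
        polyEval v f = 0 := by
    intro k f hf v hv
    obtain ⟨u, hu⟩ := Projectivization.exists_smul_eq_mk_rep ℂ v hv
    rw [← hu, Units.smul_def, polyEval_smul_of_isHomogeneous hf]
    exact ⟨fun h => (mul_eq_zero.1 h).resolve_left (pow_ne_zero _ u.ne_zero),
      fun h => by rw [h, mul_zero]⟩
  -- the polynomial in linear forms pulled back to the parameters
  choose P hP using hF
  have hpull : ∀ f : MvPolynomial (Module.Dual ℂ V) ℂ, ∃ Q : MvPolynomial (Fin (D + 1)) ℂ,
      ∀ y, MvPolynomial.eval y Q = polyEval (F y) f := fun f =>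
    ⟨MvPolynomial.aeval P f, fun y => by
      rw [eval_aeval_apply]
      simp only [hP]
      rfl⟩
  have hne : ∀ k, 1 ≤ k → k ≤ D + 1 → (T k).Nonempty := by
    intro k hk hkD
    obtain ⟨z, hz⟩ := hext k a (fun j hj => ha j (by rintro rfl; simp at hj; omega)) hkD
    obtain ⟨hy, hyZ⟩ := hZ a hh
    rw [← hz] at hh
    have hy' : F (extendZero k z) ≠ 0 := by rwa [hz]
    refine ⟨⟨Projectivization.mk ℂ (F (extendZero k z)) hy', ?_⟩, z, hh, hy', rfl⟩
    convert hyZ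
  -- T k is the image of a nonempty principal open subset of affine k-space: two open sets meeting
  -- it pull back to sets containing nonvanishing loci of nonzero polynomials, whose product is
  -- again nonzero.
  have hirr : ∀ k, 1 ≤ k → k ≤ D + 1 → IsIrreducible (T k) := by
    intro k hk hkD
    refine ⟨hne k hk hkD, ?_⟩
    rintro _ _ ⟨u, hu, rfl⟩ ⟨v, hv, rfl⟩ ⟨x, ⟨z, hz, hy, hx⟩, hxu⟩ ⟨x', ⟨z', hz', hy', hx'⟩, hxv⟩
    obtain ⟨_, ⟨m, f, hf, rfl⟩, hxf, hfu⟩ :=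
      isTopologicalBasis_zariski.exists_subset_of_mem_open hxu hu
    obtain ⟨_, ⟨m', g, hg, rfl⟩, hxg, hgv⟩ :=
      isTopologicalBasis_zariski.exists_subset_of_mem_open hxv hv
    obtain ⟨Qf, hQf⟩ := hpull f
    obtain ⟨Qg, hQg⟩ := hpull g
    have h1 : MvPolynomial.aeval (ψ k) Qf ≠ 0 := by
      intro h0
      have := evalψ k z Qf
      rw [h0, map_zero, hQf, eq_comm, ← hval hf _ hy, ← hx] at this
      exact hxf this
    have h2 : MvPolynomial.aeval (ψ k) Qg ≠ 0 := by
      intro h0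
      have := evalψ k z' Qg
      rw [h0, map_zero, hQg, eq_comm, ← hval hg _ hy', ← hx'] at this
      exact hxg this
    have h3 : MvPolynomial.aeval (ψ k) h ≠ 0 := by
      intro h0
      have := evalψ k z h
      rw [h0, map_zero] at this
      exact hz this.symm
    obtain ⟨y, hy3⟩ : ∃ y, MvPolynomial.eval y (MvPolynomial.aeval (ψ k) Qf *
        MvPolynomial.aeval (ψ k) Qg * MvPolynomial.aeval (ψ k) h) ≠ 0 := by
      by_contra! hcon
      exact mul_ne_zero (mul_ne_zero h1 h2) h3
        (MvPolynomial.funext fun a => by rw [hcon, map_zero])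
    rw [map_mul, map_mul, evalψ, evalψ, evalψ, hQf, hQg] at hy3
    obtain ⟨hF0, hFZ⟩ := hZ _ (right_ne_zero_of_mul hy3)
    refine ⟨⟨_, hFZ⟩, ⟨y, right_ne_zero_of_mul hy3, hF0, rfl⟩, hfu ?_, hgv ?_⟩
    · exact fun h0 => left_ne_zero_of_mul (left_ne_zero_of_mul hy3) ((hval hf _ hF0).1 h0)
    · exact fun h0 => right_ne_zero_of_mul (left_ne_zero_of_mul hy3) ((hval hg _ hF0).1 h0)
  have hmono : ∀ k, T k ⊆ T (k + 1) := by
    rintro k x ⟨z, hz, hy, hx⟩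
    have he : extendZero (k + 1) (fun i => extendZero (D := k + 1) k z i) =
        extendZero (D := D + 1) k z := by
      funext j
      simp only [extendZero]
      split_ifs <;> first | rfl | omega
    refine ⟨_, by rwa [he], by rwa [he], ?_⟩
    rw [hx]
    simp only [he]
  obtain ⟨l, hl⟩ := exists_dual_family hli
  -- The separating polynomial is a relation among k + 1 linear forms. Pulled back to k parameters
  -- these are algebraically dependent by transcendence degree; on k + 1 parameters they are
  -- independent by the Jacobian criterion.
  have hsep : ∀ k, 1 ≤ k → k + 1 ≤ D + 1 → ∃ (m : ℕ) (f : MvPolynomial (Module.Dual ℂ V) ℂ),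
      f.IsHomogeneous m ∧ (∀ x ∈ T k, polyEval x.1.rep f = 0) ∧
        ∃ x ∈ T (k + 1), polyEval x.1.rep f ≠ 0 := by
    intro k hk hkD
    let l' : Fin (k + 1) → Module.Dual ℂ V := fun j => l ⟨j, by omega⟩
    let g : Fin (k + 1) → MvPolynomial (Fin k) ℂ := fun j => MvPolynomial.aeval (ψ k) (P (l' j))
    let g' : Fin (k + 1) → MvPolynomial (Fin (k + 1)) ℂ := fun j =>
      MvPolynomial.aeval (ψ (k + 1)) (P (l' j))
    have hdep : ¬ AlgebraicIndependent ℂ g := by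
      intro hg
      have h1 := hg.lift_cardinalMk_le_trdeg
      rw [MvPolynomial.trdeg_of_isDomain] at h1
      simp at h1
    obtain ⟨G, hG, hG0⟩ : ∃ G, MvPolynomial.aeval g G = 0 ∧ G ≠ 0 := by
      rw [algebraicIndependent_iff] at hdep
      push Not at hdep
      exact hdep
    obtain ⟨a', ha'⟩ := hext (k + 1) a (fun j hj => ha j (by rintro rfl; simp at hj)) hkD
    have hind : AlgebraicIndependent ℂ g' := by
      apply algebraicIndependent_of_jacobian g' a'
      -- The linear forms are dual to the derivatives w, so the Jacobian matrix at the base point is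
      -- the identity.
      have hJ : ∀ i j, MvPolynomial.eval a' (MvPolynomial.pderiv j (g' i)) =
          if i = j then 1 else 0 := by
        intro i j
        have hd : HasDirDeriv (fun z => F (extendZero (k + 1) z)) a' (Pi.single j 1)
            (w ⟨j, by omega⟩) := by
          intro m
          have := hw ⟨j, by omega⟩ m
          have he : ∀ t : ℂ, extendZero (k + 1) (a' + t • Pi.single j (1 : ℂ)) =
              a + t • (Pi.single ⟨j, by omega⟩ 1 : Fin (D + 1) → ℂ) := by
            intro t
            rw [← ha']
            funext i
            by_cases h1 : (i : ℕ) < k + 1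
            · simp only [extendZero, dif_pos h1, Pi.add_apply, Pi.smul_apply, Pi.single_apply,
                Fin.ext_iff]
            · have h2 : ¬ i = ⟨j, by omega⟩ := fun h3 =>
                h1 (lt_of_eq_of_lt (congrArg Fin.val h3) j.2)
              simp only [extendZero, dif_neg h1, Pi.add_apply, Pi.smul_apply, Pi.single_apply,
                if_neg h2, smul_zero, add_zero]
          simpa only [he] using this
        have h1 := hd.sum_pderiv (l := l' i) (P := g' i) (fun y => by rw [evalψ, hP])
        simp only [Pi.single_apply, ite_mul, one_mul, zero_mul, Finset.sum_ite_eq',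
          Finset.mem_univ, if_true] at h1
        rw [h1, hl]
        simp only [Fin.ext_iff]
      rw [Fintype.linearIndependent_iff]
      intro c hc i
      have := congrFun hc i
      simpa only [Finset.sum_apply, Pi.smul_apply, hJ, smul_eq_mul, mul_ite, mul_one, mul_zero,
        Finset.sum_ite_eq', Finset.mem_univ, if_true, Pi.zero_apply] using this
    let f := MvPolynomial.rename l' G
    have hf : ∀ v, polyEval v f = MvPolynomial.eval (fun j => l' j v) G := by
      intro v
      simp only [polyEval, f, MvPolynomial.eval_rename]
      rfl
    obtain ⟨y, hy⟩ : ∃ y, MvPolynomial.eval y (MvPolynomial.aeval g' G *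
        MvPolynomial.aeval (ψ (k + 1)) h) ≠ 0 := by
      by_contra! hcon
      refine mul_ne_zero (fun h0 => hG0 ?_) (fun h0 => ?_)
        (MvPolynomial.funext fun a => by rw [hcon, map_zero])
      · exact (algebraicIndependent_iff.1 hind) G h0
      · have := evalψ (k + 1) a' h
        rw [h0, map_zero, ha'] at this
        exact hh this.symm
    rw [map_mul, evalψ, eval_aeval_apply] at hy
    obtain ⟨hF0, hFZ⟩ := hZ _ (right_ne_zero_of_mul hy)
    have h4 : polyEval (F (extendZero (k + 1) y)) f ≠ 0 := by
      rw [hf]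
      convert left_ne_zero_of_mul hy using 3
      funext j
      rw [evalψ, hP]
    -- The relation need not be homogeneous. One of its homogeneous parts is nonzero at the chosen
    -- point, and all of them vanish on T k because `cone` keeps zero parameters zero, so that the
    -- cone over T k stays in the image of the first k parameters.
    obtain ⟨m, hm⟩ : ∃ m, polyEval (F (extendZero (k + 1) y))
        (MvPolynomial.homogeneousComponent m f) ≠ 0 := by
      by_contra! hcon
      have := (forall_polyEval_smul_eq_zero_iff f _).2 hcon 1
      rw [one_smul] at this
      exact h4 this
    have hhom := MvPolynomial.homogeneousComponent_isHomogeneous m f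
    refine ⟨m, _, hhom, ?_, ⟨_, hFZ⟩,
      ⟨y, right_ne_zero_of_mul hy, hF0, rfl⟩, fun h0 => hm ((hval hhom _ hF0).1 h0)⟩
    rintro x ⟨z, hz, hy0, hx⟩
    rw [hx, hval hhom]
    refine (forall_polyEval_smul_eq_zero_iff f _).1 (fun c => ?_) m
    obtain ⟨y', hy'0, hy'⟩ := cone c (extendZero k z)
    obtain ⟨z', hz'⟩ := hext k y' (fun j hj => hy'0 j (hvan k z j hj)) (by omega)
    rw [← hy', ← hz', hf]
    have := congrArg (MvPolynomial.eval z') hG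
    rw [eval_aeval_apply, map_zero] at this
    rw [← this]
    congr 2
    funext j
    rw [evalψ, hP]
  let C : Fin (D + 1) → TopologicalSpace.IrreducibleCloseds Z := fun k =>
    ⟨closure (T (k + 1)), (hirr (k + 1) (by omega) (by omega)).closure, isClosed_closure⟩
  have hC : StrictMono C := by
    rw [Fin.strictMono_iff_lt_succ]
    intro k
    refine lt_of_le_of_ne (fun x hx => closure_mono (hmono _) hx) fun heq => ?_
    obtain ⟨m, f, hf, h1, x, hx, hxf⟩ := hsep (k + 1) (by omega) (by omega)
    have hcl : IsClosed {x : Z | polyEval x.1.rep f = 0} :=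
      (isClosed_polyEval_eq_zero hf).preimage continuous_subtype_val
    have h2 : x ∈ C k.succ := subset_closure hx
    rw [← heq] at h2
    exact hxf (closure_minimal h1 hcl h2)
  let p : LTSeries (TopologicalSpace.IrreducibleCloseds Z) :=
    ⟨D, C, fun i => hC (by simp [Fin.lt_def])⟩
  exact Order.LTSeries.length_le_krullDim p

end Zariski

/-! ### Forms, pointwise -/

theorem alternatingMap_sum_apply {R M ι κ : Type*} [CommRing R] [AddCommGroup M] [Module R M]
    (s : Finset κ) (f : κ → M [⋀^ι]→ₗ[R] R) (v : ι → M) :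
    (∑ i ∈ s, f i) v = ∑ i ∈ s, f i v := by
  classical
  induction s using Finset.induction_on with
  | empty => simp
  | insert i s hi ih => rw [Finset.sum_insert hi, Finset.sum_insert hi, AlternatingMap.add_apply, ih]

/-- The coordinate `q`-form `dx_{I 0} ∧ ⋯ ∧ dx_{I (q-1)}`. -/
def coordForm {R : Type*} [CommRing R] {m q : ℕ} (I : Fin q → Fin m) :
    (Fin m → R) [⋀^Fin q]→ₗ[R] R :=
  (Matrix.detRowAlternating : (Fin q → R) [⋀^Fin q]→ₗ[R] R).compLinearMap
    (LinearMap.pi fun k => LinearMap.proj (I k))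

theorem coordForm_apply {R : Type*} [CommRing R] {m q : ℕ} (I : Fin q → Fin m)
    (w : Fin q → Fin m → R) :
    coordForm I w = (Matrix.of fun a k => w a (I k)).det := rfl

theorem alternatingMap_ext_of_strictMono {R : Type*} [CommRing R] {m q : ℕ}
    {f g : (Fin m → R) [⋀^Fin q]→ₗ[R] R}
    (h : ∀ I : Fin q ↪o Fin m, f (fun k => Pi.single (I k) 1) = g fun k => Pi.single (I k) 1) :
    f = g := by
  classical
  refine Module.Basis.ext_alternating (Pi.basisFun R (Fin m)) fun v hv => ?_
  let s : Finset (Fin m) := Finset.univ.image v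
  have hs : s.card = q := by
    rw [Finset.card_image_of_injective _ hv, Finset.card_univ, Fintype.card_fin]
  let I := s.orderEmbOfFin hs
  have hI : ∀ a, ∃ k, I k = v a := fun a => by
    have : v a ∈ Set.range I := by
      rw [Finset.range_orderEmbOfFin]
      simp [s]
    exact this
  choose σ hσ using hI
  have hσi : Function.Injective σ := fun a b hab => hv (by rw [← hσ, ← hσ, hab])
  let τ : Equiv.Perm (Fin q) := Equiv.ofBijective σ (Finite.injective_iff_bijective.1 hσi)
  have e1 : (fun i => (Pi.basisFun R (Fin m)) (v i)) =
      (fun k => (Pi.single (I k) 1 : Fin m → R)) ∘ τ := by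
    funext i
    simp only [Pi.basisFun_apply, Function.comp_apply, τ, Equiv.ofBijective_apply, hσ]
  rw [e1, AlternatingMap.map_perm, AlternatingMap.map_perm, h]

theorem alternatingMap_eq_sum {R : Type*} [CommRing R] {m q : ℕ}
    (f : (Fin m → R) [⋀^Fin q]→ₗ[R] R) :
    f = ∑ I : Fin q ↪o Fin m, f (fun k => Pi.single (I k) 1) • coordForm I := by
  classical
  refine alternatingMap_ext_of_strictMono fun J => ?_
  rw [alternatingMap_sum_apply, Finset.sum_eq_single J]
  · rw [AlternatingMap.smul_apply, coordForm_apply]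
    have : (Matrix.of fun a k => (Pi.single (J a) 1 : Fin m → R) (J k)) = 1 := by
      ext a k
      simp [Matrix.one_apply, Pi.single_apply, eq_comm]
    rw [this, Matrix.det_one, smul_eq_mul, mul_one]
  · intro I _ hIJ
    obtain ⟨k, hk⟩ : ∃ k, ∀ a, I k ≠ J a := by
      by_contra! hcon
      apply hIJ
      have hsub : Finset.univ.image I ⊆ Finset.univ.image J := by
        intro x hx
        obtain ⟨k, -, rfl⟩ := Finset.mem_image.1 hx
        obtain ⟨a, ha⟩ := hcon k
        exact Finset.mem_image.2 ⟨a, Finset.mem_univ _, ha.symm⟩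
      have heq : Finset.univ.image I = Finset.univ.image J :=
        Finset.eq_of_subset_of_card_le hsub (by
          rw [Finset.card_image_of_injective _ J.injective,
            Finset.card_image_of_injective _ I.injective])
      have hr : Set.range I = Set.range J := by
        have := congrArg (fun s : Finset (Fin m) => (s : Set (Fin m))) heq
        simpa using this
      exact OrderEmbedding.range_inj.1 hr
    rw [AlternatingMap.smul_apply, coordForm_apply, Matrix.det_eq_zero_of_column_eq_zero k,
      smul_zero]
    intro a
    simp [Pi.single_apply, hk a]
  · simp

theorem form_apply_eq_sum {m q : ℕ} (Ω : Form m q) (w : Fin q → VField m) :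
    Ω w = ∑ I : Fin q ↪o Fin m, coeffForm Ω I * (Matrix.of fun a k => w a (I k)).det := by
  conv_lhs => rw [alternatingMap_eq_sum Ω]
  rw [alternatingMap_sum_apply]
  rfl

theorem form_ext {m q : ℕ} {Ω Ω' : Form m q} (h : ∀ I, coeffForm Ω I = coeffForm Ω' I) :
    Ω = Ω' :=
  alternatingMap_ext_of_strictMono fun I => h I

/-- The value of a vector field at a point. -/
def fieldAt {m : ℕ} (a : Fin m → ℂ) (X : VField m) : Fin m → ℂ := fun i =>
  MvPolynomial.eval a (X i)

/-- The constant vector field. -/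
def constField {m : ℕ} (v : Fin m → ℂ) : VField m := fun i => MvPolynomial.C (v i)

@[simp] theorem fieldAt_constField {m : ℕ} (a v : Fin m → ℂ) : fieldAt a (constField v) = v := by
  funext i; simp [fieldAt, constField]

/-- The value of a form at a point. -/
def formAt {m q : ℕ} (Ω : Form m q) (a : Fin m → ℂ) : (Fin m → ℂ) [⋀^Fin q]→ₗ[ℂ] ℂ :=
  ∑ I : Fin q ↪o Fin m, MvPolynomial.eval a (coeffForm Ω I) • coordForm I

theorem formAt_apply {m q : ℕ} (Ω : Form m q) (a : Fin m → ℂ) (v : Fin q → Fin m → ℂ) :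
    formAt Ω a v = ∑ I : Fin q ↪o Fin m, MvPolynomial.eval a (coeffForm Ω I) *
      (Matrix.of fun j k => v j (I k)).det := by
  rw [formAt, alternatingMap_sum_apply]
  rfl

theorem eval_det {m : ℕ} {n : Type} [Fintype n] [DecidableEq n] (a : Fin m → ℂ)
    (M : Matrix n n (Poly m)) :
    MvPolynomial.eval a M.det = (Matrix.of fun i j => MvPolynomial.eval a (M i j)).det := by
  rw [RingHom.map_det]
  rfl

theorem eval_form {m q : ℕ} (Ω : Form m q) (a : Fin m → ℂ) (w : Fin q → VField m) :
    MvPolynomial.eval a (Ω w) = formAt Ω a fun k => fieldAt a (w k) := by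
  rw [form_apply_eq_sum, formAt_apply, map_sum]
  refine Finset.sum_congr rfl fun I _ => ?_
  rw [map_mul, eval_det]
  rfl

theorem fieldAt_coordField {m : ℕ} (a : Fin m → ℂ) (i : Fin m) :
    fieldAt a (coordField i) = Pi.single i 1 := by
  funext j
  simp only [fieldAt, coordField, Pi.single_apply]
  split_ifs <;> simp

theorem eval_coeffForm {m q : ℕ} (Ω : Form m q) (a : Fin m → ℂ) (I : Fin q → Fin m) :
    MvPolynomial.eval a (coeffForm Ω I) = formAt Ω a fun k => Pi.single (I k) 1 := by
  rw [coeffForm, eval_form]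
  simp only [fieldAt_coordField]

theorem form_ext_formAt {m q : ℕ} {Ω Ω' : Form m q} (h : ∀ a v, formAt Ω a v = formAt Ω' a v) :
    Ω = Ω' :=
  form_ext fun I => MvPolynomial.funext fun a => by rw [eval_coeffForm, eval_coeffForm, h]

/-- The differential of a polynomial map. -/
def mapDiff {m k : ℕ} (φ : Fin m → Poly k) (a v : Fin k → ℂ) : Fin m → ℂ := fun i =>
  ∑ j, MvPolynomial.eval a (MvPolynomial.pderiv j (φ i)) * v j

theorem wedgeDiff_apply {m q : ℕ} (f : Fin q → Poly m) (w : Fin q → VField m) :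
    wedgeDiff f w = (Matrix.of fun a k => differential (f k) (w a)).det := rfl

theorem differential_apply {m : ℕ} (f : Poly m) (w : VField m) :
    differential f w = ∑ j, MvPolynomial.pderiv j f * w j := by
  simp [differential, LinearMap.sum_apply]

theorem pullback_apply {m k q : ℕ} (φ : Fin m → Poly k) (Ω : Form m q) (w : Fin q → VField k) :
    pullback φ Ω w = ∑ I : Fin q ↪o Fin m, MvPolynomial.aeval φ (coeffForm Ω I) *
      (Matrix.of fun a j => differential (φ (I j)) (w a)).det := by
  rw [pullback, alternatingMap_sum_apply]
  rfl

theorem formAt_pullback {m k q : ℕ} (φ : Fin m → Poly k) (Ω : Form m q) (a : Fin k → ℂ)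
    (v : Fin q → Fin k → ℂ) :
    formAt (pullback φ Ω) a v =
      formAt Ω (fun i => MvPolynomial.eval a (φ i)) fun j => mapDiff φ a (v j) := by
  have h := eval_form (pullback φ Ω) a fun j => constField (v j)
  simp only [fieldAt_constField] at h
  rw [← h, pullback_apply, formAt_apply, map_sum]
  refine Finset.sum_congr rfl fun I _ => ?_
  rw [map_mul, eval_aeval_apply, eval_det]
  congr 2
  ext b j
  simp [differential_apply, mapDiff, constField]

theorem contractZero_iff {m q : ℕ} (Z : VField m) (Ω : Form m q) :
    ContractZero Z Ω ↔ ∀ (a : Fin m → ℂ) (v : Fin q → Fin m → ℂ) (i : Fin q),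
      v i = fieldAt a Z → formAt Ω a v = 0 := by
  constructor
  · intro h a v i hv
    have h1 := h (Function.update (fun k => constField (v k)) i Z) i (by simp)
    have h2 := eval_form Ω a (Function.update (fun k => constField (v k)) i Z)
    rw [h1, map_zero] at h2
    rw [h2]
    congr 1
    funext k
    rcases eq_or_ne k i with rfl | hk
    · simp [hv]
    · simp [hk]
  · intro h w i hw
    refine MvPolynomial.funext fun a => ?_
    rw [eval_form, map_zero]
    exact h a _ i (by rw [hw])

theorem formAt_add {m q : ℕ} (Ω Ω' : Form m q) (a : Fin m → ℂ) (v : Fin q → Fin m → ℂ) :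
    formAt (Ω + Ω') a v = formAt Ω a v + formAt Ω' a v := by
  simp only [formAt_apply, ← Finset.sum_add_distrib]
  refine Finset.sum_congr rfl fun I _ => ?_
  rw [← add_mul, ← map_add]
  rfl

theorem formAt_smul {m q : ℕ} (c : ℂ) (Ω : Form m q) (a : Fin m → ℂ) (v : Fin q → Fin m → ℂ) :
    formAt (c • Ω) a v = c * formAt Ω a v := by
  simp only [formAt_apply, Finset.mul_sum]
  refine Finset.sum_congr rfl fun I _ => ?_
  have : coeffForm (c • Ω) I = MvPolynomial.C c * coeffForm Ω I :=
    MvPolynomial.smul_eq_C_mul _ _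
  rw [this, map_mul, MvPolynomial.eval_C, mul_assoc]

theorem formAt_zero {m q : ℕ} (a : Fin m → ℂ) (v : Fin q → Fin m → ℂ) :
    formAt (0 : Form m q) a v = 0 := by
  have := formAt_smul 0 (0 : Form m q) a v
  rwa [zero_smul, zero_mul] at this

/-! ### Linear substitutions -/

/-- The linear polynomial map given by a matrix. -/
def linMap {m : ℕ} (T : Matrix (Fin m) (Fin m) ℂ) : Fin m → Poly m := fun i =>
  ∑ j, MvPolynomial.C (T i j) * MvPolynomial.X j

theorem eval_linMap {m : ℕ} (T : Matrix (Fin m) (Fin m) ℂ) (a : Fin m → ℂ) (i : Fin m) :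
    MvPolynomial.eval a (linMap T i) = T.mulVec a i := by
  simp [linMap, Matrix.mulVec, dotProduct]

theorem pderiv_linMap {m : ℕ} (T : Matrix (Fin m) (Fin m) ℂ) (i j : Fin m) :
    MvPolynomial.pderiv j (linMap T i) = MvPolynomial.C (T i j) := by
  classical
  rw [linMap, map_sum, Finset.sum_eq_single j]
  · simp
  · intro k _ hk
    simp [MvPolynomial.pderiv_X, Pi.single_eq_of_ne hk]
  · simp

theorem mapDiff_linMap {m : ℕ} (T : Matrix (Fin m) (Fin m) ℂ) (a v : Fin m → ℂ) :
    mapDiff (linMap T) a v = T.mulVec v := by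
  funext i
  simp [mapDiff, pderiv_linMap, Matrix.mulVec, dotProduct]

theorem isHomogeneous_linMap {m : ℕ} (T : Matrix (Fin m) (Fin m) ℂ) (i : Fin m) :
    (linMap T i).IsHomogeneous 1 := by
  refine MvPolynomial.IsHomogeneous.sum _ _ _ fun j _ => ?_
  simpa using (MvPolynomial.isHomogeneous_C _ (T i j)).mul (MvPolynomial.isHomogeneous_X ℂ j)

theorem formAt_pullback_linMap {m q : ℕ} (T : Matrix (Fin m) (Fin m) ℂ) (Ω : Form m q)
    (a : Fin m → ℂ) (v : Fin q → Fin m → ℂ) :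
    formAt (pullback (linMap T) Ω) a v = formAt Ω (T.mulVec a) fun k => T.mulVec (v k) := by
  rw [formAt_pullback]
  simp only [eval_linMap, mapDiff_linMap]

theorem fieldAt_radial {m : ℕ} (a : Fin m → ℂ) : fieldAt a (radial m) = a := by
  funext i; simp [fieldAt, radial]

theorem coeffForm_pullback_linMap {m q : ℕ} (T : Matrix (Fin m) (Fin m) ℂ) (Ω : Form m q)
    (I : Fin q → Fin m) :
    coeffForm (pullback (linMap T) Ω) I = ∑ J : Fin q ↪o Fin m,
      MvPolynomial.C (Matrix.of fun a j => T (J j) (I a)).det *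
        MvPolynomial.aeval (linMap T) (coeffForm Ω J) := by
  classical
  rw [coeffForm, pullback_apply]
  refine Finset.sum_congr rfl fun J _ => ?_
  rw [mul_comm, RingHom.map_det]
  congr 2
  ext1 a j
  simp only [Matrix.of_apply, differential_apply, pderiv_linMap, coordField, RingHom.mapMatrix_apply,
    Matrix.map_apply]
  rw [Finset.sum_eq_single (I a)]
  · simp
  · intro b _ hb; simp [hb]
  · simp

/-- The pull-back by a linear map of twisted forms. -/
def linPull {n q e : ℕ} (T : Matrix (Fin (n + 1)) (Fin (n + 1)) ℂ) :
    twistedForms n q e →ₗ[ℂ] twistedForms n q e where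
  toFun Ω := ⟨pullback (linMap T) Ω.1, by
    constructor
    · intro I
      rw [coeffForm_pullback_linMap]
      refine MvPolynomial.IsHomogeneous.sum _ _ _ fun J _ => ?_
      have h1 := (Ω.2.1 J).aeval (linMap T) (isHomogeneous_linMap T)
      simpa using (MvPolynomial.isHomogeneous_C _
        (Matrix.of fun a j => T (J j) (I a)).det).mul h1
    · rw [contractZero_iff]
      intro a v i hv
      rw [formAt_pullback_linMap]
      refine (contractZero_iff _ _).1 Ω.2.2 _ _ i ?_
      rw [hv, fieldAt_radial, fieldAt_radial]⟩
  map_add' Ω Ω' := Subtype.ext (form_ext_formAt fun a v => by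
    change formAt (pullback (linMap T) (Ω.1 + Ω'.1)) a v =
      formAt (pullback (linMap T) Ω.1 + pullback (linMap T) Ω'.1) a v
    simp only [formAt_add, formAt_pullback_linMap])
  map_smul' c Ω := Subtype.ext (form_ext_formAt fun a v => by
    change formAt (pullback (linMap T) (c • Ω.1)) a v =
      formAt (c • pullback (linMap T) Ω.1) a v
    simp only [formAt_smul, formAt_pullback_linMap])

theorem formAt_linPull {n q e : ℕ} (T : Matrix (Fin (n + 1)) (Fin (n + 1)) ℂ)
    (Ω : twistedForms n q e) (a : Fin (n + 1) → ℂ) (v : Fin q → Fin (n + 1) → ℂ) :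
    formAt (linPull T Ω).1 a v = formAt Ω.1 (T.mulVec a) fun k => T.mulVec (v k) :=
  formAt_pullback_linMap T Ω.1 a v

theorem twisted_ext {n q e : ℕ} {Ω Ω' : twistedForms n q e}
    (h : ∀ a v, formAt Ω.1 a v = formAt Ω'.1 a v) : Ω = Ω' :=
  Subtype.ext (form_ext_formAt h)

theorem linPull_linPull {n q e : ℕ} (T T' : Matrix (Fin (n + 1)) (Fin (n + 1)) ℂ)
    (Ω : twistedForms n q e) : linPull T (linPull T' Ω) = linPull (T' * T) Ω :=
  twisted_ext fun a v => by simp only [formAt_linPull, Matrix.mulVec_mulVec]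

theorem linPull_one {n q e : ℕ} (Ω : twistedForms n q e) : linPull 1 Ω = Ω :=
  twisted_ext fun a v => by simp only [formAt_linPull, Matrix.one_mulVec]

theorem formAt_smul_point {n q e : ℕ} (Ω : twistedForms n q e) (c : ℂ) (a : Fin (n + 1) → ℂ)
    (v : Fin q → Fin (n + 1) → ℂ) :
    formAt Ω.1 (c • a) v = c ^ (e + 1) * formAt Ω.1 a v := by
  have key : ∀ (f : Poly (n + 1)), f.IsHomogeneous (e + 1) →
      MvPolynomial.eval (c • a) f = c ^ (e + 1) * MvPolynomial.eval a f := by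
    intro f hf
    simp only [MvPolynomial.eval_eq, Finset.mul_sum, Pi.smul_apply, smul_eq_mul]
    refine Finset.sum_congr rfl fun m hm => ?_
    have hk : ∑ i ∈ m.support, m i = e + 1 := by
      have := hf (MvPolynomial.mem_support_iff.1 hm)
      rw [Finsupp.weight_apply, Finsupp.sum] at this
      simpa using this
    simp only [mul_pow, Finset.prod_mul_distrib, Finset.prod_pow_eq_pow_sum, hk]
    ring
  simp only [formAt_apply, key _ (Ω.2.1 _), Finset.mul_sum, mul_assoc]

instance finiteDimensional_twistedForms (n q e : ℕ) :
    FiniteDimensional ℂ (twistedForms n q e) := by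
  have : Module.Finite ℂ (MvPolynomial.homogeneousSubmodule (Fin (n + 1)) ℂ (e + 1)) :=
    Module.Finite.iff_fg.2 (MvPolynomial.homogeneousSubmodule_fg _ _ _)
  let c : twistedForms n q e →ₗ[ℂ] ((Fin q → Fin (n + 1)) →
      MvPolynomial.homogeneousSubmodule (Fin (n + 1)) ℂ (e + 1)) :=
    { toFun := fun Ω I => ⟨coeffForm Ω.1 I, Ω.2.1 I⟩
      map_add' := fun _ _ => rfl
      map_smul' := fun _ _ => rfl }
  refine Module.Finite.of_injective c fun Ω Ω' h => Subtype.ext (form_ext fun I => ?_)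
  exact congrArg Subtype.val (congrFun h I)

/-- Evaluation of a twisted form at a point on vectors. -/
def evalAt {n q e : ℕ} (a : Fin (n + 1) → ℂ) (v : Fin q → Fin (n + 1) → ℂ) :
    Module.Dual ℂ (twistedForms n q e) where
  toFun Ω := formAt Ω.1 a v
  map_add' _ _ := formAt_add _ _ a v
  map_smul' c _ := formAt_smul c _ a v

theorem dual_eq_top_of_separating {V : Type} [AddCommGroup V] [Module ℂ V]
    [FiniteDimensional ℂ V] (p : Submodule ℂ (Module.Dual ℂ V))
    (h : ∀ v, (∀ l ∈ p, l v = 0) → v = 0) : p = ⊤ := by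
  have h1 : p.dualCoannihilator = ⊥ := by
    rw [eq_bot_iff]
    exact fun v hv => h v ((Submodule.mem_dualCoannihilator v).1 hv)
  have h3 := Subspace.dualCoannihilator_dualAnnihilator_eq (W := p)
  rw [← h3, h1, Submodule.dualAnnihilator_bot]

/-- Point evaluations separate twisted forms, hence span the dual of this finite-dimensional space.
A property of linear forms that is stable under linear combinations need only be checked on them. -/
theorem mem_of_forall_evalAt_mem {n q e : ℕ}
    (p : Submodule ℂ (Module.Dual ℂ (twistedForms n q e))) (h : ∀ a v, evalAt a v ∈ p)
    (l : Module.Dual ℂ (twistedForms n q e)) : l ∈ p := by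
  have h2 : p = ⊤ := dual_eq_top_of_separating p fun Ω hΩ =>
    twisted_ext fun a v => (hΩ _ (h a v)).trans (formAt_zero a v).symm
  rw [h2]
  exact Submodule.mem_top

theorem isPolyMap_of_formAt {σ : Type} {n q e : ℕ} {F : (σ → ℂ) → twistedForms n q e}
    (h : ∀ a v, ∃ P : MvPolynomial σ ℂ, ∀ y, MvPolynomial.eval y P = formAt (F y).1 a v) :
    IsPolyMap F := by
  let p : Submodule ℂ (Module.Dual ℂ (twistedForms n q e)) :=
    { carrier := {l | ∃ P : MvPolynomial σ ℂ, ∀ y, MvPolynomial.eval y P = l (F y)}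
      add_mem' := by
        rintro l l' ⟨P, hP⟩ ⟨P', hP'⟩
        exact ⟨P + P', fun y => by rw [map_add, hP, hP', LinearMap.add_apply]⟩
      zero_mem' := ⟨0, fun y => by simp⟩
      smul_mem' := by
        rintro c l ⟨P, hP⟩
        exact ⟨MvPolynomial.C c * P, fun y => by
          rw [map_mul, hP, MvPolynomial.eval_C, LinearMap.smul_apply, smul_eq_mul]⟩ }
  exact fun l => mem_of_forall_evalAt_mem p h l

theorem IsPolyMap.exists_differential {σ : Type} [Fintype σ] {V : Type} [AddCommGroup V]
    [Module ℂ V] [FiniteDimensional ℂ V] {F : (σ → ℂ) → V} (hF : IsPolyMap F) (a : σ → ℂ) :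
    ∃ L : (σ → ℂ) →ₗ[ℂ] V, ∀ b, HasDirDeriv F a b (L b) := by
  classical
  let B := Module.finBasis ℂ V
  choose P hP using fun i => hF (B.coord i)
  let L : (σ → ℂ) →ₗ[ℂ] V :=
    ∑ i, (∑ j, MvPolynomial.eval a (MvPolynomial.pderiv j (P i)) •
      (LinearMap.proj j : (σ → ℂ) →ₗ[ℂ] ℂ)).smulRight (B i)
  refine ⟨L, fun b l => ?_⟩
  have h1 : ∀ v : V, l v = ∑ i, B.coord i v * l (B i) := by
    intro v
    conv_lhs => rw [← B.sum_repr v]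
    refine (map_sum l _ _).trans (Finset.sum_congr rfl fun i _ => ?_)
    exact map_smul l _ _
  have h2 : l (L b) = ∑ i, (∑ j, b j * MvPolynomial.eval a (MvPolynomial.pderiv j (P i))) *
      l (B i) := by
    simp only [L, LinearMap.sum_apply, LinearMap.smulRight_apply, LinearMap.smul_apply,
      LinearMap.proj_apply, map_sum, map_smul, smul_eq_mul, mul_comm]
  rw [h2]
  have h3 : (fun t : ℂ => l (F (a + t • b))) = fun t : ℂ =>
      ∑ i, MvPolynomial.eval (a + t • b) (P i) * l (B i) := by
    funext t
    rw [h1]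
    simp only [hP]
  rw [h3]
  exact HasDerivAt.fun_sum fun i _ => (hasDerivAt_eval_line (P i) a b).mul_const _

theorem HasDirDeriv.unique {σ : Type} {V : Type} [AddCommGroup V] [Module ℂ V]
    {F : (σ → ℂ) → V} {a b : σ → ℂ} {w w' : V} (h : HasDirDeriv F a b w)
    (h' : HasDirDeriv F a b w') : w = w' := by
  rw [← sub_eq_zero, ← Module.forall_dual_apply_eq_zero_iff ℂ]
  intro l
  rw [map_sub, (h l).unique (h' l), sub_self]

/-! ### The family of pull-backs of a space of forms -/

section Family

variable {n q e m : ℕ} (u : Fin m → twistedForms n q e)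

/-- The matrix part of the parameters. -/
def paramMat {n m : ℕ} (y : (Fin (n + 1) × Fin (n + 1)) ⊕ Fin m → ℂ) :
    Matrix (Fin (n + 1)) (Fin (n + 1)) ℂ := Matrix.of fun i j => y (Sum.inl (i, j))

/-- The parameters with given matrix and coefficients. -/
def mkParam {n m : ℕ} (T : Matrix (Fin (n + 1)) (Fin (n + 1)) ℂ) (z : Fin m → ℂ) :
    (Fin (n + 1) × Fin (n + 1)) ⊕ Fin m → ℂ := Sum.elim (fun ij => T ij.1 ij.2) z

/-- The family of the pull-backs, by all linear maps, of the linear combinations of given forms. -/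
def pullFamily (y : (Fin (n + 1) × Fin (n + 1)) ⊕ Fin m → ℂ) : twistedForms n q e :=
  linPull (paramMat y) (∑ k, y (Sum.inr k) • u k)

theorem isPolyMap_pullFamily : IsPolyMap (pullFamily u) := by
  refine isPolyMap_of_formAt fun a v => ?_
  let σ := (Fin (n + 1) × Fin (n + 1)) ⊕ Fin m
  let TX : (Fin (n + 1) → ℂ) → Fin (n + 1) → MvPolynomial σ ℂ := fun x i =>
    ∑ j, MvPolynomial.X (Sum.inl (i, j)) * MvPolynomial.C (x j)
  have hTX : ∀ y x i, MvPolynomial.eval y (TX x i) = (paramMat y).mulVec x i := by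
    intro y x i
    simp [TX, paramMat, Matrix.mulVec, dotProduct]
  refine ⟨∑ k, MvPolynomial.X (Sum.inr k) * ∑ I : Fin q ↪o Fin (n + 1),
    MvPolynomial.aeval (TX a) (coeffForm (u k).1 I) *
      (Matrix.of fun j l => TX (v j) (I l)).det, fun y => ?_⟩
  have h0 : formAt (pullFamily u y).1 a v =
      ∑ k, y (Sum.inr k) * formAt (u k).1 ((paramMat y).mulVec a)
        fun j => (paramMat y).mulVec (v j) := by
    rw [pullFamily, map_sum]
    change evalAt a v _ = _
    rw [map_sum]
    refine Finset.sum_congr rfl fun k _ => ?_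
    rw [map_smul, map_smul, smul_eq_mul]
    congr 1
    exact formAt_linPull _ _ _ _
  rw [h0, map_sum]
  refine Finset.sum_congr rfl fun k _ => ?_
  rw [map_mul, MvPolynomial.eval_X, formAt_apply, map_sum]
  congr 1
  refine Finset.sum_congr rfl fun I _ => ?_
  rw [map_mul, eval_aeval_apply, RingHom.map_det]
  simp only [hTX]
  congr 2
  ext j l
  exact hTX _ _ _

end Family

/-! ### Orbits of a space of forms under linear substitutions -/

/-- A polynomial right action of the monoid of square matrices on a vector space. -/
structure PolyRep (n : ℕ) (V : Type) [AddCommGroup V] [Module ℂ V] where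
  /-- The action of a matrix. -/
  act : Matrix (Fin (n + 1)) (Fin (n + 1)) ℂ → V →ₗ[ℂ] V
  act_act : ∀ T T' v, act T (act T' v) = act (T' * T) v
  act_one : ∀ v, act 1 v = v
  isPolyMap : ∀ (m : ℕ) (u : Fin m → V),
    IsPolyMap fun y : (Fin (n + 1) × Fin (n + 1)) ⊕ Fin m → ℂ =>
      act (paramMat y) (∑ k, y (Sum.inr k) • u k)

/-- The action by pull-back on twisted forms. -/
def pullRep (n q e : ℕ) : PolyRep n (twistedForms n q e) where
  act := linPull
  act_act := linPull_linPull
  act_one := linPull_one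
  isPolyMap _ u := isPolyMap_pullFamily u

namespace PolyRep

variable {n : ℕ} {V : Type} [AddCommGroup V] [Module ℂ V] (ρ : PolyRep n V)

/-- The orbit map of a family of vectors. -/
def orbitMap {m : ℕ} (u : Fin m → V) (y : (Fin (n + 1) × Fin (n + 1)) ⊕ Fin m → ℂ) : V :=
  ρ.act (paramMat y) (∑ k, y (Sum.inr k) • u k)

theorem orbitMap_mkParam {m : ℕ} (u : Fin m → V) (T : Matrix (Fin (n + 1)) (Fin (n + 1)) ℂ)
    (z : Fin m → ℂ) : ρ.orbitMap u (mkParam T z) = ρ.act T (∑ k, z k • u k) := rfl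

theorem isPolyMap_orbitMap {m : ℕ} (u : Fin m → V) : IsPolyMap (ρ.orbitMap u) :=
  ρ.isPolyMap m u

variable [FiniteDimensional ℂ V]

/-- Linearity in B is the point: the derivative is a partial differential at (1, 1) of the
polynomial map (T, z) ↦ act T (zΩ), and a polynomial map has a linear differential. -/
theorem exists_lieDer (Ω : V) :
    ∃ L : Matrix (Fin (n + 1)) (Fin (n + 1)) ℂ →ₗ[ℂ] V,
      ∀ B (l : Module.Dual ℂ (V)),
        HasDerivAt (fun t : ℂ => l (ρ.act (1 + t • B) Ω)) (l (L B)) 0 := by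
  obtain ⟨L, hL⟩ := (ρ.isPolyMap_orbitMap (fun _ : Fin 1 => Ω)).exists_differential
    (mkParam 1 fun _ => 1)
  let ι : Matrix (Fin (n + 1)) (Fin (n + 1)) ℂ →ₗ[ℂ]
      ((Fin (n + 1) × Fin (n + 1)) ⊕ Fin 1 → ℂ) :=
    { toFun := fun B => mkParam B 0
      map_add' := fun B B' => by
        funext x
        rcases x with x | x <;> simp [mkParam]
      map_smul' := fun c B => by
        funext x
        rcases x with x | x <;> simp [mkParam] }
  refine ⟨L.comp ι, fun B l => ?_⟩
  have h := hL (ι B) l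
  have e1 : ∀ t : ℂ, mkParam 1 (fun _ => 1) + t • ι B = mkParam (1 + t • B) fun _ : Fin 1 => 1 := by
    intro t
    funext x
    rcases x with x | x <;> simp [ι, mkParam]
  simp only [e1, orbitMap_mkParam, Finset.univ_unique, Finset.sum_singleton, one_smul] at h
  exact h

/-- The Lie derivative of a form along linear vector fields. -/
def lieDer (Ω : V) :
    Matrix (Fin (n + 1)) (Fin (n + 1)) ℂ →ₗ[ℂ] V :=
  (ρ.exists_lieDer Ω).choose

theorem hasDerivAt_act (Ω : V) (B : Matrix (Fin (n + 1)) (Fin (n + 1)) ℂ)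
    (l : Module.Dual ℂ (V)) :
    HasDerivAt (fun t : ℂ => l (ρ.act (1 + t • B) Ω)) (l (ρ.lieDer Ω B)) 0 :=
  (ρ.exists_lieDer Ω).choose_spec B l

/-- At an invertible T every tangent matrix has the form B'T, and the differential of the orbit map
sends (B'T, z') to the image under act T of L_{B'}Ω + ∑ z'_k u_k. Modulo the span U only a
complement of {B' : L_{B'}Ω ∈ U} contributes, so the rank is at most m + (n+1)² − κ. Singular T are
discarded through the nonzero polynomial det T. -/
theorem zariskiDim_closureIn_le_of_family {m : ℕ} (u : Fin m → V) {D κ : ℕ}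
    (hκ : ∀ Ω ∈ Submodule.span ℂ (Set.range u),
      κ ≤ Module.finrank ℂ ((Submodule.span ℂ (Set.range u)).comap (ρ.lieDer Ω)))
    (hD : (n + 1) * (n + 1) + m ≤ D + 1 + κ) {A B : Set (ℙ ℂ V)}
    (hA : ∀ x ∈ A, ∃ (T : Matrix (Fin (n + 1)) (Fin (n + 1)) ℂ),
      ∃ Ω ∈ Submodule.span ℂ (Set.range u), ∃ h : ρ.act T Ω ≠ 0,
        x = Projectivization.mk ℂ (ρ.act T Ω) h) :
    zariskiDim (zariskiClosureIn A B) ≤ (D : WithBot ℕ∞) := by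
  classical
  have hF := ρ.isPolyMap_orbitMap u
  choose L hL using fun a => hF.exists_differential a
  have hmk : ∀ y : (Fin (n + 1) × Fin (n + 1)) ⊕ Fin m → ℂ,
      y = mkParam (paramMat y) fun k => y (Sum.inr k) := by
    intro y
    funext x
    rcases x with x | x <;> rfl
  let dm : MvPolynomial ((Fin (n + 1) × Fin (n + 1)) ⊕ Fin m) ℂ :=
    (Matrix.of fun i j => MvPolynomial.X (Sum.inl (i, j))).det
  have hdm : ∀ y, MvPolynomial.eval y dm = (paramMat y).det := by
    intro y
    rw [RingHom.map_det]
    congr 1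
    ext i j
    simp [paramMat]
  refine zariskiDim_closureIn_le hF ?_ (h := dm) ?_ L (fun a _ b => hL a b) ?_ ?_
  · intro c y
    refine ⟨mkParam (paramMat y) fun k => c * y (Sum.inr k), ?_⟩
    rw [orbitMap_mkParam, orbitMap, ← map_smul, Finset.smul_sum]
    simp only [mul_smul]
  · intro h0
    have := hdm (mkParam 1 0)
    rw [h0, map_zero] at this
    have h1 : paramMat (mkParam (1 : Matrix (Fin (n + 1)) (Fin (n + 1)) ℂ) (0 : Fin m → ℂ)) = 1 := by
      ext i j; rfl
    rw [h1, Matrix.det_one] at this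
    exact zero_ne_one this
  · intro y hy
    rw [hdm] at hy
    set T := paramMat y with hT
    set z : Fin m → ℂ := fun k => y (Sum.inr k) with hz
    set Ω := ∑ k, z k • u k with hΩ
    let U := Submodule.span ℂ (Set.range u)
    have hΩU : Ω ∈ U := Submodule.sum_mem _ fun k _ =>
      U.smul_mem _ (Submodule.subset_span ⟨k, rfl⟩)
    let K := U.comap (ρ.lieDer Ω)
    obtain ⟨C, hC⟩ := K.exists_isCompl
    have hTinv : IsUnit T.det := isUnit_iff_ne_zero.2 hy
    have hrange : LinearMap.range (L y) ≤ (U ⊔ C.map (ρ.lieDer Ω)).map (ρ.act T) := by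
      rintro _ ⟨b, rfl⟩
      let B' := paramMat b * T⁻¹
      let z' : Fin m → ℂ := fun k => b (Sum.inr k)
      have hb : b = mkParam (B' * T) 0 + mkParam 0 z' := by
        rw [hmk b, Matrix.nonsing_inv_mul_cancel_right _ _ hTinv]
        funext x
        rcases x with x | x <;> simp [mkParam, z']
      have h1 : L y (mkParam (B' * T) 0) = ρ.act T (ρ.lieDer Ω B') := by
        refine (hL y _).unique fun l => ?_
        have h2 := ρ.hasDerivAt_act Ω B' (l.comp (ρ.act T))
        have e1 : ∀ t : ℂ, y + t • mkParam (B' * T) 0 = mkParam ((1 + t • B') * T) z := by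
          intro t
          rw [hmk y]
          funext x
          rcases x with x | x <;> simp [mkParam, add_mul, hz, hT]
        simp only [e1, orbitMap_mkParam, ← ρ.act_act]
        exact h2
      have h2 : L y (mkParam 0 z') = ρ.act T (∑ k, z' k • u k) := by
        refine (hL y _).unique fun l => ?_
        have e1 : ∀ t : ℂ, y + t • mkParam 0 z' = mkParam T (z + t • z') := by
          intro t
          rw [hmk y]
          funext x
          rcases x with x | x <;> simp [mkParam, hz, hT]
        have e2 : ∀ t : ℂ, l (ρ.orbitMap u (y + t • mkParam 0 z')) =
            l (ρ.act T Ω) + t * l (ρ.act T (∑ k, z' k • u k)) := by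
          intro t
          rw [e1, orbitMap_mkParam]
          simp only [Pi.add_apply, Pi.smul_apply, add_smul, Finset.sum_add_distrib,
            map_add, mul_smul, ← Finset.smul_sum, map_smul, smul_eq_mul, hΩ]
        simp only [e2]
        simpa using ((hasDerivAt_id (0 : ℂ)).mul_const
          (l (ρ.act T (∑ k, z' k • u k)))).const_add (l (ρ.act T Ω))
      rw [hb, map_add, h1, h2, ← map_add]
      refine Submodule.mem_map_of_mem ?_
      have hB' : B' ∈ K ⊔ C := by rw [hC.sup_eq_top]; exact Submodule.mem_top
      obtain ⟨b1, hb1, b2, hb2, hb12⟩ := Submodule.mem_sup.1 hB'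
      have e3 : ρ.lieDer Ω B' + ∑ k, z' k • u k =
          (∑ k, z' k • u k + ρ.lieDer Ω b1) + ρ.lieDer Ω b2 := by
        rw [← hb12, map_add]
        abel
      rw [e3]
      refine Submodule.add_mem_sup (U.add_mem ?_ hb1) (Submodule.mem_map_of_mem hb2)
      exact Submodule.sum_mem _ fun k _ => U.smul_mem _ (Submodule.subset_span ⟨k, rfl⟩)
    have hU : Module.finrank ℂ U ≤ m := by
      have := finrank_range_le_card (R := ℂ) (b := u)
      rwa [Fintype.card_fin] at this
    have h1 := Submodule.finrank_mono hrange
    have h2 := Submodule.finrank_map_le (ρ.act T) (U ⊔ C.map (ρ.lieDer Ω))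
    have h3 := Submodule.finrank_add_le_finrank_add_finrank U (C.map (ρ.lieDer Ω))
    have h4 := Submodule.finrank_map_le (ρ.lieDer Ω) C
    have h5 := Submodule.finrank_add_eq_of_isCompl hC
    have h6 : Module.finrank ℂ (Matrix (Fin (n + 1)) (Fin (n + 1)) ℂ) = (n + 1) * (n + 1) := by
      rw [Module.finrank_matrix]; simp
    have h7 : κ ≤ Module.finrank ℂ K := hκ Ω hΩU
    omega
  · intro x hx
    obtain ⟨T, Ω, hΩ, h, rfl⟩ := hA x hx
    obtain ⟨z, hz⟩ := (Submodule.mem_span_range_iff_exists_fun ℂ).1 hΩ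
    refine ⟨mkParam T z, ?_, ?_⟩
    · rw [orbitMap_mkParam, hz]; exact h
    · congr 1
      rw [orbitMap_mkParam, hz]

/-- Only parameters transverse to the symmetries are kept: matrices 1 + ∑ y_k c_k, with c_k a basis
of a complement C of {B : L_B(u 0) ∈ U}, and coefficients on the basis u of U. At T = 1 and Ω = u 0
the derivatives are the u_l and the L_{c_k}(u 0), which are independent because C maps injectively
to V/U. -/
theorem le_zariskiDim_of_family {m : ℕ} (u : Fin (m + 1) → V)
    (hu : LinearIndependent ℂ u) {D κ : ℕ}
    (hκ : Module.finrank ℂ ((Submodule.span ℂ (Set.range u)).comap (ρ.lieDer (u 0))) ≤ κ)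
    (hD : D + 1 + κ ≤ (n + 1) * (n + 1) + (m + 1)) {h : MvPolynomial (Fin (m + 1)) ℂ}
    (hh : MvPolynomial.eval (Pi.single 0 1) h ≠ 0) {Z : Set (ℙ ℂ (V))}
    (hZ : ∀ T : Matrix (Fin (n + 1)) (Fin (n + 1)) ℂ, T.det ≠ 0 → ∀ z : Fin (m + 1) → ℂ,
      MvPolynomial.eval z h ≠ 0 → ∃ h : ρ.act T (∑ k, z k • u k) ≠ 0,
        Projectivization.mk ℂ _ h ∈ Z) :
    (D : WithBot ℕ∞) ≤ zariskiDim Z := by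
  classical
  let U := Submodule.span ℂ (Set.range u)
  let K := U.comap (ρ.lieDer (u 0))
  obtain ⟨C, hC⟩ := K.exists_isCompl
  let r := Module.finrank ℂ C
  let c : Module.Basis (Fin r) ℂ C := Module.finBasis ℂ C
  have hr : D ≤ m + r := by
    have h5 := Submodule.finrank_add_eq_of_isCompl hC
    have h6 : Module.finrank ℂ (Matrix (Fin (n + 1)) (Fin (n + 1)) ℂ) = (n + 1) * (n + 1) := by
      rw [Module.finrank_matrix]; simp
    have h7 : Module.finrank ℂ K ≤ κ := hκ
    omega
  refine le_trans (b := ((m + r : ℕ) : WithBot ℕ∞)) (by exact_mod_cast hr) ?_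
  -- The coefficient of u 0 receives index 0, so that the base point is supported there, as
  -- `le_zariskiDim` requires.
  let E : Fin (m + 1) ⊕ Fin r ≃ Fin (m + r + 1) :=
    finSumFinEquiv.trans (finCongr (by omega))
  have hE0 : E (Sum.inl 0) = 0 := rfl
  let ψ : (Fin (n + 1) × Fin (n + 1)) ⊕ Fin (m + 1) → MvPolynomial (Fin (m + r + 1)) ℂ :=
    Sum.elim (fun ij => MvPolynomial.C ((1 : Matrix (Fin (n + 1)) (Fin (n + 1)) ℂ) ij.1 ij.2) +
        ∑ k, MvPolynomial.X (E (Sum.inr k)) * MvPolynomial.C ((c k : Matrix _ _ ℂ) ij.1 ij.2))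
      fun l => MvPolynomial.X (E (Sum.inl l))
  let Ty : (Fin (m + r + 1) → ℂ) → Matrix (Fin (n + 1)) (Fin (n + 1)) ℂ := fun y =>
    1 + ∑ k, y (E (Sum.inr k)) • (c k : Matrix (Fin (n + 1)) (Fin (n + 1)) ℂ)
  have hψ : ∀ y, (fun k => MvPolynomial.eval y (ψ k)) =
      mkParam (Ty y) fun l => y (E (Sum.inl l)) := by
    intro y
    funext x
    rcases x with x | x
    · simp [ψ, mkParam, Ty, Matrix.sum_apply]
    · simp [ψ, mkParam]
  let F : (Fin (m + r + 1) → ℂ) → V := fun y =>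
    ρ.act (Ty y) (∑ l, y (E (Sum.inl l)) • u l)
  have hF : IsPolyMap F := by
    have := (ρ.isPolyMap_orbitMap u).comp ψ
    simp only [hψ, orbitMap_mkParam] at this
    exact this
  let a : Fin (m + r + 1) → ℂ := Pi.single 0 1
  have hsE : ∀ x x', (Pi.single (E x) (1 : ℂ) : Fin (m + r + 1) → ℂ) (E x') =
      if x' = x then 1 else 0 := by
    intro x x'
    simp only [Pi.single_apply, E.injective.eq_iff]
  have haE : ∀ x, a (E x) = if x = Sum.inl 0 then 1 else 0 := fun x => by
    rw [← hsE (Sum.inl 0) x]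
    rfl
  let w : Fin (m + r + 1) → V := fun j =>
    Sum.elim u (fun k => ρ.lieDer (u 0) (c k)) (E.symm j)
  let hpoly : MvPolynomial (Fin (m + r + 1)) ℂ :=
    (Matrix.of fun i j => ψ (Sum.inl (i, j))).det *
      MvPolynomial.rename (fun l => E (Sum.inl l)) h
  have hhpoly : ∀ y, MvPolynomial.eval y hpoly =
      (Ty y).det * MvPolynomial.eval (fun l => y (E (Sum.inl l))) h := by
    intro y
    rw [map_mul, RingHom.map_det, MvPolynomial.eval_rename]
    congr 2
    ext i j
    exact congrFun (hψ y) (Sum.inl (i, j))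
  have ha0 : Ty a = 1 := by
    simp [Ty, haE]
  have hal : (fun l => a (E (Sum.inl l))) = Pi.single 0 1 := by
    funext l
    rw [haE, Pi.single_apply]
    simp
  refine le_zariskiDim hF (a := a) (fun j hj => by simp [a, hj]) (w := w) ?_ ?_ ?_ (h := hpoly) ?_ ?_
  · intro j
    obtain ⟨x, rfl⟩ := E.surjective j
    rcases x with l | k
    · intro l'
      have e1 : ∀ t : ℂ, l' (F (a + t • Pi.single (E (Sum.inl l)) 1)) =
          l' (u 0) + t * l' (u l) := by
        intro t
        simp only [F, Ty, Pi.add_apply, Pi.smul_apply, haE, hsE]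
        simp [ρ.act_one, add_smul, Finset.sum_add_distrib]
      simp only [e1, w, Equiv.symm_apply_apply, Sum.elim_inl]
      simpa using ((hasDerivAt_id (0 : ℂ)).mul_const (l' (u l))).const_add (l' (u 0))
    · intro l'
      have e1 : ∀ t : ℂ, l' (F (a + t • Pi.single (E (Sum.inr k)) 1)) =
          l' (ρ.act (1 + t • (c k : Matrix (Fin (n + 1)) (Fin (n + 1)) ℂ)) (u 0)) := by
        intro t
        simp only [F, Ty, Pi.add_apply, Pi.smul_apply, haE, hsE]
        simp
      simp only [e1, w, Equiv.symm_apply_apply, Sum.elim_inr]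
      exact ρ.hasDerivAt_act _ _ _
  · rw [← linearIndependent_equiv E]
    have e1 : w ∘ E = Sum.elim u fun k => ρ.lieDer (u 0) (c k) := by
      funext x
      simp [w]
    rw [e1]
    have hinj : Disjoint C (LinearMap.ker (U.mkQ.comp (ρ.lieDer (u 0)))) := by
      rw [LinearMap.ker_comp, Submodule.ker_mkQ]
      exact hC.disjoint.symm
    have hcC : LinearIndependent ℂ fun k => (c k : Matrix (Fin (n + 1)) (Fin (n + 1)) ℂ) :=
      c.linearIndependent.map' C.subtype C.ker_subtype
    have hspan : Submodule.span ℂ (Set.range fun k =>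
        (c k : Matrix (Fin (n + 1)) (Fin (n + 1)) ℂ)) ≤ C := by
      rw [Submodule.span_le]
      rintro _ ⟨k, rfl⟩
      exact (c k).2
    have hq : LinearIndependent ℂ ((U.mkQ.comp (ρ.lieDer (u 0))) ∘ fun k =>
        (c k : Matrix (Fin (n + 1)) (Fin (n + 1)) ℂ)) :=
      hcC.map (hinj.mono_left hspan)
    refine LinearIndependent.sum_type hu (LinearIndependent.of_comp U.mkQ hq) ?_
    rw [Submodule.disjoint_def]
    intro x hx hx'
    have hsub : Submodule.span ℂ (Set.range fun k => ρ.lieDer (u 0) (c k)) ≤ C.map (ρ.lieDer (u 0)) := by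
      rw [Submodule.span_le]
      rintro _ ⟨k, rfl⟩
      exact Submodule.mem_map_of_mem (c k).2
    obtain ⟨b, hb, rfl⟩ := hsub hx'
    have : b = 0 := (Submodule.disjoint_def.1 hC.disjoint) b hx hb
    rw [this, map_zero]
  · intro s y
    refine ⟨fun j => Sum.elim (fun _ => s) (fun _ => 1) (E.symm j) * y j, fun j hj => by
      simp only [hj, mul_zero], ?_⟩
    simp only [F, Ty, Equiv.symm_apply_apply, Sum.elim_inl, Sum.elim_inr, one_mul, mul_smul,
      ← Finset.smul_sum, map_smul]
  · rw [hhpoly, ha0, hal, Matrix.det_one, one_mul]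
    exact hh
  · intro y hy
    rw [hhpoly] at hy
    exact hZ _ (left_ne_zero_of_mul hy) _ (right_ne_zero_of_mul hy)

end PolyRep

/-! ### Contractions of the determinant -/

section Alternating

variable {R M : Type*} [CommRing R] [AddCommGroup M] [Module R M]

theorem curryLeft_swap {k : ℕ} (f : M [⋀^Fin (k + 2)]→ₗ[R] R) (a b : M) :
    (f.curryLeft a).curryLeft b = -(f.curryLeft b).curryLeft a := by
  have h := f.curryLeft_same (a + b)
  simp only [map_add, AlternatingMap.curryLeft_add, LinearMap.add_apply,
    AlternatingMap.curryLeft_same, zero_add, add_zero] at h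
  exact eq_neg_of_add_eq_zero_right h

theorem update_vecCons_zero {α : Type*} {k : ℕ} (a x : α) (v : Fin k → α) :
    Function.update (Matrix.vecCons a v) 0 x = Matrix.vecCons x v := by
  funext i
  refine Fin.cases ?_ (fun j => ?_) i <;> simp

theorem update_vecCons_succ {α : Type*} {k : ℕ} (a x : α) (v : Fin k → α) (i : Fin k) :
    Function.update (Matrix.vecCons a v) i.succ x = Matrix.vecCons a (Function.update v i x) := by
  funext j
  refine Fin.cases ?_ (fun j => ?_) j
  · simp [Function.update_of_ne (Fin.succ_ne_zero i).symm]
  · by_cases h : j = i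
    · subst h; simp
    · simp [h]

theorem vecCons_comp_succAbove_zero {α : Type*} {k : ℕ} (a : α) (v : Fin k → α) :
    (fun j => Matrix.vecCons a v ((0 : Fin (k + 1)).succAbove j)) = v := by
  funext j; simp

theorem vecCons_comp_succAbove_succ {α : Type*} {k : ℕ} (a : α) (v : Fin (k + 1) → α)
    (i : Fin (k + 1)) : (fun j => Matrix.vecCons a v (i.succ.succAbove j)) =
      Matrix.vecCons a fun j => v (i.succAbove j) := by
  funext j
  refine Fin.cases ?_ (fun j => ?_) j <;> simp

/-- The first entry of an alternating map can be moved to any place. -/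
theorem map_vecCons_succAbove {k : ℕ} (f : M [⋀^Fin (k + 1)]→ₗ[R] R) (x : M)
    (v : Fin (k + 1) → M) (i : Fin (k + 1)) :
    f (Matrix.vecCons x fun j => v (i.succAbove j)) = (-1) ^ (i : ℕ) * f (Function.update v i x) := by
  induction k with
  | zero =>
    have hi : i = 0 := Fin.ext (by omega)
    subst hi
    rw [Fin.val_zero, pow_zero, one_mul]
    congr 1
    funext j
    have hj : j = 0 := Fin.ext (by omega)
    subst hj
    simp
  | succ k ih =>
    refine Fin.cases ?_ (fun i => ?_) i
    · rw [Fin.val_zero, pow_zero, one_mul]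
      congr 1
      funext j
      refine Fin.cases ?_ (fun j => ?_) j <;> simp
    · have hv : v = Matrix.vecCons (v 0) fun j => v j.succ := by
        funext j
        refine Fin.cases ?_ (fun j => ?_) j <;> simp
      have h := ih (f.curryLeft (v 0)) (fun j => v j.succ) i
      rw [AlternatingMap.curryLeft_apply_apply, AlternatingMap.curryLeft_apply_apply,
        ← update_vecCons_succ, ← hv] at h
      rw [Fin.val_succ, pow_succ, mul_assoc, mul_comm (-1 : R), ← mul_assoc, ← h]
      have e : (fun j => v (i.succ.succAbove j)) =
          Matrix.vecCons (v 0) fun j => v (i.succAbove j).succ := by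
        conv_lhs => rw [hv]
        exact vecCons_comp_succAbove_succ _ _ _
      rw [e, ← AlternatingMap.curryLeft_apply_apply, ← AlternatingMap.curryLeft_apply_apply,
        curryLeft_swap]
      simp

/-- The relation `∑ (-1)^j ℓ(u_j) f(u_0, …, û_j, …) = 0`. -/
def IsPlucker {k : ℕ} (f : M [⋀^Fin k]→ₗ[R] R) (ℓ : M →ₗ[R] R) : Prop :=
  ∀ u : Fin (k + 1) → M, ∑ j : Fin (k + 1), (-1) ^ (j : ℕ) * (ℓ (u j) * f fun i => u (j.succAbove i)) = 0

/-- The relation reads ℓ ∧ f = 0, and i_a(ℓ ∧ f) = ℓ(a) f − ℓ ∧ i_a f. -/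
theorem IsPlucker.curryLeft {k : ℕ} {f : M [⋀^Fin (k + 1)]→ₗ[R] R} {ℓ : M →ₗ[R] R}
    (h : IsPlucker f ℓ) {a : M} (ha : ℓ a = 0) : IsPlucker (f.curryLeft a) ℓ := by
  intro u
  have h1 := h (Matrix.vecCons a u)
  rw [Fin.sum_univ_succ] at h1
  simp only [Matrix.cons_val_zero, ha, zero_mul, mul_zero, zero_add, Matrix.cons_val_succ,
    vecCons_comp_succAbove_succ, Fin.val_succ, pow_succ] at h1
  simp only [AlternatingMap.curryLeft_apply_apply]
  rw [← neg_eq_zero, ← Finset.sum_neg_distrib, ← h1]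
  exact Finset.sum_congr rfl fun j _ => by ring

theorem IsPlucker.add {k : ℕ} {f g : M [⋀^Fin k]→ₗ[R] R} {ℓ : M →ₗ[R] R}
    (hf : IsPlucker f ℓ) (hg : IsPlucker g ℓ) : IsPlucker (f + g) ℓ := by
  intro u
  simp only [AlternatingMap.add_apply, mul_add, Finset.sum_add_distrib, hf u, hg u, add_zero]

theorem IsPlucker.smul {k : ℕ} {f : M [⋀^Fin k]→ₗ[R] R} {ℓ : M →ₗ[R] R}
    (hf : IsPlucker f ℓ) (c : R) : IsPlucker (c • f) ℓ := by
  intro u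
  have := hf u
  simp only [AlternatingMap.smul_apply, smul_eq_mul]
  rw [← mul_zero c, ← this, Finset.mul_sum]
  exact Finset.sum_congr rfl fun j _ => by ring

/-- There are no nonzero (m+1)-forms in m variables. Concretely, bordering the rows u_i with the
entries ℓ(u_i) gives a square matrix whose first column is a combination of the others; expanding
its determinant along that column gives the relation. -/
theorem isPlucker_det {m : ℕ} (ℓ : (Fin m → R) →ₗ[R] R) :
    IsPlucker (Matrix.detRowAlternating : (Fin m → R) [⋀^Fin m]→ₗ[R] R) ℓ := by
  intro u
  let A : Matrix (Fin (m + 1)) (Fin (m + 1)) R := Matrix.of fun i => Matrix.vecCons (ℓ (u i)) (u i)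
  have h1 : A.det = 0 := by
    have h2 := A.det_updateCol_sum 0 (Matrix.vecCons 0 fun k => ℓ (Pi.single k 1))
    rw [Matrix.cons_val_zero, zero_smul] at h2
    rw [← h2]
    congr 1
    ext i j
    refine Fin.cases ?_ (fun j => ?_) j
    · rw [Matrix.updateCol_self, Fin.sum_univ_succ]
      simp only [Matrix.cons_val_zero, smul_eq_mul, zero_mul, zero_add, Matrix.cons_val_succ, A,
        Matrix.of_apply]
      have hl := congrArg ℓ ((Pi.basisFun R (Fin m)).sum_repr (u i)).symm
      simp only [map_sum, map_smul, Pi.basisFun_repr, Pi.basisFun_apply, smul_eq_mul] at hl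
      rw [hl]
      exact Finset.sum_congr rfl fun k _ => mul_comm _ _
    · rw [Matrix.updateCol_ne (Fin.succ_ne_zero j)]
  rw [← h1, Matrix.det_succ_column_zero]
  refine Finset.sum_congr rfl fun j _ => ?_
  rw [mul_assoc]
  rfl

/-- The derivation of alternating maps given by an endomorphism. -/
def derivSum {k : ℕ} (f : M [⋀^Fin k]→ₗ[R] R) (B : M →ₗ[R] M) (v : Fin k → M) : R :=
  ∑ i, f (Function.update v i (B (v i)))

theorem derivSum_vecCons {k : ℕ} (f : M [⋀^Fin (k + 1)]→ₗ[R] R) (B : M →ₗ[R] M) (a : M)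
    (v : Fin k → M) : derivSum f B (Matrix.vecCons a v) =
      f.curryLeft (B a) v + derivSum (f.curryLeft a) B v := by
  rw [derivSum, Fin.sum_univ_succ]
  simp only [Matrix.cons_val_zero, Matrix.cons_val_succ, update_vecCons_zero, update_vecCons_succ]
  rfl

theorem sum_vecCons_succAbove {k : ℕ} (f : M [⋀^Fin (k + 1)]→ₗ[R] R) (B : M →ₗ[R] M)
    (v : Fin (k + 1) → M) :
    ∑ i : Fin (k + 1), (-1) ^ (i : ℕ) * f.curryLeft (B (v i)) (fun j => v (i.succAbove j)) =
      derivSum f B v := by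
  refine Finset.sum_congr rfl fun i _ => ?_
  rw [AlternatingMap.curryLeft_apply_apply, map_vecCons_succAbove, ← mul_assoc, ← mul_pow]
  simp

/-- This is the derivative at T = 1 of det(Tv_1, …, Tv_m) = det T · det(v). Cramer's rule computes
each replaced row, and the sum over the rows is a trace in which the adjugate cancels against the
matrix of v. -/
theorem derivSum_det {m : ℕ} (B : Matrix (Fin m) (Fin m) R) (v : Fin m → Fin m → R) :
    derivSum (Matrix.detRowAlternating : (Fin m → R) [⋀^Fin m]→ₗ[R] R) B.mulVecLin v =
      B.trace * Matrix.detRowAlternating v := by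
  let A : Matrix (Fin m) (Fin m) R := Matrix.of v
  have h1 : ∀ i, (Matrix.detRowAlternating : (Fin m → R) [⋀^Fin m]→ₗ[R] R)
      (Function.update v i (B.mulVecLin (v i))) = (A.adjugate.transpose.mulVec (B.mulVec (A i))) i := by
    intro i
    have := A.cramer_transpose_apply (B.mulVec (A i)) i
    rw [Matrix.cramer_eq_adjugate_mulVec, ← Matrix.adjugate_transpose] at this
    rw [this]
    rfl
  rw [derivSum]
  simp only [h1]
  have h2 : ∑ i, (A.adjugate.transpose.mulVec (B.mulVec (A i))) i =
      (A.adjugate.transpose * (B * A.transpose)).trace := by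
    simp only [Matrix.trace, Matrix.diag, Matrix.mul_apply, Matrix.mulVec, dotProduct,
      Matrix.transpose_apply]
  rw [h2, Matrix.trace_mul_comm, Matrix.mul_assoc, ← Matrix.transpose_mul, Matrix.adjugate_mul,
    Matrix.transpose_smul, Matrix.transpose_one, Matrix.mul_smul, Matrix.mul_one, Matrix.trace_smul,
    smul_eq_mul, mul_comm]
  rfl

end Alternating

/-- The contraction of the volume form by three vectors. -/
def vol3 {R : Type*} [CommRing R] {q : ℕ} (a b c : Fin (q + 3) → R) :
    (Fin (q + 3) → R) [⋀^Fin q]→ₗ[R] R :=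
  (((Matrix.detRowAlternating : (Fin (q + 3) → R) [⋀^Fin (q + 3)]→ₗ[R] R).curryLeft a).curryLeft
    b).curryLeft c

/-! ### Minors and vanishing contractions -/

section Minors

variable {R : Type*} [CommRing R]

/-- A minor of a family of vectors is, up to sign, a determinant. -/
theorem det_minor {k m N : ℕ} (hN : k + m = N) {I : Fin k → Fin N} (hI : Function.Injective I) :
    ∃ J : Fin m → Fin N, ∀ f : Fin N → Fin N → R,
      (∀ j, f (Fin.cast hN (Fin.natAdd k j)) = Pi.single (J j) 1) →
      Matrix.det (Matrix.of f) = 0 →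
      (Matrix.of fun i j => f (Fin.cast hN (Fin.castAdd m i)) (I j)).det = 0 := by
  classical
  have hc : Fintype.card ((Set.range I)ᶜ : Set (Fin N)) = m := by
    rw [Fintype.card_compl_set, Fintype.card_fin, Set.card_range_of_injective hI, Fintype.card_fin]
    omega
  let ε : Fin m ≃ ((Set.range I)ᶜ : Set (Fin N)) := (Fintype.equivFinOfCardEq hc).symm
  let σ : Fin k ⊕ Fin m ≃ Fin N :=
    (Equiv.sumCongr (Equiv.ofInjective I hI) ε).trans (Equiv.Set.sumCompl (Set.range I))
  let τ : Fin k ⊕ Fin m ≃ Fin N := finSumFinEquiv.trans (finCongr hN)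
  refine ⟨fun j => σ (Sum.inr j), fun f hf h0 => ?_⟩
  have h1 : ((Matrix.of f).submatrix τ σ).det = 0 := by
    have : (Matrix.of f).submatrix τ σ =
        ((Matrix.of f).submatrix id (τ.symm.trans σ)).submatrix τ τ := by
      ext i j
      simp
    rw [this, Matrix.det_submatrix_equiv_self, Matrix.det_permute', h0, mul_zero]
  -- With the columns of I moved to the front, the rows filled with the complementary coordinate
  -- vectors make the matrix block triangular, with an identity block.
  have h2 : (Matrix.of f).submatrix τ σ = Matrix.fromBlocks
      (Matrix.of fun i j => f (Fin.cast hN (Fin.castAdd m i)) (I j))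
      (Matrix.of fun i j => f (Fin.cast hN (Fin.castAdd m i)) (σ (Sum.inr j))) 0 1 := by
    ext i j
    rcases i with i | i <;> rcases j with j | j
    · rfl
    · rfl
    · change f (Fin.cast hN (Fin.natAdd k i)) (σ (Sum.inl j)) = 0
      rw [hf, Pi.single_eq_of_ne]
      intro h
      exact Sum.inl_ne_inr (σ.injective h)
    · change f (Fin.cast hN (Fin.natAdd k i)) (σ (Sum.inr j)) = (1 : Matrix (Fin m) (Fin m) R) i j
      rw [hf, Matrix.one_apply, Pi.single_apply]
      simp only [σ.injective.eq_iff, Sum.inr.injEq, eq_comm]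
  rwa [h2, Matrix.det_fromBlocks_zero₂₁, Matrix.det_one, mul_one] at h1

/-- Apply the contraction to the coordinate vectors complementary to i, j, k: up to sign, what
remains is this minor. The argument holds over any commutative ring, which allows its use for
polynomial fields, at points, and modulo an ideal. -/
theorem minor_three_eq_zero {q : ℕ} {a b c : Fin (q + 3) → R} (h : vol3 a b c = 0)
    {i j k : Fin (q + 3)} (hij : i ≠ j) (hik : i ≠ k) (hjk : j ≠ k) :
    Matrix.det !![a i, a j, a k; b i, b j, b k; c i, c j, c k] = 0 := by
  have hI : Function.Injective ![i, j, k] := by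
    intro x y
    fin_cases x <;> fin_cases y <;> simp [hij, hik, hjk, hij.symm, hik.symm, hjk.symm]
  obtain ⟨J, hJ⟩ := det_minor (R := R) (show 3 + q = q + 3 by omega) hI
  have h1 := hJ (Matrix.vecCons a (Matrix.vecCons b (Matrix.vecCons c fun l => Pi.single (J l) 1)))
    ?_ ?_
  · rw [← h1]
    congr 1
    ext x y
    fin_cases x <;> fin_cases y <;> rfl
  · intro l
    have : Fin.cast (show 3 + q = q + 3 by omega) (Fin.natAdd 3 l) = l.succ.succ.succ := by
      ext; simp
    rw [this]
    rfl
  · have := congrArg (fun f => f fun l => Pi.single (J l) 1) h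
    exact this

theorem minor_two_eq_zero {q : ℕ} {a b : Fin (q + 2) → R}
    (h : ((Matrix.detRowAlternating : (Fin (q + 2) → R) [⋀^Fin (q + 2)]→ₗ[R] R).curryLeft
      a).curryLeft b = 0) {i j : Fin (q + 2)} (hij : i ≠ j) : a i * b j = a j * b i := by
  have hI : Function.Injective ![i, j] := by
    intro x y
    fin_cases x <;> fin_cases y <;> simp [hij, hij.symm]
  obtain ⟨J, hJ⟩ := det_minor (R := R) (show 2 + q = q + 2 by omega) hI
  have h1 := hJ (Matrix.vecCons a (Matrix.vecCons b fun l => Pi.single (J l) 1)) ?_ ?_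
  · rw [Matrix.det_fin_two] at h1
    exact sub_eq_zero.1 h1
  · intro l
    have : Fin.cast (show 2 + q = q + 2 by omega) (Fin.natAdd 2 l) = l.succ.succ := by
      ext; simp
    rw [this]
    rfl
  · have := congrArg (fun f => f fun l => Pi.single (J l) 1) h
    exact this

end Minors

section Vol

variable {R : Type*} [CommRing R] {q : ℕ}

theorem vol3_swap₀₁ (a b c : Fin (q + 3) → R) : vol3 a b c = -vol3 b a c := by
  ext v
  exact congrArg (fun f => f (Matrix.vecCons c v)) (curryLeft_swap
    (Matrix.detRowAlternating : (Fin (q + 3) → R) [⋀^Fin (q + 3)]→ₗ[R] R) a b)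

theorem vol3_swap₁₂ (a b c : Fin (q + 3) → R) : vol3 a b c = -vol3 a c b :=
  curryLeft_swap _ _ _

end Vol

/-! ### Derivatives of determinants -/

theorem hasDerivAt_det {m : ℕ} {c : ℂ → Fin m → Fin m → ℂ} {c' : Fin m → Fin m → ℂ}
    (h : ∀ i j, HasDerivAt (fun t => c t i j) (c' i j) 0) :
    HasDerivAt (fun t => (Matrix.detRowAlternating : (Fin m → ℂ) [⋀^Fin m]→ₗ[ℂ] ℂ) (c t))
      (∑ i, (Matrix.detRowAlternating : (Fin m → ℂ) [⋀^Fin m]→ₗ[ℂ] ℂ)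
        (Function.update (c 0) i (c' i))) 0 := by
  classical
  have key : ∀ M : Fin m → Fin m → ℂ,
      (Matrix.detRowAlternating : (Fin m → ℂ) [⋀^Fin m]→ₗ[ℂ] ℂ) M =
        ∑ σ : Equiv.Perm (Fin m), ((Equiv.Perm.sign σ : ℤ) : ℂ) * ∏ i, M i (σ i) := by
    intro M
    have : (Matrix.detRowAlternating : (Fin m → ℂ) [⋀^Fin m]→ₗ[ℂ] ℂ) M =
      (Matrix.of M).transpose.det := (Matrix.det_transpose _).symm
    rw [this, Matrix.det_apply']
    rfl
  simp only [key]
  rw [Finset.sum_comm]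
  refine HasDerivAt.fun_sum fun σ _ => ?_
  rw [← Finset.mul_sum]
  refine HasDerivAt.const_mul _ ?_
  refine (HasDerivAt.fun_finsetProd (u := Finset.univ) fun i _ => h i (σ i)).congr_deriv ?_
  refine Finset.sum_congr rfl fun i _ => ?_
  rw [← Finset.mul_prod_erase _ _ (Finset.mem_univ i), Function.update_self, smul_eq_mul, mul_comm]
  congr 1
  refine Finset.prod_congr rfl fun j hj => ?_
  rw [Function.update_of_ne (Finset.ne_of_mem_erase hj)]

section Vol

variable {q : ℕ}

theorem vol3_apply {R : Type*} [CommRing R] (a b c : Fin (q + 3) → R) (v : Fin q → Fin (q + 3) → R) :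
    vol3 a b c v = Matrix.detRowAlternating
      (Matrix.vecCons a (Matrix.vecCons b (Matrix.vecCons c v))) := rfl

theorem hasDerivAt_vol3 {a b c : ℂ → Fin (q + 3) → ℂ} {v : ℂ → Fin q → Fin (q + 3) → ℂ}
    {a' b' c' : Fin (q + 3) → ℂ} {v' : Fin q → Fin (q + 3) → ℂ}
    (ha : ∀ i, HasDerivAt (fun t => a t i) (a' i) 0)
    (hb : ∀ i, HasDerivAt (fun t => b t i) (b' i) 0)
    (hc : ∀ i, HasDerivAt (fun t => c t i) (c' i) 0)
    (hv : ∀ k i, HasDerivAt (fun t => v t k i) (v' k i) 0) :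
    HasDerivAt (fun t => vol3 (a t) (b t) (c t) (v t))
      (vol3 a' (b 0) (c 0) (v 0) + (vol3 (a 0) b' (c 0) (v 0) + (vol3 (a 0) (b 0) c' (v 0) +
        ∑ i, vol3 (a 0) (b 0) (c 0) (Function.update (v 0) i (v' i))))) 0 := by
  simp only [vol3_apply]
  refine (hasDerivAt_det (c := fun t => Matrix.vecCons (a t) (Matrix.vecCons (b t)
    (Matrix.vecCons (c t) (v t)))) (c' := Matrix.vecCons a' (Matrix.vecCons b'
    (Matrix.vecCons c' v'))) ?_).congr_deriv ?_
  · intro i j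
    refine Fin.cases (ha j) (fun i => ?_) i
    refine Fin.cases (hb j) (fun i => ?_) i
    exact Fin.cases (hc j) (fun i => hv i j) i
  · rw [Fin.sum_univ_succ, Fin.sum_univ_succ, Fin.sum_univ_succ]
    simp only [Matrix.cons_val_zero, Matrix.cons_val_succ, update_vecCons_zero,
      update_vecCons_succ]

theorem derivSum_vol3 {R : Type*} [CommRing R] (B : Matrix (Fin (q + 3)) (Fin (q + 3)) R)
    (a b c : Fin (q + 3) → R) (v : Fin q → Fin (q + 3) → R) :
    derivSum (vol3 a b c) B.mulVecLin v = B.trace * vol3 a b c v - vol3 (B.mulVec a) b c v -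
      vol3 a (B.mulVec b) c v - vol3 a b (B.mulVec c) v := by
  have h := derivSum_det B (Matrix.vecCons a (Matrix.vecCons b (Matrix.vecCons c v)))
  rw [derivSum_vecCons, derivSum_vecCons, derivSum_vecCons] at h
  simp only [Matrix.mulVecLin_apply, AlternatingMap.curryLeft_apply_apply] at h
  change _ + (_ + (_ + derivSum (vol3 a b c) B.mulVecLin v)) = _ at h
  simp only [vol3_apply]
  linear_combination h

theorem vol3_mulVec {R : Type*} [CommRing R] (T : Matrix (Fin (q + 3)) (Fin (q + 3)) R)
    (a b c : Fin (q + 3) → R) (v : Fin q → Fin (q + 3) → R) :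
    vol3 (T.mulVec a) (T.mulVec b) (T.mulVec c) (fun k => T.mulVec (v k)) =
      T.det * vol3 a b c v := by
  let M : Matrix (Fin (q + 3)) (Fin (q + 3)) R :=
    Matrix.of (Matrix.vecCons a (Matrix.vecCons b (Matrix.vecCons c v)))
  have h : Matrix.det (M * T.transpose) = T.det * M.det := by
    rw [Matrix.det_mul, Matrix.det_transpose, mul_comm]
  refine Eq.trans ?_ h
  rw [vol3_apply]
  change Matrix.det _ = _
  congr 1
  ext i j
  refine Fin.cases ?_ (fun i => ?_) i
  · simp [M, Matrix.mul_apply, Matrix.mulVec, dotProduct, mul_comm]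
  refine Fin.cases ?_ (fun i => ?_) i
  · simp [M, Matrix.mul_apply, Matrix.mulVec, dotProduct, mul_comm]
  refine Fin.cases ?_ (fun i => ?_) i <;>
  · simp [M, Matrix.mul_apply, Matrix.mulVec, dotProduct, mul_comm]

theorem vol3_add₁ {R : Type*} [CommRing R] (a b b' c : Fin (q + 3) → R) :
    vol3 a (b + b') c = vol3 a b c + vol3 a b' c := by
  simp [vol3]

theorem vol3_smul₁ {R : Type*} [CommRing R] (r : R) (a b c : Fin (q + 3) → R) :
    vol3 a (r • b) c = r • vol3 a b c := by
  simp [vol3]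

theorem vol3_add₂ {R : Type*} [CommRing R] (a b c c' : Fin (q + 3) → R) :
    vol3 a b (c + c') = vol3 a b c + vol3 a b c' := by
  simp [vol3]

theorem vol3_smul₂ {R : Type*} [CommRing R] (r : R) (a b c : Fin (q + 3) → R) :
    vol3 a b (r • c) = r • vol3 a b c := by
  simp [vol3]

theorem vol3_self₁₂ {R : Type*} [CommRing R] (a b : Fin (q + 3) → R) : vol3 a b b = 0 :=
  AlternatingMap.curryLeft_same _ _

theorem vol3_eq_zero_of_mem {R : Type*} [CommRing R] (a b c : Fin (q + 3) → R)
    (v : Fin q → Fin (q + 3) → R) (k : Fin q) (h : v k = a ∨ v k = b ∨ v k = c) :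
    vol3 a b c v = 0 := by
  rw [vol3_apply]
  rcases h with h | h | h
  · exact AlternatingMap.map_eq_zero_of_eq _ _ (i := k.succ.succ.succ) (j := 0) (by simpa using h)
      (Fin.succ_ne_zero _)
  · exact AlternatingMap.map_eq_zero_of_eq _ _ (i := k.succ.succ.succ) (j := Fin.succ 0)
      (by simpa using h) (fun h => Fin.succ_ne_zero _ (Fin.succ_injective _ h))
  · exact AlternatingMap.map_eq_zero_of_eq _ _ (i := k.succ.succ.succ) (j := Fin.succ (Fin.succ 0))
      (by simpa using h)
      (fun h => Fin.succ_ne_zero _ (Fin.succ_injective _ (Fin.succ_injective _ h)))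

end Vol

/-! ### The exterior derivative at a point -/

theorem formAt_extDer {m q : ℕ} (Ω : Form m q) (a : Fin m → ℂ) (v : Fin (q + 1) → Fin m → ℂ)
    {g : Fin (q + 1) → ℂ}
    (hg : ∀ k, HasDerivAt (fun t : ℂ => formAt Ω (a + t • v k) fun j => v (k.succAbove j)) (g k) 0) :
    formAt (extDer Ω) a v = ∑ k : Fin (q + 1), (-1) ^ (k : ℕ) * g k := by
  have hD : ∀ k, g k = ∑ I : Fin q ↪o Fin m,
      (∑ j, v k j * MvPolynomial.eval a (MvPolynomial.pderiv j (coeffForm Ω I))) *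
        (Matrix.of fun j l => v (k.succAbove j) (I l)).det := by
    intro k
    refine (hg k).unique ?_
    simp only [formAt_apply]
    exact HasDerivAt.fun_sum fun I _ => (hasDerivAt_eval_line _ a (v k)).mul_const _
  have h := eval_form (extDer Ω) a fun j => constField (v j)
  simp only [fieldAt_constField] at h
  rw [← h, extDer, alternatingMap_sum_apply, map_sum]
  simp only [hD, Finset.mul_sum]
  rw [Finset.sum_comm]
  refine Finset.sum_congr rfl fun I _ => ?_
  rw [wedgeDiff_apply, eval_det, Matrix.det_succ_column_zero]
  refine Finset.sum_congr rfl fun k _ => ?_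
  rw [mul_assoc]
  congr 2
  · simp only [Matrix.of_apply, Fin.cons_zero, differential_apply, map_sum, map_mul, constField,
      MvPolynomial.eval_C]
    exact Finset.sum_congr rfl fun j _ => mul_comm _ _
  · congr 1
    ext j l
    simp only [Matrix.submatrix_apply, Matrix.of_apply, Fin.cons_succ, differential_apply, map_sum,
      map_mul, constField, MvPolynomial.eval_C]
    classical
    rw [Finset.sum_eq_single (I l)]
    · simp
    · intro i _ hi
      simp [MvPolynomial.pderiv_X, Pi.single_eq_of_ne hi.symm]
    · simp

/-! ### The forms `i_R i_X i_A ν` -/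

/-- The Jacobian matrix of a vector field at a point. -/
def jac {m : ℕ} (X : VField m) (a : Fin m → ℂ) : Matrix (Fin m) (Fin m) ℂ :=
  Matrix.of fun i j => MvPolynomial.eval a (MvPolynomial.pderiv j (X i))

theorem hasDerivAt_fieldAt {m : ℕ} (X : VField m) (a v : Fin m → ℂ) (i : Fin m) :
    HasDerivAt (fun t : ℂ => fieldAt (a + t • v) X i) ((jac X a).mulVec v i) 0 := by
  refine (hasDerivAt_eval_line (X i) a v).congr_deriv ?_
  exact Finset.sum_congr rfl fun j _ => mul_comm _ _

theorem hasDerivAt_mulVec {m : ℕ} (A : Matrix (Fin m) (Fin m) ℂ) (a v : Fin m → ℂ) (i : Fin m) :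
    HasDerivAt (fun t : ℂ => A.mulVec (a + t • v) i) (A.mulVec v i) 0 := by
  simp only [Matrix.mulVec_add, Matrix.mulVec_smul, Pi.add_apply, Pi.smul_apply, smul_eq_mul]
  simpa using ((hasDerivAt_id (0 : ℂ)).mul_const (A.mulVec v i)).const_add (A.mulVec a i)

theorem hasDerivAt_line {m : ℕ} (a v : Fin m → ℂ) (i : Fin m) :
    HasDerivAt (fun t : ℂ => (a + t • v) i) (v i) 0 := by
  simpa using ((hasDerivAt_id (0 : ℂ)).mul_const (v i)).const_add (a i)

theorem fieldAt_linMap {m : ℕ} (A : Matrix (Fin m) (Fin m) ℂ) (a : Fin m → ℂ) :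
    fieldAt a (linMap A) = A.mulVec a := by
  funext i; exact eval_linMap A a i

/-- The form `i_A i_X i_R ν`, where `A` is a linear vector field. -/
def theta {q : ℕ} (A : Matrix (Fin (q + 3)) (Fin (q + 3)) ℂ) (X : VField (q + 3)) :
    Form (q + 3) q := vol3 (radial (q + 3)) X (linMap A)

theorem formAt_vol3 {q : ℕ} (X Y Z : VField (q + 3)) (a : Fin (q + 3) → ℂ)
    (v : Fin q → Fin (q + 3) → ℂ) : formAt (vol3 X Y Z : Form (q + 3) q) a v =
      vol3 (fieldAt a X) (fieldAt a Y) (fieldAt a Z) v := by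
  have h := eval_form (vol3 X Y Z : Form (q + 3) q) a fun j => constField (v j)
  simp only [fieldAt_constField] at h
  rw [← h, vol3_apply, vol3_apply]
  refine (eval_det a _).trans ?_
  change Matrix.det _ = Matrix.det _
  congr 1
  ext i j
  refine Fin.cases rfl (fun i => ?_) i
  refine Fin.cases rfl (fun i => ?_) i
  refine Fin.cases rfl (fun i => ?_) i
  exact MvPolynomial.eval_C _

theorem formAt_theta {q : ℕ} (A : Matrix (Fin (q + 3)) (Fin (q + 3)) ℂ) (X : VField (q + 3))
    (a : Fin (q + 3) → ℂ) (v : Fin q → Fin (q + 3) → ℂ) :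
    formAt (theta A X) a v = vol3 a (fieldAt a X) (A.mulVec a) v := by
  rw [theta, formAt_vol3, fieldAt_radial, fieldAt_linMap]

theorem isHomogeneous_det {m σ : Type*} [Fintype m] [DecidableEq m]
    {M : Matrix m m (MvPolynomial σ ℂ)} {r : m → ℕ} (h : ∀ i j, (M i j).IsHomogeneous (r i)) :
    M.det.IsHomogeneous (∑ i, r i) := by
  rw [← Matrix.det_transpose, Matrix.det_apply']
  refine MvPolynomial.IsHomogeneous.sum _ _ _ fun σ' _ => ?_
  have h1 : (∏ i, M.transpose (σ' i) i).IsHomogeneous (∑ i, r i) :=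
    MvPolynomial.IsHomogeneous.prod _ _ _ fun i _ => h i (σ' i)
  have h2 : (((Equiv.Perm.sign σ' : ℤ) : MvPolynomial σ ℂ)).IsHomogeneous 0 := by
    have : ((Equiv.Perm.sign σ' : ℤ) : MvPolynomial σ ℂ) =
        MvPolynomial.C ((Equiv.Perm.sign σ' : ℤ) : ℂ) := by simp
    rw [this]
    exact MvPolynomial.isHomogeneous_C _ _
  simpa using h2.mul h1

theorem theta_mem {q d : ℕ} (A : Matrix (Fin (q + 3)) (Fin (q + 3)) ℂ) {X : VField (q + 3)}
    (hX : ∀ i, (X i).IsHomogeneous d) : theta A X ∈ twistedForms (q + 2) q (d + 1) := by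
  constructor
  · intro I
    have h := isHomogeneous_det (M := Matrix.of (Matrix.vecCons (radial (q + 3)) (Matrix.vecCons X
      (Matrix.vecCons (linMap A) fun k => coordField (I k)))))
      (r := Matrix.vecCons 1 (Matrix.vecCons d (Matrix.vecCons 1 fun _ => 0))) ?_
    · have e : ∑ i, Matrix.vecCons 1 (Matrix.vecCons d (Matrix.vecCons 1 fun _ : Fin q => 0)) i =
          d + 1 + 1 := by
        rw [Fin.sum_univ_succ, Fin.sum_univ_succ, Fin.sum_univ_succ]
        simp
        omega
      rw [e] at h
      exact h
    · intro i j
      refine Fin.cases (MvPolynomial.isHomogeneous_X ℂ j) (fun i => ?_) i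
      refine Fin.cases (hX j) (fun i => ?_) i
      refine Fin.cases (isHomogeneous_linMap A j) (fun i => ?_) i
      change ((coordField (I i) : VField (q + 3)) j).IsHomogeneous 0
      rw [coordField, Pi.single_apply]
      split_ifs
      · exact MvPolynomial.isHomogeneous_one _ _
      · exact MvPolynomial.isHomogeneous_zero _ _ _
  · refine (contractZero_iff _ _).2 fun a v i hv => ?_
    rw [formAt_theta]
    exact vol3_eq_zero_of_mem _ _ _ _ i (Or.inl (hv.trans (fieldAt_radial a)))

/-- The form `i_A i_X i_R ν` as a twisted form. -/
def thetaV {q d : ℕ} (A : Matrix (Fin (q + 3)) (Fin (q + 3)) ℂ) {X : VField (q + 3)}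
    (hX : ∀ i, (X i).IsHomogeneous d) : twistedForms (q + 2) q (d + 1) := ⟨theta A X, theta_mem A hX⟩

/-- The Lie derivative of `i_A i_X i_R ν` along a linear vector field. -/
theorem formAt_lieDer_thetaV {q d : ℕ} (A B : Matrix (Fin (q + 3)) (Fin (q + 3)) ℂ)
    {X : VField (q + 3)} (hX : ∀ i, (X i).IsHomogeneous d) (a : Fin (q + 3) → ℂ)
    (v : Fin q → Fin (q + 3) → ℂ) :
    formAt ((pullRep (q + 2) q (d + 1)).lieDer (thetaV A hX) B).1 a v =
      B.trace * vol3 a (fieldAt a X) (A.mulVec a) v +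
      vol3 a ((jac X a).mulVec (B.mulVec a) - B.mulVec (fieldAt a X)) (A.mulVec a) v +
      vol3 a (fieldAt a X) ((A * B - B * A).mulVec a) v := by
  have h := (pullRep (q + 2) q (d + 1)).hasDerivAt_act (thetaV A hX) B (evalAt a v)
  have h1 : ∀ t : ℂ, evalAt a v ((pullRep (q + 2) q (d + 1)).act (1 + t • B) (thetaV A hX)) =
      vol3 (a + t • B.mulVec a) (fieldAt (a + t • B.mulVec a) X) (A.mulVec (a + t • B.mulVec a))
        (fun k => v k + t • B.mulVec (v k)) := by
    intro t
    change formAt (linPull (1 + t • B) (thetaV A hX)).1 a v = _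
    rw [formAt_linPull]
    change formAt (theta A X) _ _ = _
    rw [formAt_theta]
    simp only [Matrix.add_mulVec, Matrix.one_mulVec, Matrix.smul_mulVec]
  simp only [h1] at h
  have h2 := hasDerivAt_vol3 (hasDerivAt_line a (B.mulVec a))
    (hasDerivAt_fieldAt X a (B.mulVec a)) (hasDerivAt_mulVec A a (B.mulVec a))
    (fun k => hasDerivAt_line (v k) (B.mulVec (v k)))
  have h3 := h.unique h2
  change formAt ((pullRep (q + 2) q (d + 1)).lieDer (thetaV A hX) B).1 a v = _ at h3
  rw [h3]
  -- The derivative along the arguments v is exchanged for a trace term and for B acting on the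
  -- three contracted fields; combined with the derivatives of these fields, this produces the
  -- brackets.
  have h4 := derivSum_vol3 B a (fieldAt a X) (A.mulVec a) v
  simp only [zero_smul, add_zero]
  have h5 : (∑ i, vol3 a (fieldAt a X) (A.mulVec a) (Function.update v i (B.mulVec (v i)))) =
      derivSum (vol3 a (fieldAt a X) (A.mulVec a)) B.mulVecLin v := rfl
  rw [h5, h4, sub_eq_add_neg ((jac X a).mulVec _), ← neg_one_smul ℂ (B.mulVec (fieldAt a X)),
    vol3_add₁, vol3_smul₁, Matrix.sub_mulVec, sub_eq_add_neg ((A * B).mulVec a),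
    ← neg_one_smul ℂ ((B * A).mulVec a), vol3_add₂, vol3_smul₂]
  simp only [AlternatingMap.add_apply, AlternatingMap.smul_apply, Matrix.mulVec_mulVec, smul_eq_mul]
  ring

/-! ### Integrability -/

/-- The contraction of the volume form by two vectors. -/
def vol2 {R : Type*} [CommRing R] {q : ℕ} (a b : Fin (q + 2) → R) :
    (Fin (q + 2) → R) [⋀^Fin q]→ₗ[R] R :=
  ((Matrix.detRowAlternating : (Fin (q + 2) → R) [⋀^Fin (q + 2)]→ₗ[R] R).curryLeft a).curryLeft b

theorem vol2_curryLeft {R : Type*} [CommRing R] {q : ℕ} (a b c : Fin (q + 3) → R) :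
    (vol2 a b : (Fin (q + 3) → R) [⋀^Fin (q + 1)]→ₗ[R] R).curryLeft c = vol3 a b c := rfl

theorem vol2_swap {R : Type*} [CommRing R] {q : ℕ} (a b : Fin (q + 2) → R) :
    (vol2 a b : (Fin (q + 2) → R) [⋀^Fin q]→ₗ[R] R) = -vol2 b a := curryLeft_swap _ _ _

theorem vol2_add {R : Type*} [CommRing R] {q : ℕ} (a b b' : Fin (q + 2) → R) :
    (vol2 a (b + b') : (Fin (q + 2) → R) [⋀^Fin q]→ₗ[R] R) = vol2 a b + vol2 a b' := by
  simp [vol2]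

theorem vol2_smul {R : Type*} [CommRing R] {q : ℕ} (r : R) (a b : Fin (q + 2) → R) :
    (vol2 a (r • b) : (Fin (q + 2) → R) [⋀^Fin q]→ₗ[R] R) = r • vol2 a b := by
  simp [vol2]

theorem derivSum_vol2 {R : Type*} [CommRing R] {q : ℕ} (B : Matrix (Fin (q + 2)) (Fin (q + 2)) R)
    (a b : Fin (q + 2) → R) (v : Fin q → Fin (q + 2) → R) :
    derivSum (vol2 a b) B.mulVecLin v = B.trace * vol2 a b v - vol2 (B.mulVec a) b v -
      vol2 a (B.mulVec b) v := by
  have h := derivSum_det B (Matrix.vecCons a (Matrix.vecCons b v))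
  rw [derivSum_vecCons, derivSum_vecCons] at h
  simp only [Matrix.mulVecLin_apply] at h
  change vol2 (B.mulVec a) b v + (vol2 a (B.mulVec b) v + derivSum (vol2 a b) B.mulVecLin v) =
    B.trace * vol2 a b v at h
  linear_combination h

/-- Homogeneous vector fields `X` with `[A, X] = lam X`. -/
structure IsEigenField {m : ℕ} (A : Matrix (Fin m) (Fin m) ℂ) (lam : ℂ) (d : ℕ) (X : VField m) :
    Prop where
  homog : ∀ i, (X i).IsHomogeneous d
  eigen : ∀ a, (jac X a).mulVec (A.mulVec a) = A.mulVec (fieldAt a X) + lam • fieldAt a X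

theorem jac_mulVec_self {m d : ℕ} {X : VField m} (hX : ∀ i, (X i).IsHomogeneous d)
    (a : Fin m → ℂ) : (jac X a).mulVec a = (d : ℂ) • fieldAt a X := by
  funext i
  have h := congrArg (MvPolynomial.eval a) (hX i).sum_X_mul_pderiv
  simp only [map_sum, map_mul, MvPolynomial.eval_X, map_nsmul] at h
  simp only [Matrix.mulVec, dotProduct, jac, Matrix.of_apply, Pi.smul_apply, fieldAt, smul_eq_mul]
  rw [← nsmul_eq_mul, ← h]
  exact Finset.sum_congr rfl fun j _ => mul_comm _ _

/-- Alternating the directional derivatives of det(a, X, Aa, v) gives derivations of three double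
contractions of ν, induced by the identity, the Jacobian of X and A. The trace formula, Euler's
relation and [A, X] = λX reduce them to double contractions by pairs among R, X, A, the shape that
Frobenius' condition needs. -/
theorem formAt_extDer_theta {q d : ℕ} {A : Matrix (Fin (q + 3)) (Fin (q + 3)) ℂ} {lam : ℂ}
    {X : VField (q + 3)} (hX : IsEigenField A lam d X) (a : Fin (q + 3) → ℂ) :
    formAt (extDer (theta A X)) a =
      ((q : ℂ) + 2 + d) • vol2 (fieldAt a X) (A.mulVec a) +
        (-(jac X a).trace) • vol2 a (A.mulVec a) + (lam + A.trace) • vol2 a (fieldAt a X) := by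
  ext v
  have hg : ∀ k : Fin (q + 1), HasDerivAt (fun t : ℂ => formAt (theta A X) (a + t • v k)
      fun j => v (k.succAbove j))
      ((vol2 (fieldAt a X) (A.mulVec a)).curryLeft (LinearMap.id (R := ℂ) (v k))
          (fun j => v (k.succAbove j)) -
        (vol2 a (A.mulVec a)).curryLeft ((jac X a).mulVecLin (v k)) (fun j => v (k.succAbove j)) +
        (vol2 a (fieldAt a X)).curryLeft (A.mulVecLin (v k)) (fun j => v (k.succAbove j))) 0 := by
    intro k
    simp only [formAt_theta]
    refine (hasDerivAt_vol3 (hasDerivAt_line a (v k)) (hasDerivAt_fieldAt X a (v k))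
      (hasDerivAt_mulVec A a (v k)) (v := fun _ j => v (k.succAbove j)) (v' := fun _ => 0)
      (fun j i => hasDerivAt_const _ _)).congr_deriv ?_
    have h0 : ∀ i, vol3 a (fieldAt a X) (A.mulVec a)
        (Function.update (fun j => v (k.succAbove j)) i 0) = 0 := fun i =>
      AlternatingMap.map_coord_zero _ i (Function.update_self _ _ _)
    simp only [zero_smul, add_zero, h0, Finset.sum_const_zero, vol2_curryLeft, LinearMap.id_apply,
      Matrix.mulVecLin_apply]
    rw [vol3_swap₀₁ (v k), vol3_swap₁₂ (fieldAt a X) (v k), vol3_swap₁₂ a ((jac X a).mulVec (v k))]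
    simp only [AlternatingMap.neg_apply]
    ring
  rw [formAt_extDer _ _ _ hg]
  simp only [mul_add, mul_sub, Finset.sum_add_distrib, Finset.sum_sub_distrib,
    sum_vecCons_succAbove]
  have h1 : derivSum (vol2 (fieldAt a X) (A.mulVec a)) LinearMap.id v =
      ((q : ℂ) + 1) * vol2 (fieldAt a X) (A.mulVec a) v := by
    simp [derivSum]
  rw [h1, derivSum_vol2, derivSum_vol2, jac_mulVec_self hX.homog, hX.eigen, vol2_add, vol2_smul,
    vol2_swap ((d : ℂ) • fieldAt a X), vol2_smul, vol2_swap (A.mulVec a) (fieldAt a X)]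
  simp only [AlternatingMap.add_apply, AlternatingMap.smul_apply, AlternatingMap.neg_apply,
    smul_eq_mul]
  ring

theorem isIntegrable_of_isPlucker {m q : ℕ} {Ω : Form m q}
    (h : ∀ a w i, IsPlucker (formAt Ω a) ((formAt Ω a).toMultilinearMap.toLinearMap w i) ∧
      IsPlucker (formAt (extDer Ω) a) ((formAt Ω a).toMultilinearMap.toLinearMap w i)) :
    IsIntegrable Ω := by
  intro w i
  have hu : ∀ a x, (fun k => fieldAt a (Function.update w i x k)) =
      Function.update (fun k => fieldAt a (w k)) i (fieldAt a x) := by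
    intro a x
    funext k
    by_cases hk : k = i
    · subst hk; simp
    · simp [hk]
  constructor
  · intro u
    refine MvPolynomial.funext fun a => ?_
    have := (h a (fun k => fieldAt a (w k)) i).1 fun k => fieldAt a (u k)
    simp only [map_sum, map_mul, map_pow, map_neg, map_one, map_zero, eval_form, hu]
    exact this
  · intro u
    refine MvPolynomial.funext fun a => ?_
    have := (h a (fun k => fieldAt a (w k)) i).2 fun k => fieldAt a (u k)
    simp only [map_sum, map_mul, map_pow, map_neg, map_one, map_zero, eval_form, hu]
    exact this

/-- A one-form obtained by filling all slots of Ω but one kills R, X and A. Since Ω and dΩ are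
combinations of contractions of ν by these fields, the Plücker relation of the determinant, which
such contractions preserve, yields both conditions. -/
theorem isIntegrable_theta {q d : ℕ} {A : Matrix (Fin (q + 3)) (Fin (q + 3)) ℂ} {lam : ℂ}
    {X : VField (q + 3)} (hX : IsEigenField A lam d X) : IsIntegrable (theta A X) := by
  refine isIntegrable_of_isPlucker fun a w i => ?_
  have hα : formAt (theta A X) a = vol3 a (fieldAt a X) (A.mulVec a) := by
    ext v; exact formAt_theta A X a v
  set ℓ := (formAt (theta A X) a).toMultilinearMap.toLinearMap w i with hℓ
  have hl : ∀ x, (x = a ∨ x = fieldAt a X ∨ x = A.mulVec a) → ℓ x = 0 := by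
    intro x hx
    change formAt (theta A X) a (Function.update w i x) = 0
    rw [hα]
    exact vol3_eq_zero_of_mem _ _ _ _ i (by simpa using hx)
  have ha := hl a (Or.inl rfl)
  have hb := hl _ (Or.inr (Or.inl rfl))
  have hc := hl _ (Or.inr (Or.inr rfl))
  constructor
  · rw [hα]
    exact (((isPlucker_det ℓ).curryLeft ha).curryLeft hb).curryLeft hc
  · rw [formAt_extDer_theta hX]
    exact (((((isPlucker_det ℓ).curryLeft hb).curryLeft hc).smul _).add
      ((((isPlucker_det ℓ).curryLeft ha).curryLeft hc).smul _)).add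
      ((((isPlucker_det ℓ).curryLeft ha).curryLeft hb).smul _)

/-! ### Linear substitutions in vector fields -/

/-- The vector field `x ↦ T' X(T x)`. -/
def substField {m : ℕ} (T T' : Matrix (Fin m) (Fin m) ℂ) (X : VField m) : VField m := fun i =>
  ∑ j, MvPolynomial.C (T' i j) * MvPolynomial.aeval (linMap T) (X j)

theorem fieldAt_substField {m : ℕ} (T T' : Matrix (Fin m) (Fin m) ℂ) (X : VField m)
    (a : Fin m → ℂ) : fieldAt a (substField T T' X) = T'.mulVec (fieldAt (T.mulVec a) X) := by
  funext i
  simp only [fieldAt, substField, map_sum, map_mul, MvPolynomial.eval_C, eval_aeval_apply,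
    eval_linMap]
  rfl

theorem jac_substField {m : ℕ} (T T' : Matrix (Fin m) (Fin m) ℂ) (X : VField m)
    (a v : Fin m → ℂ) : (jac (substField T T' X) a).mulVec v =
      T'.mulVec ((jac X (T.mulVec a)).mulVec (T.mulVec v)) := by
  funext i
  refine (hasDerivAt_fieldAt (substField T T' X) a v i).unique ?_
  simp only [fieldAt_substField, Matrix.mulVec_add, Matrix.mulVec_smul]
  change HasDerivAt (fun t : ℂ => ∑ j, T' i j * fieldAt (T.mulVec a + t • T.mulVec v) X j)
    (∑ j, T' i j * (jac X (T.mulVec a)).mulVec (T.mulVec v) j) 0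
  exact HasDerivAt.fun_sum fun j _ => (hasDerivAt_fieldAt X (T.mulVec a) (T.mulVec v) j).const_mul _

theorem isHomogeneous_substField {m d : ℕ} (T T' : Matrix (Fin m) (Fin m) ℂ) {X : VField m}
    (hX : ∀ i, (X i).IsHomogeneous d) (i : Fin m) : (substField T T' X i).IsHomogeneous d := by
  refine MvPolynomial.IsHomogeneous.sum _ _ _ fun j _ => ?_
  have h := (MvPolynomial.isHomogeneous_C (Fin m) (T' i j)).mul
    ((hX j).aeval (linMap T) (isHomogeneous_linMap T))
  simpa using h

theorem IsEigenField.substField {m d : ℕ} {A : Matrix (Fin m) (Fin m) ℂ} {lam : ℂ} {X : VField m}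
    (hX : IsEigenField A lam d X) {T T' : Matrix (Fin m) (Fin m) ℂ} (hT : T * T' = 1) :
    IsEigenField (T' * A * T) lam d (substField T T' X) := by
  refine ⟨isHomogeneous_substField T T' hX.homog, fun a => ?_⟩
  rw [jac_substField, fieldAt_substField]
  have h1 : T.mulVec ((T' * A * T).mulVec a) = A.mulVec (T.mulVec a) := by
    rw [Matrix.mulVec_mulVec, ← Matrix.mul_assoc, ← Matrix.mul_assoc, hT, Matrix.one_mul,
      Matrix.mulVec_mulVec]
  rw [h1, hX.eigen, Matrix.mulVec_add, Matrix.mulVec_smul, Matrix.mulVec_mulVec,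
    Matrix.mulVec_mulVec, Matrix.mul_assoc (T' * A), hT, Matrix.mul_one]

theorem IsEigenField.smul {m d : ℕ} {A : Matrix (Fin m) (Fin m) ℂ} {lam : ℂ} {X : VField m}
    (hX : IsEigenField A lam d X) (c : ℂ) : IsEigenField A lam d (c • X) := by
  have h1 : ∀ a, fieldAt a (c • X) = c • fieldAt a X := by
    intro a
    funext i
    simp [fieldAt]
  have h2 : ∀ a, jac (c • X) a = c • jac X a := by
    intro a
    ext i j
    simp [jac]
  refine ⟨fun i => ?_, fun a => ?_⟩
  · have := (MvPolynomial.isHomogeneous_C (Fin m) c).mul (hX.homog i)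
    rw [zero_add, ← MvPolynomial.smul_eq_C_mul] at this
    exact this
  · rw [h1, h2, Matrix.smul_mulVec, hX.eigen, Matrix.mulVec_smul, smul_add, smul_comm]

theorem linPull_thetaV {q d : ℕ} (A : Matrix (Fin (q + 3)) (Fin (q + 3)) ℂ)
    {X : VField (q + 3)} (hX : ∀ i, (X i).IsHomogeneous d)
    {T T' : Matrix (Fin (q + 3)) (Fin (q + 3)) ℂ} (hT : T * T' = 1) :
    (linPull T (thetaV A hX)).1 = theta (T' * A * T) (T.det • substField T T' X) := by
  refine form_ext_formAt fun a v => ?_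
  rw [formAt_linPull]
  change formAt (theta A X) _ _ = _
  have h1 : fieldAt a (T.det • substField T T' X) = T.det • fieldAt a (substField T T' X) := by
    funext i
    simp [fieldAt]
  rw [formAt_theta, formAt_theta, h1, vol3_smul₁, fieldAt_substField, AlternatingMap.smul_apply,
    smul_eq_mul, ← vol3_mulVec]
  simp only [Matrix.mulVec_mulVec, ← Matrix.mul_assoc, hT, Matrix.one_mul, Matrix.one_mulVec]

theorem isIntegrable_linPull_thetaV {q d : ℕ} {A : Matrix (Fin (q + 3)) (Fin (q + 3)) ℂ} {lam : ℂ}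
    {X : VField (q + 3)} (hX : IsEigenField A lam d X)
    {T : Matrix (Fin (q + 3)) (Fin (q + 3)) ℂ} (hT : T.det ≠ 0) :
    IsIntegrable (linPull T (thetaV A hX.homog)).1 := by
  have h := T.mul_nonsing_inv (isUnit_iff_ne_zero.2 hT)
  rw [linPull_thetaV A hX.homog h]
  exact isIntegrable_theta ((hX.substField h).smul _)

/-! ### Weights -/

section Weights

variable {m : ℕ}

theorem coeff_X_mul_pderiv (j : Fin m) (f : Poly m) (a : Fin m →₀ ℕ) :
    MvPolynomial.coeff a (MvPolynomial.X j * MvPolynomial.pderiv j f) =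
      (a j : ℂ) * MvPolynomial.coeff a f := by
  classical
  rw [MvPolynomial.coeff_X_mul']
  split_ifs with h
  · have h1 : a - Finsupp.single j 1 + Finsupp.single j 1 = a := by
      refine tsub_add_cancel_of_le ?_
      rw [Finsupp.single_le_iff]
      exact Nat.one_le_iff_ne_zero.2 (Finsupp.mem_support_iff.1 h)
    have h2 : ((a - Finsupp.single j 1 : Fin m →₀ ℕ) j : ℂ) + 1 = a j := by
      conv_rhs => rw [← h1, Finsupp.add_apply, Finsupp.single_eq_same]
      push_cast
      rfl
    rw [MvPolynomial.coeff_pderiv, h1, h2, mul_comm]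
  · rw [Finsupp.notMem_support_iff.1 h]
    simp

theorem isWeightedHomogeneous_X_mul_pderiv {M : Type*} [AddCommMonoid M] {w : Fin m → M} {c : M}
    {f : Poly m} (h : f.IsWeightedHomogeneous w c) (j : Fin m) :
    (MvPolynomial.X j * MvPolynomial.pderiv j f).IsWeightedHomogeneous w c := by
  intro a ha
  rw [coeff_X_mul_pderiv] at ha
  exact h (right_ne_zero_of_mul ha)

theorem isWeightedHomogeneous_of_X_mul {M : Type*} [AddCancelCommMonoid M] {w : Fin m → M} {c : M}
    {f : Poly m} {j : Fin m} (h : (MvPolynomial.X j * f).IsWeightedHomogeneous w (c + w j)) :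
    f.IsWeightedHomogeneous w c := by
  intro a ha
  have h1 := h (d := Finsupp.single j 1 + a) (by rwa [MvPolynomial.coeff_X_mul])
  rw [map_add, Finsupp.weight_single, one_smul, add_comm] at h1
  exact add_right_cancel h1

theorem weight_natCast (p : Fin m → ℕ) (a : Fin m →₀ ℕ) :
    ((Finsupp.weight (fun i => (p i : ℤ)) a : ℤ) : ℂ) = ∑ j, (p j : ℂ) * (a j : ℂ) := by
  rw [Finsupp.weight_apply, Finsupp.sum_fintype _ _ (by simp)]
  push_cast
  refine Finset.sum_congr rfl fun j _ => ?_
  rw [nsmul_eq_mul, mul_comm]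
  push_cast
  rfl

theorem coeff_euler (p : Fin m → ℂ) (f : Poly m) (a : Fin m →₀ ℕ) :
    MvPolynomial.coeff a (∑ j, MvPolynomial.C (p j) * (MvPolynomial.X j * MvPolynomial.pderiv j f)) =
      (∑ j, p j * a j) * MvPolynomial.coeff a f := by
  rw [MvPolynomial.coeff_sum, Finset.sum_mul]
  refine Finset.sum_congr rfl fun j _ => ?_
  rw [MvPolynomial.coeff_C_mul, coeff_X_mul_pderiv, mul_assoc]

theorem isWeightedHomogeneous_iff_euler (p : Fin m → ℕ) (f : Poly m) (c : ℤ) :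
    f.IsWeightedHomogeneous (fun i => (p i : ℤ)) c ↔
      ∑ j, MvPolynomial.C (p j : ℂ) * (MvPolynomial.X j * MvPolynomial.pderiv j f) =
        MvPolynomial.C (c : ℂ) * f := by
  constructor
  · intro h
    ext a
    rw [coeff_euler, MvPolynomial.coeff_C_mul, ← weight_natCast]
    by_cases ha : MvPolynomial.coeff a f = 0
    · rw [ha, mul_zero, mul_zero]
    · rw [h ha]
  · intro h a ha
    have h1 := congrArg (MvPolynomial.coeff a) h
    rw [coeff_euler, MvPolynomial.coeff_C_mul, ← weight_natCast] at h1
    exact_mod_cast mul_right_cancel₀ ha h1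

theorem bracket_diagField_apply (p : Fin m → ℕ) (X : VField m) (i : Fin m) :
    bracket (diagField p) X i =
      ∑ j, MvPolynomial.C (p j : ℂ) * (MvPolynomial.X j * MvPolynomial.pderiv j (X i)) -
        MvPolynomial.C (p i : ℂ) * X i := by
  classical
  rw [bracket, Finset.sum_sub_distrib]
  congr 1
  · refine Finset.sum_congr rfl fun j _ => ?_
    simp [diagField, mul_assoc]
  · rw [Finset.sum_eq_single i]
    · simp [diagField, mul_comm]
    · intro j _ hj
      simp [diagField, MvPolynomial.pderiv_X, Pi.single_eq_of_ne hj.symm]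
    · simp

/-- The field x^a ∂/∂x_i is an eigenvector of the bracket with S, with eigenvalue ⟨p, a⟩ − p_i.
Eigenspaces thus become a condition on weights, stable under all the polynomial operations used
later. -/
theorem bracket_diagField_eq_iff (p : Fin m → ℕ) (lam : ℤ) (X : VField m) :
    bracket (diagField p) X = lam • X ↔
      ∀ i, (X i).IsWeightedHomogeneous (fun i => (p i : ℤ)) (lam + p i) := by
  rw [funext_iff]
  refine forall_congr' fun i => ?_
  rw [isWeightedHomogeneous_iff_euler, bracket_diagField_apply, sub_eq_iff_eq_add]
  have : (lam • X) i = MvPolynomial.C (lam : ℂ) * X i := by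
    rw [Pi.smul_apply, zsmul_eq_mul]
    congr 1
  rw [this, ← add_mul, ← map_add]
  push_cast
  rfl

theorem eq_zero_of_isWeightedHomogeneous_neg {p : Fin m → ℕ} {f : Poly m} {c : ℤ}
    (h : f.IsWeightedHomogeneous (fun i => (p i : ℤ)) c) (hc : c < 0) : f = 0 := by
  ext a
  by_contra ha
  have h1 := h ha
  rw [Finsupp.weight_apply, Finsupp.sum_fintype _ _ (by simp)] at h1
  have h2 : 0 ≤ ∑ i, a i • (p i : ℤ) := Finset.sum_nonneg fun i _ => by positivity
  omega

theorem divergence_mul_diagField (p : Fin m → ℕ) (g : Poly m) :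
    divergence (fun i => g * diagField p i) =
      ∑ j, MvPolynomial.C (p j : ℂ) * (MvPolynomial.X j * MvPolynomial.pderiv j g) +
        MvPolynomial.C (∑ j, (p j : ℂ)) * g := by
  simp only [divergence, diagField, map_sum, Finset.sum_mul, ← Finset.sum_add_distrib]
  refine Finset.sum_congr rfl fun j _ => ?_
  simp
  ring

/-- The operator g ↦ div(gS) = S(g) + (∑ p_j) g multiplies each coefficient of g by a positive
integer. -/
theorem eq_zero_of_divergence_mul_diagField {p : Fin m → ℕ} (hp : 0 < ∑ j, p j) {g : Poly m}
    (h : divergence (fun i => g * diagField p i) = 0) : g = 0 := by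
  ext a
  have h1 := congrArg (MvPolynomial.coeff a) h
  rw [divergence_mul_diagField, MvPolynomial.coeff_add, coeff_euler, MvPolynomial.coeff_C_mul,
    ← add_mul] at h1
  refine (mul_eq_zero.1 h1).resolve_left ?_
  have : (∑ j, (p j : ℂ) * (a j : ℂ) + ∑ j, (p j : ℂ)) =
      ((∑ j, p j * a j + ∑ j, p j : ℕ) : ℂ) := by push_cast; rfl
  rw [this]
  exact_mod_cast (by omega : ∑ j, p j * a j + ∑ j, p j ≠ 0)

theorem isWeightedHomogeneous_divergence {p : Fin m → ℕ} {lam : ℤ} {X : VField m}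
    (h : ∀ i, (X i).IsWeightedHomogeneous (fun i => (p i : ℤ)) (lam + p i)) :
    (divergence X).IsWeightedHomogeneous (fun i => (p i : ℤ)) lam :=
  MvPolynomial.IsWeightedHomogeneous.sum _ _ _ fun i _ => (h i).pderiv rfl

theorem coeff_homogeneousComponent (k : ℕ) (f : Poly m) (a : Fin m →₀ ℕ) :
    MvPolynomial.coeff a (MvPolynomial.homogeneousComponent k f) =
      if a.degree = k then MvPolynomial.coeff a f else 0 :=
  MvPolynomial.coeff_homogeneousComponent k f a

theorem isWeightedHomogeneous_homogeneousComponent {M : Type*} [AddCommMonoid M] {w : Fin m → M}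
    {c : M} {f : Poly m} (h : f.IsWeightedHomogeneous w c) (k : ℕ) :
    (MvPolynomial.homogeneousComponent k f).IsWeightedHomogeneous w c := by
  intro a ha
  rw [coeff_homogeneousComponent] at ha
  split_ifs at ha
  · exact h ha
  · exact absurd rfl ha

theorem pderiv_homogeneousComponent (j : Fin m) (k : ℕ) (f : Poly m) :
    MvPolynomial.pderiv j (MvPolynomial.homogeneousComponent (k + 1) f) =
      MvPolynomial.homogeneousComponent k (MvPolynomial.pderiv j f) := by
  ext a
  rw [MvPolynomial.coeff_pderiv, coeff_homogeneousComponent, coeff_homogeneousComponent,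
    MvPolynomial.coeff_pderiv]
  have : (a + Finsupp.single j 1).degree = k + 1 ↔ a.degree = k := by
    rw [map_add, Finsupp.degree_single]
    omega
  by_cases h : a.degree = k
  · rw [if_pos h, if_pos (this.2 h)]
  · rw [if_neg h, if_neg (fun h' => h (this.1 h')), zero_mul]

theorem divergence_homPart (k : ℕ) (X : VField m) :
    divergence (homPart (k + 1) X) = MvPolynomial.homogeneousComponent k (divergence X) := by
  simp only [divergence, homPart, pderiv_homogeneousComponent, map_sum]

theorem isWeightedHomogeneous_rename {n : ℕ} {M : Type*} [AddCommMonoid M] {w : Fin m → M}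
    {w' : Fin n → M} (e : Fin m → Fin n) (he : ∀ i, w' (e i) = w i) {c : M} {f : Poly m}
    (h : f.IsWeightedHomogeneous w c) :
    (MvPolynomial.rename e f).IsWeightedHomogeneous w' c := by
  rw [f.as_sum, map_sum]
  refine MvPolynomial.IsWeightedHomogeneous.sum _ _ _ fun a ha => ?_
  rw [MvPolynomial.rename_monomial]
  refine MvPolynomial.isWeightedHomogeneous_monomial _ _ _ ?_
  rw [← h (MvPolynomial.mem_support_iff.1 ha), Finsupp.weight_apply, Finsupp.weight_apply,
    Finsupp.sum_mapDomain_index (by simp) (by simp [add_smul])]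
  simp only [he]

theorem isWeightedHomogeneous_aeval {n : ℕ} {M : Type*} [AddCommMonoid M] {w : Fin m → M}
    {w' : Fin n → M} {g : Fin m → Poly n} (hg : ∀ i, (g i).IsWeightedHomogeneous w' (w i)) {c : M}
    {f : Poly m} (h : f.IsWeightedHomogeneous w c) :
    (MvPolynomial.aeval g f).IsWeightedHomogeneous w' c := by
  rw [MvPolynomial.aeval_def, MvPolynomial.eval₂_eq']
  refine MvPolynomial.IsWeightedHomogeneous.sum _ _ _ fun a ha => ?_
  have h1 : (∏ i, g i ^ a i).IsWeightedHomogeneous w' (∑ i, a i • w i) :=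
    MvPolynomial.IsWeightedHomogeneous.prod _ _ _ fun i _ => (hg i).pow (a i)
  have h2 := h1.C_mul (MvPolynomial.coeff a f)
  rw [← h (MvPolynomial.mem_support_iff.1 ha), Finsupp.weight_apply,
    Finsupp.sum_fintype _ _ (by simp)]
  exact h2

end Weights

/-! ### The forms `i_S i_Y ν` -/

section Contract

variable {q : ℕ}

theorem formAt_contractVol (S X : VField (q + 2)) (a : Fin (q + 2) → ℂ)
    (v : Fin q → Fin (q + 2) → ℂ) :
    formAt (contractVol S X) a v = vol2 (fieldAt a X) (fieldAt a S) v := by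
  have h := eval_form (contractVol S X) a fun j => constField (v j)
  simp only [fieldAt_constField] at h
  rw [← h]
  refine (eval_det a _).trans ?_
  change Matrix.det _ = Matrix.det _
  congr 1
  ext i j
  refine Fin.cases rfl (fun i => ?_) i
  refine Fin.cases rfl (fun i => ?_) i
  exact MvPolynomial.eval_C _

theorem vol2_self {R : Type*} [CommRing R] (a : Fin (q + 2) → R) :
    (vol2 a a : (Fin (q + 2) → R) [⋀^Fin q]→ₗ[R] R) = 0 := AlternatingMap.curryLeft_same _ _

theorem vol2_add_smul_left {R : Type*} [CommRing R] (a b : Fin (q + 2) → R) (r : R) :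
    (vol2 (a + r • b) b : (Fin (q + 2) → R) [⋀^Fin q]→ₗ[R] R) = vol2 a b := by
  rw [vol2_swap, vol2_add, vol2_smul, vol2_self, smul_zero, add_zero, ← vol2_swap]

theorem X_dvd_of_dvd_mul {m : ℕ} {i : Fin m} {f g : Poly m} (h : MvPolynomial.X i ∣ f * g)
    (hg : ¬ (MvPolynomial.X i ∣ g)) : (MvPolynomial.X i : Poly m) ∣ f :=
  ((MvPolynomial.X_prime.dvd_mul).1 h).resolve_right hg

theorem not_X_dvd_C_mul_X {m : ℕ} {i j : Fin m} (hij : i ≠ j) {c : ℂ} (hc : c ≠ 0) :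
    ¬ ((MvPolynomial.X i : Poly m) ∣ MvPolynomial.C c * MvPolynomial.X j) := by
  have hu : IsUnit (MvPolynomial.C c : Poly m) := (isUnit_iff_ne_zero.2 hc).map MvPolynomial.C
  rw [hu.dvd_mul_left, MvPolynomial.X_dvd_X]
  exact hij

/-- A field `Y` with `i_S i_Y ν = 0` is a multiple of `S`. -/
theorem exists_eq_mul_diagField {p : Fin (q + 2) → ℕ} (hpos : ∀ i, 0 < p i) {Y : VField (q + 2)}
    (h : contractVol (diagField p) Y = 0) : ∃ g, Y = fun i => g * diagField p i := by
  have hpc : ∀ i, (p i : ℂ) ≠ 0 := fun i => by exact_mod_cast (hpos i).ne'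
  have hS : ∀ i, diagField p i = MvPolynomial.C (p i : ℂ) * MvPolynomial.X i := by
    intro i
    simp [diagField]
  -- The 2 × 2 minors give p_j x_j Y_i = p_i x_i Y_j; hence x_i divides Y_i and the quotients are
  -- proportional to the p_i.
  have hm : ∀ i j, i ≠ j → Y i * diagField p j = Y j * diagField p i := fun i j hij =>
    minor_two_eq_zero (a := Y) (b := diagField p) h hij
  have hdiv : ∀ i, (MvPolynomial.X i : Poly (q + 2)) ∣ Y i := by
    intro i
    obtain ⟨j, hj⟩ := exists_ne i
    refine X_dvd_of_dvd_mul ?_ (not_X_dvd_C_mul_X hj.symm (hpc j))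
    rw [← hS, hm i j hj.symm, hS]
    exact ⟨Y j * MvPolynomial.C (p i : ℂ), by ring⟩
  choose k hk using hdiv
  refine ⟨MvPolynomial.C ((p 0 : ℂ)⁻¹) * k 0, funext fun i => ?_⟩
  have hk' : MvPolynomial.C (p 0 : ℂ) * k i = MvPolynomial.C (p i : ℂ) * k 0 := by
    by_cases hi : i = 0
    · rw [hi]
    · have h1 := hm i 0 hi
      rw [hk, hk, hS, hS] at h1
      have h2 : (MvPolynomial.X i * MvPolynomial.X 0 : Poly (q + 2)) ≠ 0 :=
        mul_ne_zero (MvPolynomial.X_ne_zero _) (MvPolynomial.X_ne_zero _)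
      refine mul_left_cancel₀ h2 ?_
      linear_combination h1
  have h3 : (MvPolynomial.C ((p 0 : ℂ)⁻¹) : Poly (q + 2)) * MvPolynomial.C (p 0 : ℂ) = 1 := by
    rw [← map_mul, inv_mul_cancel₀ (hpc 0), map_one]
  rw [hk, hS]
  linear_combination (-MvPolynomial.X i * k i) * h3 +
    MvPolynomial.C ((p 0 : ℂ)⁻¹) * MvPolynomial.X i * hk'

theorem eq_zero_of_contractVol_eq_zero {p : Fin (q + 2) → ℕ} (hpos : ∀ i, 0 < p i)
    {Y : VField (q + 2)} (h : contractVol (diagField p) Y = 0) (hdiv : divergence Y = 0) :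
    Y = 0 := by
  obtain ⟨g, rfl⟩ := exists_eq_mul_diagField hpos h
  have hp : 0 < ∑ j, p j := Finset.sum_pos (fun i _ => hpos i) Finset.univ_nonempty
  rw [eq_zero_of_divergence_mul_diagField hp hdiv]
  funext i
  simp

/-- A homogeneous field `Y` with `i_R i_S i_Y ν = 0` is a combination of `R` and `S`. -/
theorem exists_eq_add_of_contractZero {p : Fin (q + 3) → ℕ} (hp : Function.Injective p)
    {Y : VField (q + 3)} (h : ContractZero (radial (q + 3)) (contractVol (diagField p) Y))
    {lam : ℤ} (hY : ∀ i, (Y i).IsWeightedHomogeneous (fun i => (p i : ℤ)) (lam + p i)) {d : ℕ}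
    (hd : ∀ i, (Y i).IsHomogeneous (d + 1)) :
    ∃ f g : Poly (q + 3), f.IsHomogeneous d ∧ f.IsWeightedHomogeneous (fun i => (p i : ℤ)) lam ∧
      Y = fun i => f * MvPolynomial.X i + g * diagField p i := by
  have hS : ∀ i, diagField p i = MvPolynomial.C (p i : ℂ) * MvPolynomial.X i := by
    intro i
    simp [diagField]
  have hv : (vol3 Y (diagField p) (radial (q + 3)) :
      (Fin (q + 3) → Poly (q + 3)) [⋀^Fin q]→ₗ[Poly (q + 3)] Poly (q + 3)) = 0 := by
    refine AlternatingMap.ext fun w => ?_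
    exact h (Matrix.vecCons (radial (q + 3)) w) 0 rfl
  have hpne : ∀ i j, i ≠ j → ((p i : ℂ) - p j) ≠ 0 := by
    intro i j hij
    rw [sub_ne_zero]
    exact_mod_cast fun h => hij (hp h)
  have hm : ∀ i j k, i ≠ j → i ≠ k → j ≠ k →
      Y i * (MvPolynomial.C ((p j : ℂ) - p k) * (MvPolynomial.X j * MvPolynomial.X k)) +
      Y j * (MvPolynomial.C ((p k : ℂ) - p i) * (MvPolynomial.X k * MvPolynomial.X i)) +
      Y k * (MvPolynomial.C ((p i : ℂ) - p j) * (MvPolynomial.X i * MvPolynomial.X j)) = 0 := by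
    intro i j k hij hik hjk
    have h1 := minor_three_eq_zero hv hij hik hjk
    rw [Matrix.det_fin_three] at h1
    simp only [Matrix.of_apply, Matrix.cons_val', Matrix.cons_val_zero, Matrix.cons_val_one,
      Matrix.cons_val, hS, radial, Matrix.empty_val', Matrix.cons_val_fin_one] at h1
    simp only [map_sub]
    linear_combination h1
  have hdiv : ∀ i, (MvPolynomial.X i : Poly (q + 3)) ∣ Y i := by
    intro i
    obtain ⟨j, k, hij, hik, hjk⟩ : ∃ j k : Fin (q + 3), i ≠ j ∧ i ≠ k ∧ j ≠ k := by
      obtain ⟨j, hj⟩ := exists_ne i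
      have : ∃ k, k ∉ ({i, j} : Finset (Fin (q + 3))) := by
        by_contra hcon
        push Not at hcon
        have h1 := Finset.card_le_card (fun x _ => hcon x : Finset.univ ⊆ ({i, j} : Finset _))
        have h2 := Finset.card_le_two (a := i) (b := j)
        rw [Finset.card_univ, Fintype.card_fin] at h1
        omega
      obtain ⟨k, hk⟩ := this
      simp only [Finset.mem_insert, Finset.mem_singleton, not_or] at hk
      exact ⟨j, k, hj.symm, Ne.symm hk.1, Ne.symm hk.2⟩
    have h1 := hm i j k hij hik hjk
    refine X_dvd_of_dvd_mul (g := MvPolynomial.C ((p j : ℂ) - p k) * MvPolynomial.X j) ?_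
      (not_X_dvd_C_mul_X hij (hpne j k hjk))
    refine X_dvd_of_dvd_mul (g := MvPolynomial.X k) ?_ (by rw [MvPolynomial.X_dvd_X]; exact hik)
    refine ⟨-(Y j * (MvPolynomial.C ((p k : ℂ) - p i) * MvPolynomial.X k) +
      Y k * (MvPolynomial.C ((p i : ℂ) - p j) * MvPolynomial.X j)), ?_⟩
    linear_combination h1
  choose k hk using hdiv
  have hkh : ∀ i, (k i).IsHomogeneous d := by
    intro i
    have := hd i
    rw [hk] at this
    exact isWeightedHomogeneous_of_X_mul this
  have hkw : ∀ i, (k i).IsWeightedHomogeneous (fun i => (p i : ℤ)) lam := by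
    intro i
    have := hY i
    rw [hk] at this
    exact isWeightedHomogeneous_of_X_mul this
  have h01 : (0 : Fin (q + 3)) ≠ 1 := by
    intro h
    have := congrArg Fin.val h
    simp at this
  set c : ℂ := ((p 0 : ℂ) - p 1)⁻¹ with hc
  have hc1 : (MvPolynomial.C c : Poly (q + 3)) * (MvPolynomial.C (p 0 : ℂ) - MvPolynomial.C (p 1 : ℂ))
      = 1 := by
    rw [← map_sub, ← map_mul, hc, inv_mul_cancel₀ (hpne 0 1 h01), map_one]
  -- The 3 × 3 minors say that the quotients k_i = Y_i / x_i depend affinely on p_i. The polynomials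
  -- f and g are the constant term and the slope, interpolated from the indices 0 and 1.
  have hrel : ∀ i, k 0 * (MvPolynomial.C (p 1 : ℂ) - MvPolynomial.C (p i : ℂ)) +
      k 1 * (MvPolynomial.C (p i : ℂ) - MvPolynomial.C (p 0 : ℂ)) +
      k i * (MvPolynomial.C (p 0 : ℂ) - MvPolynomial.C (p 1 : ℂ)) = 0 := by
    intro i
    by_cases h0 : i = 0
    · rw [h0]; ring
    by_cases h1 : i = 1
    · rw [h1]; ring
    have h2 := hm 0 1 i h01 (Ne.symm h0) (Ne.symm h1)
    rw [hk 0, hk 1, hk i] at h2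
    simp only [map_sub] at h2
    have h3 : (MvPolynomial.X 0 * MvPolynomial.X 1 * MvPolynomial.X i : Poly (q + 3)) ≠ 0 :=
      mul_ne_zero (mul_ne_zero (MvPolynomial.X_ne_zero _) (MvPolynomial.X_ne_zero _))
        (MvPolynomial.X_ne_zero _)
    refine mul_left_cancel₀ h3 ?_
    linear_combination h2
  refine ⟨k 0 - MvPolynomial.C ((p 0 : ℂ) * c) * (k 0 - k 1), MvPolynomial.C c * (k 0 - k 1),
    ?_, ?_, funext fun i => ?_⟩
  · exact (hkh 0).sub (((hkh 0).sub (hkh 1)).C_mul _)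
  · exact (hkw 0).sub (((hkw 0).sub (hkw 1)).C_mul _)
  · rw [hk, hS, map_mul]
    linear_combination (-MvPolynomial.X i * (k i - k 0)) * hc1 +
      MvPolynomial.X i * MvPolynomial.C c * hrel i

end Contract

/-! ### Restriction to an affine chart -/

section Chart

variable {n : ℕ}

/-- The point `(x, z)`. -/
def chartPt (x : Fin n → ℂ) (z : ℂ) : Fin (n + 1) → ℂ := Fin.snoc (α := fun _ => ℂ) x z

@[simp] theorem chartPt_castSucc (x : Fin n → ℂ) (z : ℂ) (i : Fin n) :
    chartPt x z i.castSucc = x i := Fin.snoc_castSucc (α := fun _ => ℂ) z x i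

@[simp] theorem chartPt_last (x : Fin n → ℂ) (z : ℂ) : chartPt x z (Fin.last n) = z :=
  Fin.snoc_last (α := fun _ => ℂ) z x

theorem chartPt_ext {a b : Fin (n + 1) → ℂ} (h : ∀ i : Fin n, a i.castSucc = b i.castSucc)
    (h' : a (Fin.last n) = b (Fin.last n)) : a = b := by
  funext i
  exact Fin.lastCases h' h i

theorem eq_chartPt (a : Fin (n + 1) → ℂ) :
    a = chartPt (fun i => a i.castSucc) (a (Fin.last n)) :=
  chartPt_ext (by simp) (by simp)

theorem smul_chartPt (c : ℂ) (x : Fin n → ℂ) (z : ℂ) :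
    c • chartPt x z = chartPt (c • x) (c * z) :=
  chartPt_ext (by simp) (by simp)

theorem formAt_pullback_affineChart {q : ℕ} (T : GL (Fin (n + 1)) ℂ) (Ω : Form (n + 1) q)
    (x : Fin n → ℂ) (v : Fin q → Fin n → ℂ) :
    formAt (pullback (affineChart T) Ω) x v =
      formAt Ω (T.1.mulVec (chartPt x 1)) fun j => T.1.mulVec (chartPt (v j) 0) := by
  classical
  have h0 : ∀ i, affineChart T i = ∑ j, MvPolynomial.C (T.1 i j.castSucc) * MvPolynomial.X j +
      MvPolynomial.C (T.1 i (Fin.last n)) := by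
    intro i
    simp only [affineChart]
    rw [Fin.sum_univ_castSucc, Fin.snoc_last, mul_one]
    simp only [Fin.snoc_castSucc]
  rw [formAt_pullback]
  have h1 : (fun i => MvPolynomial.eval x (affineChart T i)) = T.1.mulVec (chartPt x 1) := by
    funext i
    rw [h0, Matrix.mulVec, dotProduct, Fin.sum_univ_castSucc]
    simp
  have h2 : ∀ w, mapDiff (affineChart T) x w = T.1.mulVec (chartPt w 0) := by
    intro w
    funext i
    rw [Matrix.mulVec, dotProduct, Fin.sum_univ_castSucc, chartPt_last, mul_zero, add_zero, mapDiff]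
    refine Finset.sum_congr rfl fun j _ => ?_
    rw [chartPt_castSucc, h0, map_add, map_sum, Finset.sum_eq_single j]
    · simp
    · intro k _ hk
      simp [MvPolynomial.pderiv_X, Pi.single_eq_of_ne hk]
    · simp
  rw [h1]
  simp only [h2]

/-- The restriction of a twisted form to the standard affine chart. -/
def restr {q e : ℕ} : twistedForms n q e →ₗ[ℂ] Form n q where
  toFun Ω := pullback (affineChart 1) Ω.1
  map_add' Ω Ω' := form_ext_formAt fun a v => by
    change formAt (pullback (affineChart 1) (Ω.1 + Ω'.1)) a v = _
    simp only [formAt_add, formAt_pullback_affineChart]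
  map_smul' c Ω := form_ext_formAt fun a v => by
    change formAt (pullback (affineChart 1) (c • Ω.1)) a v = formAt (c • pullback _ Ω.1) a v
    simp only [formAt_smul, formAt_pullback_affineChart]

theorem formAt_restr {q e : ℕ} (Ω : twistedForms n q e) (x : Fin n → ℂ) (v : Fin q → Fin n → ℂ) :
    formAt (restr Ω) x v = formAt Ω.1 (chartPt x 1) fun j => chartPt (v j) 0 := by
  have := formAt_pullback_affineChart 1 Ω.1 x v
  simp only [Units.val_one, Matrix.one_mulVec] at this
  exact this

theorem pullback_affineChart_eq_restr {q e : ℕ} (T : GL (Fin (n + 1)) ℂ) (Ω : twistedForms n q e) :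
    pullback (affineChart T) Ω.1 = restr (linPull T.1 Ω) :=
  form_ext_formAt fun a v => by
    rw [formAt_pullback_affineChart, formAt_restr, formAt_linPull]

theorem map_add_smul_of_forall {R M : Type*} [CommRing R] [AddCommGroup M] [Module R M] {q : ℕ}
    (α : M [⋀^Fin q]→ₗ[R] R) {a : M} (h : ∀ u i, u i = a → α u = 0) (w : Fin q → M) (c : Fin q → R) :
    α (fun j => w j + c j • a) = α w := by
  classical
  suffices H : ∀ s : Finset (Fin q), α (fun j => if j ∈ s then w j + c j • a else w j) = α w by
    simpa using H Finset.univ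
  intro s
  induction s using Finset.induction_on with
  | empty => simp
  | insert i s hi ih =>
    have e1 : (fun j => if j ∈ insert i s then w j + c j • a else w j) =
        Function.update (fun j => if j ∈ s then w j + c j • a else w j) i (w i + c i • a) := by
      funext j
      by_cases hj : j = i
      · subst hj; simp
      · simp [hj]
    have e2 : Function.update (fun j => if j ∈ s then w j + c j • a else w j) i (w i) =
        fun j => if j ∈ s then w j + c j • a else w j := by
      rw [Function.update_eq_self_iff]
      simp [hi]
    rw [e1, AlternatingMap.map_update_add, AlternatingMap.map_update_smul, e2, ih,
      h (Function.update _ i a) i (Function.update_self _ _ _), smul_zero, add_zero]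

theorem linearMap_injective_of_forall {V W : Type} [AddCommGroup V] [AddCommGroup W] [Module ℂ V]
    [Module ℂ W] (f : V →ₗ[ℂ] W) (h : ∀ v, f v = 0 → v = 0) : Function.Injective f :=
  (injective_iff_map_eq_zero f).2 h

/-- Since i_R Ω = 0, arguments may be corrected by multiples of R, so at a point with z = 1
horizontal vectors determine the form. Homogeneity extends this to z ≠ 0, and the identity z·Ω(w) =
0 of polynomials to all points. -/
theorem restr_injective {q e : ℕ} :
    Function.Injective (restr : twistedForms n q e →ₗ[ℂ] Form n q) := by
  refine linearMap_injective_of_forall (V := twistedForms n q e) (W := Form n q) restr fun Ω hΩ => ?_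
  have h1 : ∀ x w, formAt Ω.1 (chartPt x 1) w = 0 := by
    intro x w
    have h2 := map_add_smul_of_forall (formAt Ω.1 (chartPt x 1)) (a := chartPt x 1)
      (fun u i hu => (contractZero_iff _ _).1 Ω.2.2 _ u i (by rw [hu, fieldAt_radial])) w
      (fun j => -w j (Fin.last n))
    rw [← h2]
    have h3 : (fun j => w j + (-w j (Fin.last n)) • chartPt x 1) =
        fun j => chartPt (fun i => w j i.castSucc - w j (Fin.last n) * x i) 0 := by
      funext j
      exact chartPt_ext (fun i => by simp [sub_eq_add_neg]) (by simp)
    rw [h3, ← formAt_restr, hΩ, formAt_zero]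
  have h4 : ∀ a w, a (Fin.last n) ≠ 0 → formAt Ω.1 a w = 0 := by
    intro a w ha
    have h5 : a = a (Fin.last n) • chartPt ((a (Fin.last n))⁻¹ • fun i => a i.castSucc) 1 := by
      rw [smul_chartPt, smul_smul, mul_inv_cancel₀ ha, one_smul, mul_one]
      exact eq_chartPt a
    rw [h5, formAt_smul_point, h1, mul_zero]
  refine twisted_ext fun a w => ?_
  have h6 : (MvPolynomial.X (Fin.last n) : Poly (n + 1)) * Ω.1 (fun j => constField (w j)) = 0 := by
    refine MvPolynomial.funext fun b => ?_
    rw [map_mul, MvPolynomial.eval_X, map_zero, eval_form]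
    by_cases hb : b (Fin.last n) = 0
    · rw [hb, zero_mul]
    · rw [h4 b _ hb, mul_zero]
  have h7 := (mul_eq_zero.1 h6).resolve_left (MvPolynomial.X_ne_zero _)
  have h8 := eval_form Ω.1 a fun j => constField (w j)
  simp only [h7, map_zero, fieldAt_constField] at h8
  rw [← h8]
  exact (formAt_zero a w).symm

theorem eval_smul_of_isHomogeneous {m k : ℕ} {f : Poly m} (hf : f.IsHomogeneous k) (c : ℂ)
    (a : Fin m → ℂ) : MvPolynomial.eval (c • a) f = c ^ k * MvPolynomial.eval a f := by
  simp only [MvPolynomial.eval_eq, Finset.mul_sum, Pi.smul_apply, smul_eq_mul]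
  refine Finset.sum_congr rfl fun s hs => ?_
  have h1 : ∑ i ∈ s.support, s i = k := by
    have := hf (MvPolynomial.mem_support_iff.1 hs)
    rw [Finsupp.weight_apply, Finsupp.sum] at this
    simpa using this
  simp only [mul_pow, Finset.prod_mul_distrib, Finset.prod_pow_eq_pow_sum, h1]
  ring

theorem sum_homogeneousComponent_of_le {m : ℕ} {f : Poly m} {K : ℕ} (h : f.totalDegree ≤ K) :
    ∑ k ∈ Finset.range (K + 1), MvPolynomial.homogeneousComponent k f = f := by
  conv_rhs => rw [← MvPolynomial.sum_homogeneousComponent f]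
  symm
  refine Finset.sum_subset (Finset.range_subset_range.2 (by omega)) fun k _ hk => ?_
  rw [Finset.mem_range, not_lt] at hk
  exact MvPolynomial.homogeneousComponent_eq_zero k f (by omega)

theorem fieldAt_smul_eq_sum {m K : ℕ} {Y : VField m} (h : ∀ i, (Y i).totalDegree ≤ K) (c : ℂ)
    (x : Fin m → ℂ) : fieldAt (c • x) Y =
      ∑ k ∈ Finset.range (K + 1), c ^ k • fieldAt x (homPart k Y) := by
  funext i
  rw [Finset.sum_apply]
  simp only [fieldAt, Pi.smul_apply, smul_eq_mul, homPart]
  conv_lhs => rw [← sum_homogeneousComponent_of_le (h i), map_sum]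
  exact Finset.sum_congr rfl fun k _ =>
    eval_smul_of_isHomogeneous (MvPolynomial.homogeneousComponent_isHomogeneous k (Y i)) c x

theorem sum_vol2 {q : ℕ} {κ : Type*} (s : Finset κ) (c : κ → ℂ) (y : κ → Fin (q + 2) → ℂ)
    (b : Fin (q + 2) → ℂ) (r : ℂ) (v : Fin q → Fin (q + 2) → ℂ) :
    vol2 (∑ k ∈ s, c k • y k) (r • b) v = ∑ k ∈ s, c k * (r * vol2 (y k) b v) := by
  rw [vol2_smul, vol2_swap, AlternatingMap.smul_apply, AlternatingMap.neg_apply, vol2,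
    map_sum ((Matrix.detRowAlternating : (Fin (q + 2) → ℂ) [⋀^Fin (q + 2)]→ₗ[ℂ] ℂ).curryLeft
      b).curryLeft, alternatingMap_sum_apply, smul_eq_mul, ← Finset.sum_neg_distrib, Finset.mul_sum]
  refine Finset.sum_congr rfl fun k _ => ?_
  rw [vol2_swap (y k) b, map_smul, AlternatingMap.smul_apply, AlternatingMap.neg_apply, smul_eq_mul]
  change r * -(c k * vol2 b (y k) v) = _
  ring

/-- The homogeneous parts of `i_S i_Y ν`, when it extends to a twisted form. -/
theorem contractVol_homPart_of_restr {q e : ℕ} {p : Fin (q + 2) → ℕ} {Y : VField (q + 2)}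
    {Ω : twistedForms (q + 2) q e} (h : restr Ω = contractVol (diagField p) Y) :
    (∀ k, e < k → contractVol (diagField p) (homPart k Y) = 0) ∧
    ∀ x v, formAt (contractVol (diagField p) (homPart e Y)) x v =
      formAt Ω.1 (chartPt x 0) fun j => chartPt (v j) 0 := by
  -- On horizontal arguments, Ω at (x, z) is a polynomial P in z, and homogeneity compares it with
  -- the chart z = 1: P(z) is the sum over k of z^(e − k) times the value at x of i_S i_{Y_k} ν.
  -- Negative powers cannot occur, and the term k = e is P(0), the value at infinity. The factor
  -- z^(K + 1) clears the denominators.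
  have key : ∀ (x : Fin (q + 2) → ℂ) (v : Fin q → Fin (q + 2) → ℂ), ∃ P : Polynomial ℂ,
      P.coeff 0 = (formAt Ω.1 (chartPt x 0) fun j => chartPt (v j) 0) ∧
      ∀ K, (∀ i, (Y i).totalDegree ≤ K) → Polynomial.X ^ (K + 1) * P =
        ∑ k ∈ Finset.range (K + 1), Polynomial.C (formAt (contractVol (diagField p)
          (homPart k Y)) x v) * Polynomial.X ^ (e + K + 1 - k) := by
    intro x v
    let G := Ω.1 fun j => constField (chartPt (v j) 0)
    have hG : ∀ a, MvPolynomial.eval a G = formAt Ω.1 a fun j => chartPt (v j) 0 := by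
      intro a
      have := eval_form Ω.1 a fun j => constField (chartPt (v j) 0)
      simpa only [fieldAt_constField] using this
    let g : Fin (q + 2 + 1) → Polynomial ℂ :=
      Fin.snoc (α := fun _ => Polynomial ℂ) (fun i => Polynomial.C (x i)) Polynomial.X
    have hP : ∀ z, (MvPolynomial.aeval g G).eval z = MvPolynomial.eval (chartPt x z) G := by
      intro z
      have hg : ∀ i, (g i).eval z = chartPt x z i := by
        intro i
        refine Fin.lastCases ?_ (fun i => ?_) i
        · simp [g]
        · simp [g]
      induction G using MvPolynomial.induction_on with
      | C c => simp
      | add f f' hf hf' => simp only [map_add, Polynomial.eval_add, hf, hf']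
      | mul_X f i hf =>
        rw [map_mul, MvPolynomial.aeval_X, Polynomial.eval_mul, hf, hg, map_mul,
          MvPolynomial.eval_X]
    refine ⟨MvPolynomial.aeval g G, ?_, fun K hK => Polynomial.funext fun z => ?_⟩
    · rw [Polynomial.coeff_zero_eq_eval_zero, hP, hG]
    · rw [Polynomial.eval_finsetSum]
      simp only [Polynomial.eval_mul, Polynomial.eval_pow, Polynomial.eval_X, Polynomial.eval_C,
        hP, hG]
      by_cases hz : z = 0
      · subst hz
        rw [zero_pow (Nat.succ_ne_zero K), zero_mul, eq_comm]
        refine Finset.sum_eq_zero fun k hk => ?_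
        rw [Finset.mem_range] at hk
        rw [zero_pow (by omega), mul_zero]
      · have h1 : chartPt x z = z • chartPt (z⁻¹ • x) 1 := by
          rw [smul_chartPt, smul_smul, mul_inv_cancel₀ hz, one_smul, mul_one]
        have h2 : fieldAt (z⁻¹ • x) (diagField p) = z⁻¹ • fieldAt x (diagField p) := by
          funext i
          simp [fieldAt, diagField]
          ring
        rw [h1, formAt_smul_point, ← formAt_restr, h, formAt_contractVol,
          fieldAt_smul_eq_sum hK, h2, sum_vol2, Finset.mul_sum, Finset.mul_sum]
        refine Finset.sum_congr rfl fun k hk => ?_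
        rw [Finset.mem_range] at hk
        obtain ⟨j, rfl⟩ : ∃ j, K = k + j := ⟨K - k, by omega⟩
        rw [formAt_contractVol, show e + (k + j) + 1 - k = e + 1 + j by omega]
        have : z ^ (k + j + 1) * z ^ (e + 1) * z⁻¹ ^ k * z⁻¹ = z ^ (e + 1 + j) := by
          have h3 : z ^ k * z⁻¹ ^ k = 1 := by rw [← mul_pow, mul_inv_cancel₀ hz, one_pow]
          have h4 : z * z⁻¹ = 1 := mul_inv_cancel₀ hz
          rw [show z ^ (k + j + 1) * z ^ (e + 1) * z⁻¹ ^ k * z⁻¹ =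
            (z ^ k * z⁻¹ ^ k) * (z * z⁻¹) * z ^ (e + 1 + j) by ring, h3, h4, one_mul, one_mul]
        rw [← this]
        ring
  have hcoef : ∀ k x v, e ≤ k → ∃ P : Polynomial ℂ,
      P.coeff 0 = (formAt Ω.1 (chartPt x 0) fun j => chartPt (v j) 0) ∧
      formAt (contractVol (diagField p) (homPart k Y)) x v = if k = e then P.coeff 0 else 0 := by
    intro k x v hk
    obtain ⟨P, hP0, hP⟩ := key x v
    refine ⟨P, hP0, ?_⟩
    let K := max k (Finset.univ.sup fun i => (Y i).totalDegree)
    have hkK : k ≤ K := le_max_left _ _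
    have hPK := congrArg (fun Q => Polynomial.coeff Q (e + K + 1 - k)) (hP K fun i =>
      (Finset.le_sup (f := fun i => (Y i).totalDegree) (Finset.mem_univ i)).trans (le_max_right _ _))
    simp only [Polynomial.finsetSum_coeff, Polynomial.coeff_C_mul, Polynomial.coeff_X_pow] at hPK
    rw [Finset.sum_eq_single k, if_pos rfl, mul_one, Polynomial.coeff_X_pow_mul'] at hPK
    · rw [← hPK]
      by_cases hke : k = e
      · rw [if_pos hke, if_pos (by omega), show e + K + 1 - k - (K + 1) = 0 by omega]
      · rw [if_neg hke, if_neg (by omega)]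
    · intro k' hk' hne
      rw [Finset.mem_range] at hk'
      rw [if_neg (by omega), mul_zero]
    · intro hk'
      exact absurd (Finset.mem_range.2 (by omega)) hk'
  constructor
  · intro k hk
    refine form_ext_formAt fun x v => ?_
    obtain ⟨P, -, hP⟩ := hcoef k x v hk.le
    rw [hP, if_neg (by omega), formAt_zero]
  · intro x v
    obtain ⟨P, hP0, hP⟩ := hcoef e x v le_rfl
    rw [hP, if_pos rfl, hP0]

end Chart

/-! ### The space of forms `i_S i_X i_R ν` -/

/-- The weights of the homogeneous coordinates. -/
def extW {n : ℕ} (p : Fin n → ℕ) : Fin (n + 1) → ℕ := Fin.snoc (α := fun _ => ℕ) p 0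

@[simp] theorem extW_castSucc {n : ℕ} (p : Fin n → ℕ) (i : Fin n) : extW p i.castSucc = p i :=
  Fin.snoc_castSucc (α := fun _ => ℕ) 0 p i

@[simp] theorem extW_last {n : ℕ} (p : Fin n → ℕ) : extW p (Fin.last n) = 0 :=
  Fin.snoc_last (α := fun _ => ℕ) 0 p

/-- The diagonal matrix of the weights. -/
def extMat {n : ℕ} (p : Fin n → ℕ) : Matrix (Fin (n + 1)) (Fin (n + 1)) ℂ :=
  Matrix.diagonal fun i => (extW p i : ℂ)

theorem extMat_mulVec {n : ℕ} (p : Fin n → ℕ) (a : Fin (n + 1) → ℂ) (i : Fin (n + 1)) :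
    (extMat p).mulVec a i = extW p i * a i := by
  rw [extMat, Matrix.mulVec_diagonal]

/-- Homogeneous fields of degree `d` and weight `lam`. -/
structure IsWeightField {m : ℕ} (p : Fin m → ℕ) (lam : ℤ) (d : ℕ) (X : VField m) : Prop where
  homog : ∀ i, (X i).IsHomogeneous d
  weight : ∀ i, (X i).IsWeightedHomogeneous (fun i => (p i : ℤ)) (lam + p i)

theorem theta_add {q : ℕ} (A : Matrix (Fin (q + 3)) (Fin (q + 3)) ℂ) (X Y : VField (q + 3)) :
    theta A (X + Y) = theta A X + theta A Y := vol3_add₁ _ _ _ _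

theorem fieldAt_smul {m : ℕ} (c : ℂ) (X : VField m) (a : Fin m → ℂ) :
    fieldAt a (c • X) = c • fieldAt a X := by
  funext i
  simp [fieldAt]

theorem theta_smul {q : ℕ} (A : Matrix (Fin (q + 3)) (Fin (q + 3)) ℂ) (c : ℂ)
    (X : VField (q + 3)) : theta A (c • X) = c • theta A X :=
  form_ext_formAt fun a v => by
    rw [formAt_theta, formAt_smul, formAt_theta, fieldAt_smul, vol3_smul₁]
    rfl

theorem theta_zero {q : ℕ} (A : Matrix (Fin (q + 3)) (Fin (q + 3)) ℂ) :
    theta A (0 : VField (q + 3)) = 0 := by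
  have := theta_smul A 0 (0 : VField (q + 3))
  rwa [zero_smul, zero_smul] at this

theorem IsWeightField.add {m d : ℕ} {p : Fin m → ℕ} {lam : ℤ} {X Y : VField m}
    (hX : IsWeightField p lam d X) (hY : IsWeightField p lam d Y) :
    IsWeightField p lam d (X + Y) :=
  ⟨fun i => (hX.homog i).add (hY.homog i), fun i => (hX.weight i).add (hY.weight i)⟩

theorem IsWeightField.smul {m d : ℕ} {p : Fin m → ℕ} {lam : ℤ} {X : VField m}
    (hX : IsWeightField p lam d X) (c : ℂ) : IsWeightField p lam d (c • X) := by
  have e : ∀ i, (c • X) i = MvPolynomial.C c * X i := fun i => MvPolynomial.smul_eq_C_mul _ _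
  refine ⟨fun i => ?_, fun i => ?_⟩
  · rw [e]; exact (hX.homog i).C_mul c
  · rw [e]; exact (hX.weight i).C_mul c

theorem isWeightField_zero {m d : ℕ} (p : Fin m → ℕ) (lam : ℤ) :
    IsWeightField p lam d (0 : VField m) :=
  ⟨fun _ => MvPolynomial.isHomogeneous_zero _ _ _,
    fun _ => MvPolynomial.isWeightedHomogeneous_zero _ _ _⟩

/-- The forms `i_S i_X i_R ν` with `X` homogeneous of degree `d` and `[S, X] = lam X`. -/
def weightForms {q : ℕ} (p : Fin (q + 2) → ℕ) (lam : ℤ) (d : ℕ) :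
    Submodule ℂ (twistedForms (q + 2) q (d + 1)) where
  carrier := {Ω | ∃ X : VField (q + 3), IsWeightField (extW p) lam d X ∧ Ω.1 = theta (extMat p) X}
  add_mem' := by
    rintro a b ⟨X, hX, ha⟩ ⟨Y, hY, hb⟩
    refine ⟨X + Y, hX.add hY, ?_⟩
    rw [theta_add, ← ha, ← hb]
    rfl
  zero_mem' := ⟨0, isWeightField_zero _ _, (theta_zero _).symm⟩
  smul_mem' := by
    rintro c a ⟨X, hX, ha⟩
    refine ⟨c • X, hX.smul c, ?_⟩
    rw [theta_smul, ← ha]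
    rfl

theorem IsWeightField.isEigenField {n d : ℕ} {p : Fin n → ℕ} {lam : ℤ} {X : VField (n + 1)}
    (hX : IsWeightField (extW p) lam d X) : IsEigenField (extMat p) lam d X := by
  refine ⟨hX.homog, fun a => ?_⟩
  funext i
  have h := congrArg (MvPolynomial.eval a)
    ((isWeightedHomogeneous_iff_euler (extW p) (X i) (lam + extW p i)).1 (hX.weight i))
  simp only [map_sum, map_mul, MvPolynomial.eval_C, MvPolynomial.eval_X] at h
  rw [Pi.add_apply, extMat_mulVec, Matrix.mulVec, dotProduct]
  simp only [extMat_mulVec, jac, Matrix.of_apply, Pi.smul_apply, smul_eq_mul, fieldAt]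
  push_cast at h
  refine Eq.trans (Finset.sum_congr rfl fun j _ => ?_) (h.trans ?_) <;> ring

theorem fieldAt_add {m : ℕ} (X Y : VField m) (a : Fin m → ℂ) :
    fieldAt a (X + Y) = fieldAt a X + fieldAt a Y := by
  funext i
  simp [fieldAt]

/-! ### Passing to the affine chart -/

/-- Subtracting c times the first row from the second leaves a last column with a single nonzero
entry; the sign comes from its position. -/
theorem vol3_chartPt {q : ℕ} (x y z : Fin (q + 2) → ℂ) (c : ℂ) (v : Fin q → Fin (q + 2) → ℂ) :
    vol3 (chartPt x 1) (chartPt y c) (chartPt z 0) (fun k => chartPt (v k) 0) =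
      (-1) ^ q * vol2 (y - c • x) z v := by
  have h1 : chartPt y c = chartPt (y - c • x) 0 + c • chartPt x 1 :=
    chartPt_ext (by simp) (by simp)
  have h2 : (vol3 (chartPt x 1) (chartPt x 1) (chartPt z 0) :
      (Fin (q + 3) → ℂ) [⋀^Fin q]→ₗ[ℂ] ℂ) = 0 := by
    rw [vol3, AlternatingMap.curryLeft_same]
    rfl
  rw [h1, vol3_add₁, vol3_smul₁, h2, smul_zero, add_zero]
  set w := y - c • x
  let M : Matrix (Fin (q + 2 + 1)) (Fin (q + 2 + 1)) ℂ := Matrix.of (Matrix.vecCons (chartPt x 1)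
    (Matrix.vecCons (chartPt w 0) (Matrix.vecCons (chartPt z 0) fun k => chartPt (v k) 0)))
  change M.det = _
  rw [M.det_succ_column (Fin.last _), Finset.sum_eq_single 0]
  · have h3 : M 0 (Fin.last (q + 2)) = 1 := chartPt_last x 1
    rw [h3, mul_one, Fin.val_zero, zero_add, Fin.val_last, pow_add]
    rw [show (-1 : ℂ) ^ 2 = 1 by norm_num, mul_one]
    congr 1
    change _ = Matrix.det _
    congr 1
    ext i j
    rw [Matrix.submatrix_apply, Fin.succAbove_zero, Fin.succAbove_last]
    refine Fin.cases (chartPt_castSucc w 0 j) (fun i => ?_) i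
    refine Fin.cases (chartPt_castSucc z 0 j) (fun i => ?_) i
    exact chartPt_castSucc (v i) 0 j
  · intro i _ hi
    obtain ⟨i, rfl⟩ := Fin.exists_succ_eq.2 hi
    have h3 : M i.succ (Fin.last (q + 2)) = 0 := by
      refine Fin.cases (chartPt_last w 0) (fun i => ?_) i
      refine Fin.cases (chartPt_last z 0) (fun i => ?_) i
      exact chartPt_last (v i) 0
    rw [h3, mul_zero, zero_mul]
  · simp

theorem extMat_mulVec_chartPt {n : ℕ} (p : Fin n → ℕ) (x : Fin n → ℂ) :
    (extMat p).mulVec (chartPt x 1) = chartPt (fieldAt x (diagField p)) 0 := by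
  refine chartPt_ext (fun i => ?_) ?_
  · rw [extMat_mulVec]
    simp [fieldAt, diagField]
  · rw [extMat_mulVec]
    simp

/-- The polynomials `(x, 1)`. -/
def chartVar (n : ℕ) : Fin (n + 1) → Poly n :=
  Fin.snoc (α := fun _ => Poly n) (fun i => MvPolynomial.X i) 1

theorem eval_aeval_chartVar {n : ℕ} (f : Poly (n + 1)) (x : Fin n → ℂ) :
    MvPolynomial.eval x (MvPolynomial.aeval (chartVar n) f) = MvPolynomial.eval (chartPt x 1) f := by
  rw [eval_aeval_apply]
  congr 2
  funext i
  refine Fin.lastCases ?_ (fun i => ?_) i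
  · rw [chartVar, Fin.snoc_last, map_one, chartPt_last]
  · rw [chartVar, Fin.snoc_castSucc, MvPolynomial.eval_X, chartPt_castSucc]

/-- The field defined in the affine chart by a homogeneous field. -/
def chartField {n : ℕ} (X : VField (n + 1)) : VField n := fun i =>
  MvPolynomial.aeval (chartVar n) (X i.castSucc) -
    MvPolynomial.aeval (chartVar n) (X (Fin.last n)) * MvPolynomial.X i

theorem fieldAt_chartField {n : ℕ} (X : VField (n + 1)) (x : Fin n → ℂ) :
    fieldAt x (chartField X) = (fun i => fieldAt (chartPt x 1) X (Fin.castSucc i)) -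
      fieldAt (chartPt x 1) X (Fin.last n) • x := by
  funext i
  simp only [fieldAt, chartField, map_sub, map_mul, eval_aeval_chartVar, MvPolynomial.eval_X,
    Pi.sub_apply, Pi.smul_apply, smul_eq_mul]

theorem isWeightedHomogeneous_chartField {n d : ℕ} {p : Fin n → ℕ} {lam : ℤ} {X : VField (n + 1)}
    (hX : IsWeightField (extW p) lam d X) (i : Fin n) :
    (chartField X i).IsWeightedHomogeneous (fun i => (p i : ℤ)) (lam + p i) := by
  have hg : ∀ i, (chartVar n i).IsWeightedHomogeneous (fun i => (p i : ℤ)) (extW p i : ℤ) := by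
    intro i
    refine Fin.lastCases ?_ (fun i => ?_) i
    · rw [chartVar, Fin.snoc_last, extW_last]
      exact MvPolynomial.isWeightedHomogeneous_one ℂ _
    · rw [chartVar, Fin.snoc_castSucc, extW_castSucc]
      exact MvPolynomial.isWeightedHomogeneous_X ℂ (fun i => (p i : ℤ)) i
  have h1 := isWeightedHomogeneous_aeval hg (hX.weight i.castSucc)
  have h2 := isWeightedHomogeneous_aeval hg (hX.weight (Fin.last n))
  rw [extW_castSucc] at h1
  rw [extW_last, Nat.cast_zero, add_zero] at h2
  exact h1.sub (h2.mul (MvPolynomial.isWeightedHomogeneous_X ℂ (fun i => (p i : ℤ)) i))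

theorem formAt_restr_of_eq_theta {q d : ℕ} {p : Fin (q + 2) → ℕ} {X : VField (q + 3)}
    {Ω : twistedForms (q + 2) q (d + 1)} (h : Ω.1 = theta (extMat p) X) (x : Fin (q + 2) → ℂ)
    (v : Fin q → Fin (q + 2) → ℂ) : formAt (restr Ω) x v =
      (-1) ^ q * vol2 (fieldAt x (chartField X)) (fieldAt x (diagField p)) v := by
  rw [formAt_restr, h, formAt_theta, extMat_mulVec_chartPt, eq_chartPt (fieldAt (chartPt x 1) X),
    vol3_chartPt, fieldAt_chartField]

/-- The homogeneous polynomial of degree `d` given by the part of degree at most `d` of `f`. -/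
def homogenization {n : ℕ} (d : ℕ) (f : Poly n) : Poly (n + 1) :=
  ∑ k ∈ Finset.range (d + 1), MvPolynomial.X (Fin.last n) ^ (d - k) *
    MvPolynomial.rename Fin.castSucc (MvPolynomial.homogeneousComponent k f)

theorem isHomogeneous_homogenization {n : ℕ} (d : ℕ) (f : Poly n) :
    (homogenization d f).IsHomogeneous d := by
  refine MvPolynomial.IsHomogeneous.sum _ _ _ fun k hk => ?_
  rw [Finset.mem_range] at hk
  have h1 := ((MvPolynomial.isHomogeneous_X ℂ (Fin.last n)).pow (d - k)).mul
    ((MvPolynomial.homogeneousComponent_isHomogeneous k f).rename_isHomogeneous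
      (f := Fin.castSucc))
  rwa [one_mul, show d - k + k = d by omega] at h1

theorem isWeightedHomogeneous_homogenization {n d : ℕ} {p : Fin n → ℕ} {c : ℤ} {f : Poly n}
    (h : f.IsWeightedHomogeneous (fun i => (p i : ℤ)) c) :
    (homogenization d f).IsWeightedHomogeneous (fun i => (extW p i : ℤ)) c := by
  refine MvPolynomial.IsWeightedHomogeneous.sum _ _ _ fun k _ => ?_
  have h1 := (MvPolynomial.isWeightedHomogeneous_X ℂ (fun i => (extW p i : ℤ)) (Fin.last n)).pow
    (d - k)
  rw [extW_last, Nat.cast_zero, smul_zero] at h1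
  have h2 := h1.mul (isWeightedHomogeneous_rename (w' := fun i => (extW p i : ℤ)) Fin.castSucc
    (fun i => by rw [extW_castSucc]) (isWeightedHomogeneous_homogeneousComponent h k))
  rwa [zero_add] at h2

theorem eval_homogenization {n : ℕ} (d : ℕ) (f : Poly n) (x : Fin n → ℂ) :
    MvPolynomial.eval (chartPt x 1) (homogenization d f) =
      ∑ k ∈ Finset.range (d + 1), MvPolynomial.eval x (MvPolynomial.homogeneousComponent k f) := by
  rw [homogenization, map_sum]
  refine Finset.sum_congr rfl fun k _ => ?_
  rw [map_mul, map_pow, MvPolynomial.eval_X, chartPt_last, one_pow, one_mul,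
    MvPolynomial.eval_rename]
  congr 2
  funext i
  exact chartPt_castSucc x 1 i

/-- Every element of `W₀` comes from a form `i_S i_X i_R ν`. -/
theorem exists_mem_weightForms_restr_eq {q d : ℕ} (hq : 1 ≤ q) {p : Fin (q + 2) → ℕ}
    (hp : Function.Injective p) {lam : ℤ} {Y : VField (q + 2)} (hY : Y ∈ W₀ p lam d) :
    ∃ Ω ∈ weightForms p lam d, restr Ω = contractVol (diagField p) Y := by
  obtain ⟨h1, -, h3, h4⟩ := hY
  rw [bracket_diagField_eq_iff] at h1
  obtain ⟨f, g, hf, hfw, hfg⟩ : ∃ f g : Poly (q + 2), f.IsHomogeneous d ∧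
      f.IsWeightedHomogeneous (fun i => (p i : ℤ)) lam ∧
      homPart (d + 1) Y = fun i => f * MvPolynomial.X i + g * diagField p i := by
    obtain ⟨r, rfl⟩ : ∃ r, q = r + 1 := ⟨q - 1, by omega⟩
    exact exists_eq_add_of_contractZero (q := r) hp h4
      (fun i => isWeightedHomogeneous_homogeneousComponent (h1 i) (d + 1))
      (fun i => MvPolynomial.homogeneousComponent_isHomogeneous (d + 1) (Y i))
  -- With Y_{d+1} = fR + gS: the parts of degree at most d are homogenized, a last component −f
  -- becomes the term fR in the chart, and gS is invisible in i_S i_Y ν.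
  let X : VField (q + 3) := Fin.snoc (α := fun _ => Poly (q + 3)) (fun i => homogenization d (Y i))
    (-MvPolynomial.rename Fin.castSucc f)
  have hXc : ∀ i : Fin (q + 2), X i.castSucc = homogenization d (Y i) := fun i =>
    Fin.snoc_castSucc (α := fun _ => Poly (q + 3)) _ _ i
  have hXl : X (Fin.last (q + 2)) = -MvPolynomial.rename Fin.castSucc f :=
    Fin.snoc_last (α := fun _ => Poly (q + 3)) _ _
  have hX : IsWeightField (extW p) lam d X := by
    refine ⟨fun i => ?_, fun i => ?_⟩
    · refine Fin.lastCases ?_ (fun i => ?_) i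
      · rw [hXl]
        exact (hf.rename_isHomogeneous (f := Fin.castSucc)).neg
      · rw [hXc]
        exact isHomogeneous_homogenization d (Y i)
    · refine Fin.lastCases ?_ (fun i => ?_) i
      · rw [hXl, extW_last, Nat.cast_zero, add_zero]
        exact (isWeightedHomogeneous_rename (w' := fun i => (extW p i : ℤ)) Fin.castSucc
          (fun i => by rw [extW_castSucc]) hfw).neg
      · rw [hXc, extW_castSucc]
        exact isWeightedHomogeneous_homogenization (h1 i)
  let Ω₀ : twistedForms (q + 2) q (d + 1) := thetaV (extMat p) hX.homog
  refine ⟨(-1 : ℂ) ^ q • Ω₀, (weightForms p lam d).smul_mem _ ⟨X, hX, rfl⟩,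
    form_ext_formAt fun x v => ?_⟩
  have e1 : restr ((-1 : ℂ) ^ q • Ω₀) = (-1 : ℂ) ^ q • restr Ω₀ := LinearMap.map_smul restr _ _
  rw [e1, formAt_smul, formAt_restr_of_eq_theta (p := p) (X := X) rfl, ← mul_assoc, ← mul_pow,
    neg_one_mul, neg_neg, one_pow, one_mul, formAt_contractVol]
  have e2 : fieldAt x Y = fieldAt x (chartField X) +
      MvPolynomial.eval x g • fieldAt x (diagField p) := by
    rw [fieldAt_chartField]
    funext i
    have e3 := congrArg (MvPolynomial.eval x) (congrFun hfg i)
    have e4 := congrArg (MvPolynomial.eval x) (sum_homogeneousComponent_of_le (h3 i))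
    rw [Finset.sum_range_succ, map_add, map_sum, ← eval_homogenization] at e4
    simp only [homPart, map_add, map_mul, MvPolynomial.eval_X] at e3
    simp only [fieldAt, hXc, hXl, Pi.add_apply, Pi.sub_apply, Pi.smul_apply, smul_eq_mul, map_neg,
      MvPolynomial.eval_rename]
    have e5 : (chartPt x 1 ∘ Fin.castSucc : Fin (q + 2) → ℂ) = x :=
      funext fun i => chartPt_castSucc x 1 i
    rw [e5, ← e4, e3]
    ring
  rw [e2, vol2_add_smul_left]

theorem totalDegree_le_of_homogeneousComponent {m D : ℕ} {f : Poly m}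
    (h : ∀ k, D < k → MvPolynomial.homogeneousComponent k f = 0) : f.totalDegree ≤ D := by
  refine Finset.sup_le fun a ha => ?_
  by_contra hlt
  have h1 := congrArg (MvPolynomial.coeff a) (h a.degree (not_le.1 hlt))
  rw [coeff_homogeneousComponent, if_pos rfl] at h1
  exact MvPolynomial.mem_support_iff.1 ha h1

/-- A twisted form defined in the chart by `i_S i_X ν` is defined by an element of `W₀`. -/
theorem exists_mem_W₀_restr_eq {q d : ℕ} {p : Fin (q + 2) → ℕ} (hpos : ∀ i, 0 < p i) {lam : ℤ}
    {X : VField (q + 2)} (hX : bracket (diagField p) X = lam • X)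
    {Ω : twistedForms (q + 2) q (d + 1)} (h : restr Ω = contractVol (diagField p) X) :
    ∃ Y ∈ W₀ p lam d, restr Ω = contractVol (diagField p) Y := by
  rw [bracket_diagField_eq_iff] at hX
  obtain ⟨Y, hYw, hYd, hY⟩ : ∃ Y : VField (q + 2),
      (∀ i, (Y i).IsWeightedHomogeneous (fun i => (p i : ℤ)) (lam + p i)) ∧ divergence Y = 0 ∧
      restr Ω = contractVol (diagField p) Y := by
    have hdw := isWeightedHomogeneous_divergence hX
    have hp : 0 < ∑ j, p j := Finset.sum_pos (fun i _ => hpos i) Finset.univ_nonempty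
    -- The divergence is removed by subtracting gS with g = div X / (λ + ∑ p_j), because g has
    -- weight λ and so div(gS) = (λ + ∑ p_j) g. When λ + ∑ p_j = 0 the weight λ is negative, and div
    -- X, having weight λ, is already zero.
    by_cases hl : lam + (∑ j, p j : ℕ) = 0
    · exact ⟨X, hX, eq_zero_of_isWeightedHomogeneous_neg hdw (by omega), h⟩
    · set c : ℂ := ((lam + (∑ j, p j : ℕ) : ℤ) : ℂ)⁻¹ with hc
      have hc0 : ((lam + (∑ j, p j : ℕ) : ℤ) : ℂ) ≠ 0 := by exact_mod_cast hl
      let g : Poly (q + 2) := MvPolynomial.C c * divergence X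
      have hgw : g.IsWeightedHomogeneous (fun i => (p i : ℤ)) lam := hdw.C_mul c
      have hSw : ∀ i, (diagField p i).IsWeightedHomogeneous (fun i => (p i : ℤ)) (p i : ℤ) := by
        intro i
        have := (MvPolynomial.isWeightedHomogeneous_X ℂ (fun i => (p i : ℤ)) i).C_mul (p i : ℂ)
        convert! this using 1
        simp [diagField]
      refine ⟨fun i => X i - g * diagField p i, fun i => (hX i).sub (hgw.mul (hSw i)), ?_, ?_⟩
      · have e1 : divergence (fun i => X i - g * diagField p i) =
            divergence X - divergence fun i => g * diagField p i := by
          simp only [divergence, map_sub, Finset.sum_sub_distrib]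
        rw [e1, divergence_mul_diagField, (isWeightedHomogeneous_iff_euler p g lam).1 hgw,
          ← add_mul, ← map_add]
        have e2 : ((lam : ℂ) + ∑ j, (p j : ℂ)) * c = 1 := by
          rw [hc]
          have : ((lam + (∑ j, p j : ℕ) : ℤ) : ℂ) = (lam : ℂ) + ∑ j, (p j : ℂ) := by push_cast; rfl
          rw [← this, mul_inv_cancel₀ hc0]
        rw [← mul_assoc, ← map_mul, e2, map_one, one_mul, sub_self]
      · rw [h]
        refine form_ext_formAt fun x v => ?_
        rw [formAt_contractVol, formAt_contractVol]
        have e3 : fieldAt x X = fieldAt x (fun i => X i - g * diagField p i) +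
            MvPolynomial.eval x g • fieldAt x (diagField p) := by
          funext i
          simp [fieldAt]
        rw [e3, vol2_add_smul_left]
  obtain ⟨h1, h2⟩ := contractVol_homPart_of_restr hY
  -- A part of degree above d + 1 is divergence free with i_S i_{Y_k} ν = 0, hence zero. The part of
  -- degree d + 1 corresponds to Ω on the hyperplane at infinity, where i_R Ω = 0 gives the last
  -- condition.
  refine ⟨Y, ⟨(bracket_diagField_eq_iff p lam Y).2 hYw, hYd, fun i => ?_, ?_⟩, hY⟩
  · refine totalDegree_le_of_homogeneousComponent fun k hk => ?_
    have h3 : divergence (homPart k Y) = 0 := by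
      obtain ⟨j, rfl⟩ : ∃ j, k = j + 1 := ⟨k - 1, by omega⟩
      rw [divergence_homPart, hYd, map_zero]
    exact congrFun (eq_zero_of_contractVol_eq_zero hpos (h1 k hk) h3) i
  · rw [contractZero_iff]
    intro x v i hv
    rw [h2]
    refine (contractZero_iff _ _).1 Ω.2.2 _ _ i ?_
    rw [hv, fieldAt_radial, fieldAt_radial]

theorem exists_restr_eq_of_mem {q d : ℕ} {p : Fin (q + 2) → ℕ} {lam : ℤ}
    {Ω : twistedForms (q + 2) q (d + 1)} (hΩ : Ω ∈ weightForms p lam d) :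
    ∃ X, bracket (diagField p) X = lam • X ∧ restr Ω = contractVol (diagField p) X := by
  obtain ⟨X, hX, h⟩ := hΩ
  refine ⟨(-1 : ℂ) ^ q • chartField X, ?_, form_ext_formAt fun x v => ?_⟩
  · rw [bracket_diagField_eq_iff]
    intro i
    have : ((-1 : ℂ) ^ q • chartField X) i = MvPolynomial.C ((-1 : ℂ) ^ q) * chartField X i :=
      MvPolynomial.smul_eq_C_mul _ _
    rw [this]
    exact (isWeightedHomogeneous_chartField hX i).C_mul _
  · rw [formAt_restr_of_eq_theta h, formAt_contractVol, fieldAt_smul,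
      vol2_swap ((-1 : ℂ) ^ q • _), vol2_smul, vol2_swap (fieldAt x (chartField X))]
    simp

theorem mem_weightForms_iff {q d : ℕ} (hq : 1 ≤ q) {p : Fin (q + 2) → ℕ}
    (hp : Function.Injective p) (hpos : ∀ i, 0 < p i) {lam : ℤ}
    {Ω : twistedForms (q + 2) q (d + 1)} : Ω ∈ weightForms p lam d ↔
      ∃ X, bracket (diagField p) X = lam • X ∧ restr Ω = contractVol (diagField p) X := by
  refine ⟨exists_restr_eq_of_mem, fun ⟨X, hX, h⟩ => ?_⟩
  obtain ⟨Y, hY, h'⟩ := exists_mem_W₀_restr_eq hpos hX h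
  obtain ⟨Ω', hΩ', h''⟩ := exists_mem_weightForms_restr_eq hq hp hY
  rwa [restr_injective (h'.trans h''.symm)]

theorem finrank_eq_of_range_eq {V W E : Type} [AddCommGroup V] [AddCommGroup W] [AddCommGroup E]
    [Module ℂ V] [Module ℂ W] [Module ℂ E] {f : V →ₗ[ℂ] E} {g : W →ₗ[ℂ] E}
    (hf : Function.Injective f) (hg : Function.Injective g) {U : Submodule ℂ V}
    (h1 : ∀ u ∈ U, ∃ w, f u = g w) (h2 : ∀ w, ∃ u ∈ U, f u = g w) :
    Module.finrank ℂ U = Module.finrank ℂ W := by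
  have h : U.map f = LinearMap.range g := by
    ext x
    constructor
    · rintro ⟨u, hu, rfl⟩
      obtain ⟨w, hw⟩ := h1 u hu
      exact ⟨w, hw.symm⟩
    · rintro ⟨w, rfl⟩
      obtain ⟨u, hu, hw⟩ := h2 w
      exact ⟨u, hu, hw⟩
  rw [← LinearMap.finrank_range_of_inj hg, ← h]
  exact (Submodule.equivMapOfInjective f hf U).finrank_eq

/-- The linear map `Y ↦ i_S i_Y ν`. -/
def contractVolMap {q : ℕ} (S : VField (q + 2)) : VField (q + 2) →ₗ[ℂ] Form (q + 2) q where
  toFun Y := contractVol S Y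
  map_add' Y Y' := by simp [contractVol]
  map_smul' c Y := form_ext_formAt fun a v => by
    rw [RingHom.id_apply, formAt_smul, formAt_contractVol, formAt_contractVol, fieldAt_smul,
      vol2_swap (c • _), vol2_smul, vol2_swap (fieldAt a Y)]
    simp

theorem finrank_weightForms {q d : ℕ} (hq : 1 ≤ q) {p : Fin (q + 2) → ℕ}
    (hp : Function.Injective p) (hpos : ∀ i, 0 < p i) (lam : ℤ) :
    Module.finrank ℂ (weightForms p lam d) = Module.finrank ℂ (W₀ p lam d) := by
  refine finrank_eq_of_range_eq (V := twistedForms (q + 2) q (d + 1)) (E := Form (q + 2) q)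
    (f := restr) (g := (contractVolMap (diagField p)).comp (W₀ p lam d).subtype) restr_injective
    ?_ ?_ ?_
  · refine linearMap_injective_of_forall (W := Form (q + 2) q) _ fun Y hY => Subtype.ext ?_
    exact eq_zero_of_contractVol_eq_zero hpos hY Y.2.2.1
  · intro Ω hΩ
    obtain ⟨X, hX, h⟩ := exists_restr_eq_of_mem hΩ
    obtain ⟨Y, hY, h'⟩ := exists_mem_W₀_restr_eq hpos hX h
    exact ⟨⟨Y, hY⟩, h'⟩
  · intro Y
    exact exists_mem_weightForms_restr_eq hq hp Y.2

/-! ### Forms without divisorial zeros -/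

/-- The members of the family have no common divisor. -/
def IsReducedFamily {R ι : Type*} [CommRing R] (c : ι → R) : Prop :=
  ∀ g, (∀ i, g ∣ c i) → IsUnit g

theorem IsReducedFamily.exists_ne_zero {R ι : Type*} [CommRing R] [Nontrivial R] {c : ι → R}
    (h : IsReducedFamily c) : ∃ i, c i ≠ 0 := by
  by_contra hcon
  push Not at hcon
  exact not_isUnit_zero (h 0 fun i => by rw [hcon i])

/-- A nonunit common divisor puts the ideal inside a proper principal ideal, of height at most one
by Krull's theorem. Conversely, a height-one prime containing the ideal is principal by unique
factorization, and its generator is a common divisor; height zero would make all members vanish. -/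
theorem two_le_height_span_iff {m : ℕ} {ι : Type*} (c : ι → Poly m) :
    2 ≤ (Ideal.span (Set.range c)).height ↔ IsReducedFamily c := by
  constructor
  · intro h g hg
    by_contra hu
    have h1 : Ideal.span (Set.range c) ≤ Ideal.span {g} := by
      rw [Ideal.span_le]
      rintro _ ⟨i, rfl⟩
      exact Ideal.mem_span_singleton.2 (hg i)
    have hne : Ideal.span {g} ≠ ⊤ := fun h => hu (Ideal.span_singleton_eq_top.1 h)
    obtain ⟨P, hP⟩ := Ideal.nonempty_minimalPrimes hne
    have h2 : P.height ≤ 1 :=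
      Ideal.height_le_one_of_isPrincipal_of_mem_minimalPrimes (Ideal.span {g}) P hP
    have h3 : (2 : ℕ∞) ≤ 1 := h.trans ((Ideal.height_mono (h1.trans hP.1.2)).trans h2)
    exact absurd h3 (by decide)
  · intro h
    by_contra hlt
    rw [not_le] at hlt
    obtain ⟨i, hi⟩ := h.exists_ne_zero
    have h0 : (Ideal.span (Set.range c)).height ≠ 0 := by
      rw [Ne, Ideal.height_eq_zero_iff_eq_bot]
      intro hb
      have : c i ∈ Ideal.span (Set.range c) := Ideal.subset_span ⟨i, rfl⟩
      rw [hb] at this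
      exact hi this
    have h1 : (Ideal.span (Set.range c)).height = (1 : ℕ) := by
      obtain ⟨k, hk⟩ := ENat.ne_top_iff_exists.1 (hlt.trans (ENat.natCast_lt_top 2)).ne
      rw [← hk] at hlt h0 ⊢
      norm_cast at hlt h0 ⊢
      omega
    obtain ⟨P, hP, hle, hPh⟩ := Ideal.exists_isPrime_height_eq h1
    obtain ⟨x, hx⟩ := UniqueFactorizationMonoid.isPrincipal_of_height_eq_one (p := P)
      (by rw [hPh]; norm_num)
    have hxu := h x fun j => Ideal.mem_span_singleton.1 (by
      have : c j ∈ P := hle (Ideal.subset_span ⟨j, rfl⟩)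
      rwa [hx] at this)
    refine hP.ne_top ?_
    rw [hx]
    exact Ideal.span_singleton_eq_top.2 hxu

/-- A family proportional to one without common divisors is a multiple of it. -/
theorem IsReducedFamily.exists_eq_mul {R ι : Type*} [CommRing R] [IsDomain R]
    [UniqueFactorizationMonoid R] {c b : ι → R} (h : IsReducedFamily c)
    (hcb : ∀ i j, c i * b j = c j * b i) : ∃ g, ∀ i, b i = g * c i := by
  obtain ⟨i, hi⟩ := h.exists_ne_zero
  -- After cancelling the common factor c' the relations read a' b_j = c_j b' with a' and b'
  -- coprime, so a' divides every c_j and is a unit.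
  obtain ⟨a', b', c', hrel, ha, hb⟩ :=
    UniqueFactorizationMonoid.exists_reduced_factors (c i) hi (b i)
  have hc' : c' ≠ 0 := by
    rintro rfl
    exact hi (by rw [← ha, zero_mul])
  have h1 : ∀ j, a' * b j = c j * b' := by
    intro j
    refine mul_left_cancel₀ hc' ?_
    have := hcb i j
    rw [← ha, ← hb] at this
    linear_combination this
  have hu : IsUnit a' := h a' fun j => hrel.dvd_of_dvd_mul_right ⟨b j, (h1 j).symm⟩
  obtain ⟨w, hw⟩ := hu.exists_left_inv
  refine ⟨w * b', fun j => ?_⟩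
  linear_combination w * h1 j - b j * hw

/-- A form without divisorial zeros. -/
def IsReducedForm {m q : ℕ} (Ω : Form m q) : Prop := IsReducedFamily (coeffForm Ω)

theorem two_le_height_singIdeal_iff {m q : ℕ} (Ω : Form m q) :
    2 ≤ (singIdeal Ω).height ↔ IsReducedForm Ω := two_le_height_span_iff _

theorem aeval_linMap_linMap {m : ℕ} {T T' : Matrix (Fin m) (Fin m) ℂ} (h : T' * T = 1)
    (g : Poly m) : MvPolynomial.aeval (linMap T) (MvPolynomial.aeval (linMap T') g) = g := by
  refine MvPolynomial.funext fun a => ?_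
  rw [eval_aeval_apply, eval_aeval_apply]
  simp only [eval_linMap]
  have : (fun i => MvPolynomial.eval (fun j => T.mulVec a j) (linMap T' i)) = a := by
    funext i
    rw [eval_linMap]
    change T'.mulVec (T.mulVec a) i = a i
    rw [Matrix.mulVec_mulVec, h, Matrix.one_mulVec]
  simp only [eval_linMap] at this
  rw [this]

theorem IsReducedForm.linPull {n q e : ℕ} {Ω : twistedForms n q e} (h : IsReducedForm Ω.1)
    {T : Matrix (Fin (n + 1)) (Fin (n + 1)) ℂ} (hT : T.det ≠ 0) :
    IsReducedForm (linPull T Ω).1 := by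
  have h1 := T.mul_nonsing_inv (isUnit_iff_ne_zero.2 hT)
  have h2 := T.nonsing_inv_mul (isUnit_iff_ne_zero.2 hT)
  intro g hg
  have h3 : IsUnit (MvPolynomial.aeval (linMap T⁻¹) g) := by
    refine h _ fun I => ?_
    have h4 : Ω = ProjFol.linPull T⁻¹ (ProjFol.linPull T Ω) := by
      rw [linPull_linPull, h1, linPull_one]
    have h5 : coeffForm Ω.1 I = coeffForm (pullback (linMap T⁻¹) (ProjFol.linPull T Ω).1) I := by
      conv_lhs => rw [h4]
      rfl
    rw [h5, coeffForm_pullback_linMap]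
    exact Finset.dvd_sum fun J _ => Dvd.dvd.mul_left (map_dvd _ (hg J)) _
  have h6 := h3.map (MvPolynomial.aeval (R := ℂ) (linMap T))
  rwa [aeval_linMap_linMap h2] at h6

/-! ### Openness of the absence of divisorial zeros -/

/-- Injectivity is an open condition in a linear family of linear maps. -/
theorem exists_polynomial_of_injective {V E F : Type} [AddCommGroup V] [Module ℂ V]
    [AddCommGroup E] [Module ℂ E] [FiniteDimensional ℂ E] [AddCommGroup F] [Module ℂ F]
    (Φ : V →ₗ[ℂ] E →ₗ[ℂ] F) {m : ℕ} (u : Fin (m + 1) → V) (h0 : Function.Injective (Φ (u 0))) :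
    ∃ h : MvPolynomial (Fin (m + 1)) ℂ, MvPolynomial.eval (Pi.single 0 1) h ≠ 0 ∧
      ∀ z, MvPolynomial.eval z h ≠ 0 → Function.Injective (Φ (∑ k, z k • u k)) := by
  classical
  -- Composing with a left inverse at u 0 gives an endomorphism of E whose determinant is polynomial
  -- in the coefficients, equals 1 at u 0, and is nonzero only where the map is injective.
  obtain ⟨Λ, hΛ⟩ := (Φ (u 0)).exists_leftInverse_of_injective (LinearMap.ker_eq_bot.2 h0)
  let b := Module.finBasis ℂ E
  let M : Fin (m + 1) → Matrix _ _ ℂ := fun k => LinearMap.toMatrix b b (Λ.comp (Φ (u k)))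
  have hM : ∀ z : Fin (m + 1) → ℂ, LinearMap.toMatrix b b (Λ.comp (Φ (∑ k, z k • u k))) =
      ∑ k, z k • M k := by
    intro z
    have : Λ.comp (Φ (∑ k, z k • u k)) = ∑ k, z k • Λ.comp (Φ (u k)) := by
      ext x
      simp [map_sum, LinearMap.sum_apply]
    rw [this, map_sum]
    simp only [map_smul, M]
  refine ⟨Matrix.det (Matrix.of fun i j => ∑ k, MvPolynomial.X k * MvPolynomial.C (M k i j)), ?_⟩
  have hev : ∀ z, MvPolynomial.eval z
      (Matrix.det (Matrix.of fun i j => ∑ k, MvPolynomial.X k * MvPolynomial.C (M k i j))) =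
      LinearMap.det (Λ.comp (Φ (∑ k, z k • u k))) := by
    intro z
    rw [← LinearMap.det_toMatrix b, hM, RingHom.map_det]
    congr 1
    ext i j
    simp [Matrix.sum_apply]
  constructor
  · rw [hev]
    have : ∑ k, (Pi.single 0 1 : Fin (m + 1) → ℂ) k • u k = u 0 := by
      rw [Finset.sum_eq_single 0]
      · simp
      · intro k _ hk
        simp [hk]
      · simp
    rw [this, hΛ, LinearMap.det_id]
    exact one_ne_zero
  · intro z hz
    rw [hev] at hz
    have h1 : Function.Injective (Λ.comp (Φ (∑ k, z k • u k))) :=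
      (LinearMap.equivOfDetNeZero _ hz).injective
    intro x y hxy
    exact h1 (congrArg Λ hxy)

/-- The bilinear map detecting common divisors of the coefficients. -/
def syzygyMap (n q e : ℕ) : twistedForms n q e →ₗ[ℂ]
    ((Fin q → Fin (n + 1)) → MvPolynomial.restrictTotalDegree (Fin (n + 1)) ℂ e) →ₗ[ℂ]
      ((Fin q → Fin (n + 1)) × (Fin q → Fin (n + 1)) → Poly (n + 1)) :=
  LinearMap.mk₂ ℂ (fun Ω b IJ => coeffForm Ω.1 IJ.1 * (b IJ.2).1 - coeffForm Ω.1 IJ.2 * (b IJ.1).1)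
    (fun Ω Ω' b => by
      funext IJ
      change (coeffForm Ω.1 IJ.1 + coeffForm Ω'.1 IJ.1) * _ -
        (coeffForm Ω.1 IJ.2 + coeffForm Ω'.1 IJ.2) * _ = _
      rw [Pi.add_apply]
      ring)
    (fun c Ω b => by
      funext IJ
      change (c • coeffForm Ω.1 IJ.1) * _ - (c • coeffForm Ω.1 IJ.2) * _ = c • (_ - _)
      simp only [MvPolynomial.smul_eq_C_mul]
      ring)
    (fun Ω b b' => by
      funext IJ
      simp only [Pi.add_apply, Submodule.coe_add]
      ring)
    (fun c Ω b => by
      funext IJ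
      simp only [Pi.smul_apply, Submodule.coe_smul, MvPolynomial.smul_eq_C_mul]
      ring)

/-- The bound e on the degree of b is one less than the degree of the coefficients of Ω. Without
common divisors, a family b proportional to the coefficients is a polynomial multiple of them, hence
too large in degree unless zero; a nonunit common divisor of a nonzero Ω gives, by division, a
nonzero b within the bound. -/
theorem isReducedForm_iff {n q e : ℕ} (Ω : twistedForms n q e) :
    IsReducedForm Ω.1 ↔ Function.Injective (syzygyMap n q e Ω) := by
  constructor
  · intro h
    refine linearMap_injective_of_forall _ fun b hb => ?_
    have hb' : ∀ I J, coeffForm Ω.1 I * (b J).1 = coeffForm Ω.1 J * (b I).1 := by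
      intro I J
      exact sub_eq_zero.1 (congrFun hb (I, J))
    obtain ⟨g, hg⟩ := h.exists_eq_mul (b := fun I => (b I).1) hb'
    obtain ⟨I, hI⟩ := IsReducedFamily.exists_ne_zero h
    have hg0 : g = 0 := by
      by_contra hg0
      have h1 : (b I).1.totalDegree ≤ e := (MvPolynomial.mem_restrictTotalDegree _ _ _).1 (b I).2
      rw [hg I, MvPolynomial.totalDegree_mul_of_isDomain hg0 hI,
        (Ω.2.1 I).totalDegree hI] at h1
      omega
    funext J
    refine Subtype.ext ?_
    rw [hg J, hg0, zero_mul]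
    rfl
  · intro h g hg
    by_contra hu
    choose b hb using hg
    have h0 : ∀ b : (Fin q → Fin (n + 1)) → MvPolynomial.restrictTotalDegree (Fin (n + 1)) ℂ e,
        (∀ I J, coeffForm Ω.1 I * (b J).1 = coeffForm Ω.1 J * (b I).1) → ∀ I, (b I).1 = 0 := by
      intro b hb I
      have : b = 0 := h (by
        rw [map_zero]
        funext IJ
        exact sub_eq_zero.2 (hb IJ.1 IJ.2))
      rw [this]
      rfl
    have hne : ∃ I, coeffForm Ω.1 I ≠ 0 := by
      by_contra hcon
      push Not at hcon
      have := h0 (fun _ => ⟨1, by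
        rw [MvPolynomial.mem_restrictTotalDegree, MvPolynomial.totalDegree_one]
        exact Nat.zero_le _⟩) (fun I J => by rw [hcon, hcon]) 0
      exact one_ne_zero this
    obtain ⟨I₀, hI₀⟩ := hne
    have hg0 : g ≠ 0 := by
      rintro rfl
      exact hI₀ (by rw [hb, zero_mul])
    have hgd : 1 ≤ g.totalDegree := by
      by_contra hlt
      have h1 := MvPolynomial.totalDegree_eq_zero_iff_eq_C.1 (by omega : g.totalDegree = 0)
      rw [h1] at hu hg0
      refine hu ((isUnit_iff_ne_zero.2 fun hc => hg0 ?_).map MvPolynomial.C)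
      rw [hc, map_zero]
    have hbd : ∀ I, b I ∈ MvPolynomial.restrictTotalDegree (Fin (n + 1)) ℂ e := by
      intro I
      rw [MvPolynomial.mem_restrictTotalDegree]
      by_cases hI : b I = 0
      · rw [hI, MvPolynomial.totalDegree_zero]
        exact Nat.zero_le _
      · have h1 := (Ω.2.1 I).totalDegree (by rw [hb]; exact mul_ne_zero hg0 hI)
        rw [hb, MvPolynomial.totalDegree_mul_of_isDomain hg0 hI] at h1
        omega
    have := h0 (fun I => ⟨b I, hbd I⟩) (fun I J => by
      change coeffForm Ω.1 I * b J = coeffForm Ω.1 J * b I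
      rw [hb I, hb J]
      ring) I₀
    exact hI₀ (by rw [hb]; rw [show b I₀ = 0 from this, mul_zero])

/-- Being without divisorial zeros is an open condition. -/
theorem exists_polynomial_isReducedForm {n q e m : ℕ} (u : Fin (m + 1) → twistedForms n q e)
    (h0 : IsReducedForm (u 0).1) :
    ∃ h : MvPolynomial (Fin (m + 1)) ℂ, MvPolynomial.eval (Pi.single 0 1) h ≠ 0 ∧
      ∀ z, MvPolynomial.eval z h ≠ 0 → IsReducedForm (∑ k, z k • u k : twistedForms n q e).1 := by
  obtain ⟨h, h1, h2⟩ := exists_polynomial_of_injective (syzygyMap n q e) u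
    ((isReducedForm_iff (u 0)).1 h0)
  exact ⟨h, h1, fun z hz => (isReducedForm_iff _).2 (h2 z hz)⟩

/-! ### Infinitesimal symmetries of the forms `i_S i_X i_R ν` -/

/-- Morally the hypothesis makes a, x, b, c linearly dependent, so that the contractions by (a, x,
b) and (a, c, b) are proportional. In the Plücker relation of i_b i_a vol with the one-form y ↦
vol(a, b, y, w), applied to x, c, v, all terms after the first two vanish by hypothesis. For q = 0
the arguments v and w are both empty. -/
theorem vol3_mul_vol3 {R : Type*} [CommRing R] {q : ℕ} {a b c x : Fin (q + 3) → R}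
    (h : ∀ (v : Fin q → Fin (q + 3) → R) (i : Fin q), v i = b → vol3 a x c v = 0)
    (v w : Fin q → Fin (q + 3) → R) :
    vol3 a x b w * vol3 a c b v = vol3 a x b v * vol3 a c b w := by
  obtain _ | r := q
  · rw [Subsingleton.elim v w]
  · let f : (Fin (r + 1 + 3) → R) [⋀^Fin (r + 1 + 1)]→ₗ[R] R := vol2 a b
    let ℓ := f.toMultilinearMap.toLinearMap (Matrix.vecCons 0 w) 0
    have hℓ : ∀ y, ℓ y = vol3 a b y w := by
      intro y
      change f (Function.update (Matrix.vecCons 0 w) 0 y) = _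
      rw [update_vecCons_zero]
      rfl
    have ha : ℓ a = 0 := by
      rw [hℓ, vol3_swap₁₂, vol3, AlternatingMap.curryLeft_same]
      simp
    have hb : ℓ b = 0 := by
      rw [hℓ, vol3_self₁₂]
      rfl
    have h1 := ((isPlucker_det ℓ).curryLeft ha).curryLeft hb (Matrix.vecCons x (Matrix.vecCons c v))
    rw [Fin.sum_univ_succ, Fin.sum_univ_succ, Finset.sum_eq_zero, add_zero] at h1
    · simp only [vecCons_comp_succAbove_zero, vecCons_comp_succAbove_succ, hℓ, Fin.val_zero,
        Fin.val_succ, Matrix.cons_val_zero, Matrix.cons_val_succ] at h1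
      change _ * (vol3 a b x w * vol3 a b c v) + _ * (vol3 a b c w * vol3 a b x v) = 0 at h1
      rw [vol3_swap₁₂ a x, vol3_swap₁₂ a c]
      simp only [AlternatingMap.neg_apply]
      linear_combination h1
    · intro j _
      have h2 : (fun i => Matrix.vecCons x (Matrix.vecCons c v) (j.succ.succ.succAbove i)) =
          Matrix.vecCons x (Matrix.vecCons c fun i => v (j.succAbove i)) := by
        rw [vecCons_comp_succAbove_succ, vecCons_comp_succAbove_succ]
      have h3 := h (Matrix.vecCons b fun i => v (j.succAbove i)) 0 rfl
      have h4 : vol2 a b (fun i => Matrix.vecCons x (Matrix.vecCons c v)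
          (j.succ.succ.succAbove i)) = 0 := by
        rw [h2]
        change vol3 a b x (Matrix.vecCons c fun i => v (j.succAbove i)) = 0
        rw [vol3_swap₁₂, AlternatingMap.neg_apply]
        change -((vol3 a x b).curryLeft c) (fun i => v (j.succAbove i)) = 0
        rw [← vol2_curryLeft, curryLeft_swap]
        change -(-(vol3 a x c (Matrix.vecCons b fun i => v (j.succAbove i)))) = 0
        rw [h3, neg_zero, neg_zero]
      change _ * (_ * vol2 a b (fun i => Matrix.vecCons x (Matrix.vecCons c v)
          (j.succ.succ.succAbove i))) = 0
      rw [h4, mul_zero, mul_zero]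

section Commutator

variable {q : ℕ}

theorem linMap_add {m : ℕ} (T T' : Matrix (Fin m) (Fin m) ℂ) :
    linMap (T + T') = linMap T + linMap T' := by
  funext i
  simp [linMap, add_mul, Finset.sum_add_distrib]

theorem linMap_smul {m : ℕ} (c : ℂ) (T : Matrix (Fin m) (Fin m) ℂ) :
    linMap (c • T) = c • linMap T := by
  funext i
  simp [linMap, Finset.smul_sum, MvPolynomial.smul_eq_C_mul, mul_assoc]

/-- The map `B ↦ i_A i_B i_R ν` on linear fields. -/
def thetaLin (A : Matrix (Fin (q + 3)) (Fin (q + 3)) ℂ) :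
    Matrix (Fin (q + 3)) (Fin (q + 3)) ℂ →ₗ[ℂ] Form (q + 3) q where
  toFun B := theta A (linMap B)
  map_add' B B' := by rw [linMap_add, theta_add]
  map_smul' c B := by rw [linMap_smul, theta_smul]; rfl

/-- The map `B ↦ i_A i_[A, B] i_R ν`. -/
def thetaComm (A : Matrix (Fin (q + 3)) (Fin (q + 3)) ℂ) :
    Matrix (Fin (q + 3)) (Fin (q + 3)) ℂ →ₗ[ℂ] Form (q + 3) q :=
  (thetaLin A).comp (LinearMap.mulLeft ℂ A - LinearMap.mulRight ℂ A)

variable {p : Fin (q + 2) → ℕ}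

theorem extW_injective {n : ℕ} {p : Fin n → ℕ} (hp : Function.Injective p) (hpos : ∀ i, 0 < p i) :
    Function.Injective (extW p) := by
  intro i j
  refine Fin.lastCases ?_ (fun i => ?_) i <;> refine Fin.lastCases ?_ (fun j => ?_) j
  · exact fun _ => rfl
  · intro h
    rw [extW_castSucc, extW_last] at h
    exact absurd h (hpos j).ne
  · intro h
    rw [extW_castSucc, extW_last] at h
    exact absurd h (hpos i).ne'
  · intro h
    rw [extW_castSucc, extW_castSucc] at h
    rw [hp h]

theorem extMat_commutator {n : ℕ} (p : Fin n → ℕ) (B : Matrix (Fin (n + 1)) (Fin (n + 1)) ℂ)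
    (i j : Fin (n + 1)) : (extMat p * B - B * extMat p) i j =
      ((extW p i : ℂ) - extW p j) * B i j := by
  rw [Matrix.sub_apply, extMat, Matrix.diagonal_mul, Matrix.mul_diagonal]
  ring

theorem exists_ne_ne {m : ℕ} (i j : Fin (m + 3)) : ∃ k, k ≠ i ∧ k ≠ j := by
  have h : ({i, j} : Finset (Fin (m + 3))).card < (Finset.univ : Finset (Fin (m + 3))).card := by
    rw [Finset.card_univ, Fintype.card_fin]
    exact lt_of_le_of_lt Finset.card_le_two (by omega)
  obtain ⟨k, -, hk⟩ := Finset.exists_mem_notMem_of_card_lt_card h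
  simp only [Finset.mem_insert, Finset.mem_singleton, not_or] at hk
  exact ⟨k, hk.1, hk.2⟩

/-- At a = e_i + t e_j the minor on i, j, k equals t (s_i − s_j)(C_ki + t C_kj), where s denotes the
weights; the values t = ±1 separate the two entries of C. -/
theorem apply_eq_zero_of_thetaLin_eq_zero (hs : Function.Injective (extW p))
    {C : Matrix (Fin (q + 3)) (Fin (q + 3)) ℂ} (h : thetaLin (extMat p) C = 0)
    {k i : Fin (q + 3)} (hki : k ≠ i) : C k i = 0 := by
  obtain ⟨j, hjk, hji⟩ := exists_ne_ne k i
  have key : ∀ t : ℂ, t ≠ 0 → C k i + t * C k j = 0 := by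
    intro t ht
    let a : Fin (q + 3) → ℂ := Pi.single i 1 + Pi.single j t
    have hai : a i = 1 := by simp [a, hji.symm]
    have haj : a j = t := by simp [a, hji]
    have hak : a k = 0 := by simp [a, hki, hjk.symm]
    have h1 : vol3 a (C.mulVec a) ((extMat p).mulVec a) = 0 := by
      refine AlternatingMap.ext fun v => ?_
      have h2 := formAt_theta (extMat p) (linMap C) a v
      rw [fieldAt_linMap] at h2
      rw [← h2]
      change formAt (thetaLin (extMat p) C) a v = _
      rw [h, formAt_zero]
      rfl
    have h2 := minor_three_eq_zero h1 hji.symm hki.symm hjk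
    have h3 : C.mulVec a k = C k i + t * C k j := by
      simp [a, Matrix.mulVec_add]
    rw [Matrix.det_fin_three] at h2
    simp only [extMat_mulVec, hai, haj, hak, h3, Matrix.of_apply, Matrix.cons_val', Matrix.cons_val_zero,
      Matrix.cons_val_one, Matrix.cons_val] at h2
    have h4 : ((extW p i : ℂ) - extW p j) * t ≠ 0 := by
      refine mul_ne_zero ?_ ht
      rw [sub_ne_zero]
      exact_mod_cast fun h => hji (hs h).symm
    refine (mul_eq_zero.1 ?_).resolve_left h4
    linear_combination h2
  have h1 := key 1 one_ne_zero
  have h2 := key (-1) (neg_ne_zero.2 one_ne_zero)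
  linear_combination (h1 + h2) / 2

/-- The diagonal matrices. -/
def diagMat (m : ℕ) : Submodule ℂ (Matrix (Fin m) (Fin m) ℂ) :=
  LinearMap.range (Matrix.diagonalLinearMap (Fin m) ℂ ℂ)

theorem mem_diagMat_iff {m : ℕ} {B : Matrix (Fin m) (Fin m) ℂ} :
    B ∈ diagMat m ↔ ∀ i j, i ≠ j → B i j = 0 := by
  constructor
  · rintro ⟨b, rfl⟩ i j hij
    exact Matrix.diagonal_apply_ne _ hij
  · intro h
    exact ⟨B.diag, Matrix.IsDiag.diagonal_diag fun i j hij => h i j hij⟩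

theorem finrank_diagMat (m : ℕ) : Module.finrank ℂ (diagMat m) = m := by
  rw [diagMat, LinearMap.finrank_range_of_inj Matrix.diagonal_injective]
  simp

/-- The off-diagonal entries of [A, B] − D vanish, and the (i, j) entry of [A, B] is (s_i − s_j)
B_ij with distinct weights s. -/
theorem mem_diagMat_of_thetaLin (hs : Function.Injective (extW p))
    {B D : Matrix (Fin (q + 3)) (Fin (q + 3)) ℂ} (hD : D ∈ diagMat (q + 3))
    (h : thetaComm (extMat p) B = thetaLin (extMat p) D) : B ∈ diagMat (q + 3) := by
  rw [mem_diagMat_iff] at hD ⊢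
  intro i j hij
  have h1 : thetaLin (extMat p) (extMat p * B - B * extMat p - D) = 0 := by
    rw [map_sub, ← h]
    exact sub_self _
  have h2 := apply_eq_zero_of_thetaLin_eq_zero hs h1 hij
  rw [Matrix.sub_apply, extMat_commutator, hD i j hij, sub_zero] at h2
  refine (mul_eq_zero.1 h2).resolve_left ?_
  rw [sub_eq_zero]
  exact_mod_cast fun h => hij (hs h)

theorem mem_diagMat_of_thetaComm_eq_zero (hs : Function.Injective (extW p))
    {B : Matrix (Fin (q + 3)) (Fin (q + 3)) ℂ}
    (h : thetaComm (extMat p) B = 0) : B ∈ diagMat (q + 3) :=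
  mem_diagMat_of_thetaLin hs (Submodule.zero_mem _) (by rw [h, map_zero])

/-- The matrices `B` such that the derivative of `u` along `B` stays in `weightForms`. -/
def symMat {d : ℕ} (p : Fin (q + 2) → ℕ) (lam : ℤ) (u : twistedForms (q + 2) q (d + 1)) :
    Submodule ℂ (Matrix (Fin (q + 3)) (Fin (q + 3)) ℂ) :=
  (weightForms p lam d).comap ((pullRep (q + 2) q (d + 1)).lieDer u)

/-- Of the three terms of L_B u, all but the one containing [A, B] are contractions by A, as is
every element of `weightForms`. Hence i_A kills i_[A,B] i_X i_R ν, which makes the forms built from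
X and from [A, B] proportional; as u has no divisorial zeros, the factor is a polynomial. -/
theorem exists_thetaComm_eq_mul {d : ℕ} {lam : ℤ} {u : twistedForms (q + 2) q (d + 1)}
    (hu : u ∈ weightForms p lam d) (hr : IsReducedForm u.1)
    {B : Matrix (Fin (q + 3)) (Fin (q + 3)) ℂ} (hB : B ∈ symMat p lam u) :
    ∃ g, ∀ I, coeffForm (thetaComm (extMat p) B) I = g * coeffForm u.1 I := by
  obtain ⟨X, hX, hu⟩ := hu
  obtain rfl : u = thetaV (extMat p) hX.homog := Subtype.ext hu
  obtain ⟨Y, -, hY⟩ := hB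
  have hv : ∀ a v i, v i = (extMat p).mulVec a → vol3 a (fieldAt a X)
      ((extMat p * B - B * extMat p).mulVec a) v = 0 := by
    intro a v i hi
    have h1 := formAt_lieDer_thetaV (extMat p) B hX.homog a v
    rw [hY, formAt_theta, vol3_eq_zero_of_mem _ _ _ v i (Or.inr (Or.inr hi)),
      vol3_eq_zero_of_mem _ _ _ v i (Or.inr (Or.inr hi)),
      vol3_eq_zero_of_mem _ _ _ v i (Or.inr (Or.inr hi)), mul_zero, zero_add, zero_add] at h1
    exact h1.symm
  refine hr.exists_eq_mul fun I J => MvPolynomial.funext fun a => ?_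
  rw [map_mul, map_mul]
  change MvPolynomial.eval a (coeffForm (theta (extMat p) X) I) *
    MvPolynomial.eval a (coeffForm (theta (extMat p) _) J) =
    MvPolynomial.eval a (coeffForm (theta (extMat p) X) J) *
    MvPolynomial.eval a (coeffForm (theta (extMat p) _) I)
  simp only [eval_coeffForm, formAt_theta]
  refine vol3_mul_vol3 (fun v i hi => ?_) _ _
  have := hv a v i hi
  rwa [← fieldAt_linMap] at this

theorem isHomogeneous_coeffForm_thetaComm (A B : Matrix (Fin (q + 3)) (Fin (q + 3)) ℂ)
    (I : Fin q → Fin (q + 3)) : (coeffForm (thetaComm A B) I).IsHomogeneous 3 :=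
  (theta_mem A (isHomogeneous_linMap (A * B - B * A))).1 I

/-- Degrees decide: i_A i_[A,B] i_R ν has degree 3 and u has degree d + 2 ≥ 4, so the factor g is
zero. -/
theorem symMat_le_of_two_le {d : ℕ} (hd : 2 ≤ d) (hs : Function.Injective (extW p)) {lam : ℤ}
    {u : twistedForms (q + 2) q (d + 1)} (hu : u ∈ weightForms p lam d) (hr : IsReducedForm u.1) :
    symMat p lam u ≤ diagMat (q + 3) := by
  intro B hB
  obtain ⟨g, hg⟩ := exists_thetaComm_eq_mul hu hr hB
  obtain ⟨I, hI⟩ := IsReducedFamily.exists_ne_zero hr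
  refine mem_diagMat_of_thetaComm_eq_zero hs (form_ext fun J => ?_)
  have hg0 : g = 0 := by
    by_contra hg0
    have h1 := (isHomogeneous_coeffForm_thetaComm (extMat p) B I).totalDegree
      (by rw [hg]; exact mul_ne_zero hg0 hI)
    rw [hg, MvPolynomial.totalDegree_mul_of_isDomain hg0 hI, (u.2.1 I).totalDegree hI] at h1
    omega
  rw [hg, hg0, zero_mul]
  rfl

theorem exists_thetaComm_eq_smul {lam : ℤ} {u : twistedForms (q + 2) q (1 + 1)}
    (hu : u ∈ weightForms p lam 1) (hr : IsReducedForm u.1)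
    {B : Matrix (Fin (q + 3)) (Fin (q + 3)) ℂ} (hB : B ∈ symMat p lam u) :
    ∃ c : ℂ, thetaComm (extMat p) B = c • u.1 := by
  obtain ⟨g, hg⟩ := exists_thetaComm_eq_mul hu hr hB
  obtain ⟨I, hI⟩ := IsReducedFamily.exists_ne_zero hr
  have hg0 : g.totalDegree = 0 := by
    by_cases hg0 : g = 0
    · rw [hg0, MvPolynomial.totalDegree_zero]
    · have h1 := (isHomogeneous_coeffForm_thetaComm (extMat p) B I).totalDegree
        (by rw [hg]; exact mul_ne_zero hg0 hI)
      rw [hg, MvPolynomial.totalDegree_mul_of_isDomain hg0 hI, (u.2.1 I).totalDegree hI] at h1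
      omega
  rw [MvPolynomial.totalDegree_eq_zero_iff_eq_C] at hg0
  refine ⟨MvPolynomial.coeff 0 g, form_ext fun J => ?_⟩
  rw [hg, hg0]
  simp only [MvPolynomial.coeff_C, if_true]
  exact (MvPolynomial.smul_eq_C_mul _ _).symm

theorem finrank_le_add_one {E F : Type} [AddCommGroup E] [AddCommGroup F] [Module ℂ E] [Module ℂ F]
    [FiniteDimensional ℂ E] {K D : Submodule ℂ E} (f : E →ₗ[ℂ] F) (w : F)
    (h : ∀ x ∈ K, ∃ c : ℂ, f x = c • w) (h0 : ∀ x, f x = 0 → x ∈ D) :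
    Module.finrank ℂ K ≤ Module.finrank ℂ D + 1 := by
  have h1 := (f.domRestrict K).finrank_range_add_finrank_ker
  have h2 : Module.finrank ℂ (LinearMap.range (f.domRestrict K)) ≤ 1 := by
    refine (Submodule.finrank_mono (t := Submodule.span ℂ {w}) ?_).trans ?_
    · rintro _ ⟨x, rfl⟩
      obtain ⟨c, hc⟩ := h x.1 x.2
      exact Submodule.mem_span_singleton.2 ⟨c, hc.symm⟩
    · have := finrank_span_le_card (R := ℂ) ({w} : Set F)
      simpa using this
  have h3 : Module.finrank ℂ (LinearMap.ker (f.domRestrict K)) ≤ Module.finrank ℂ D := by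
    have h4 := Submodule.finrank_map_subtype_eq K (LinearMap.ker (f.domRestrict K))
    rw [← h4]
    refine Submodule.finrank_mono ?_
    rintro _ ⟨x, hx, rfl⟩
    exact h0 _ hx
  omega

theorem finrank_symMat_le {lam : ℤ} (hs : Function.Injective (extW p))
    {u : twistedForms (q + 2) q (1 + 1)}
    (hu : u ∈ weightForms p lam 1) (hr : IsReducedForm u.1) :
    Module.finrank ℂ (symMat p lam u) ≤ q + 3 + 1 := by
  have h := finrank_le_add_one (D := diagMat (q + 3)) (thetaComm (extMat p)) u.1
    (fun B hB => exists_thetaComm_eq_smul hu hr hB)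
    (fun B hB => mem_diagMat_of_thetaComm_eq_zero hs hB)
  rwa [finrank_diagMat] at h

theorem exists_eq_single_of_degree_eq_one {σ : Type*} {a : σ →₀ ℕ} (ha : a.degree = 1) :
    ∃ j, a = Finsupp.single j 1 := by
  have h0 : a ≠ 0 := by
    rintro rfl
    simp at ha
  obtain ⟨j, hj⟩ := Finsupp.support_nonempty_iff.2 h0
  have h1 : Finsupp.single j 1 ≤ a := by
    rw [Finsupp.single_le_iff]
    exact Nat.one_le_iff_ne_zero.2 (Finsupp.mem_support_iff.1 hj)
  obtain ⟨b, rfl⟩ := exists_add_of_le h1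
  rw [map_add, Finsupp.degree_single] at ha
  have : b = 0 := (Finsupp.degree_eq_zero_iff b).1 (by omega)
  exact ⟨j, by rw [this, add_zero]⟩

/-- Homogeneous fields of degree one are linear. -/
theorem exists_eq_linMap {m : ℕ} {p : Fin m → ℕ} {lam : ℤ} {X : VField m}
    (hX : IsWeightField p lam 1 X) : ∃ M : Matrix (Fin m) (Fin m) ℂ, X = linMap M ∧
      ∀ i j, M i j ≠ 0 → (p j : ℤ) = lam + p i := by
  refine ⟨Matrix.of fun i j => MvPolynomial.coeff (Finsupp.single j 1) (X i), ?_, ?_⟩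
  · funext i
    refine MvPolynomial.ext _ _ fun a => ?_
    by_cases ha : a.degree = 1
    · obtain ⟨j, rfl⟩ := exists_eq_single_of_degree_eq_one ha
      rw [linMap, MvPolynomial.coeff_sum, Finset.sum_eq_single j]
      · rw [MvPolynomial.coeff_C_mul, MvPolynomial.coeff_X, if_pos rfl, mul_one]
        rfl
      · intro k _ hk
        rw [MvPolynomial.coeff_C_mul, MvPolynomial.coeff_X, if_neg, mul_zero]
        intro h
        exact hk (Finsupp.single_left_injective one_ne_zero h)
      · simp
    · rw [(hX.homog i).coeff_eq_zero ha, (isHomogeneous_linMap _ i).coeff_eq_zero ha]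
  · intro i j hij
    have h := hX.weight i hij
    rw [Finsupp.weight_single, one_smul] at h
    exact h

theorem thetaLin_of_eq {u : twistedForms (q + 2) q (1 + 1)} {lam : ℤ} (hu : u ∈ weightForms p lam 1) :
    ∃ M : Matrix (Fin (q + 3)) (Fin (q + 3)) ℂ, u.1 = thetaLin (extMat p) M ∧
      ∀ i j, M i j ≠ 0 → (extW p j : ℤ) = lam + extW p i := by
  obtain ⟨X, hX, hu⟩ := hu
  obtain ⟨M, rfl, hM⟩ := exists_eq_linMap hX
  exact ⟨M, hu, hM⟩

theorem mem_diagMat_of_weight_zero (hs : Function.Injective (extW p))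
    {M : Matrix (Fin (q + 3)) (Fin (q + 3)) ℂ}
    (hM : ∀ i j, M i j ≠ 0 → (extW p j : ℤ) = 0 + extW p i) : M ∈ diagMat (q + 3) := by
  rw [mem_diagMat_iff]
  intro i j hij
  by_contra h
  have := hM i j h
  rw [zero_add] at this
  exact hij (hs (by exact_mod_cast this)).symm

/-- For λ = 0 distinct weights make the matrix M of u diagonal. The relation between the forms then
compares [A, B] with the diagonal matrix cM, so all off-diagonal entries of [A, B] vanish and the
constant c brings no extra symmetry. -/
theorem symMat_le_of_weight_zero (hs : Function.Injective (extW p))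
    {u : twistedForms (q + 2) q (1 + 1)}
    (hu : u ∈ weightForms p 0 1) (hr : IsReducedForm u.1) :
    symMat p 0 u ≤ diagMat (q + 3) := by
  intro B hB
  obtain ⟨c, hc⟩ := exists_thetaComm_eq_smul hu hr hB
  obtain ⟨M, hM, hM'⟩ := thetaLin_of_eq hu
  refine mem_diagMat_of_thetaLin hs
    ((diagMat (q + 3)).smul_mem c (mem_diagMat_of_weight_zero hs hM')) ?_
  rw [hc, hM, map_smul]

/-- Diagonal matrices are infinitesimal symmetries. -/
theorem diagMat_le_symMat {d : ℕ} {lam : ℤ} {u : twistedForms (q + 2) q (d + 1)}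
    (hu : u ∈ weightForms p lam d) : diagMat (q + 3) ≤ symMat p lam u := by
  obtain ⟨X, hX, hu⟩ := hu
  obtain rfl : u = thetaV (extMat p) hX.homog := Subtype.ext hu
  rintro _ ⟨b, rfl⟩
  -- Y is the bracket of the diagonal field with X. The operators x_j ∂/∂x_j preserve degrees and
  -- weights, and the term with [A, B] disappears because diagonal matrices commute.
  let Y : VField (q + 3) := fun i => ∑ j, MvPolynomial.C (b j) * (MvPolynomial.X j *
    MvPolynomial.pderiv j (X i)) - MvPolynomial.C (b i) * X i
  have hY : IsWeightField (extW p) lam d Y := by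
    refine ⟨fun i => ?_, fun i => ?_⟩
    · refine (MvPolynomial.IsHomogeneous.sum _ _ _ fun j _ => ?_).sub ((hX.homog i).C_mul _)
      exact MvPolynomial.IsHomogeneous.C_mul
        (isWeightedHomogeneous_X_mul_pderiv (hX.homog i) j) (b j)
    · refine MvPolynomial.IsWeightedHomogeneous.sub
        (MvPolynomial.IsWeightedHomogeneous.sum _ _ _ fun j _ => ?_) ((hX.weight i).C_mul _)
      exact MvPolynomial.IsWeightedHomogeneous.C_mul
        (isWeightedHomogeneous_X_mul_pderiv (hX.weight i) j) (b j)
  refine ⟨(Matrix.diagonal b).trace • X + Y, (hX.smul _).add hY, form_ext_formAt fun a v => ?_⟩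
  have h1 := formAt_lieDer_thetaV (extMat p) (Matrix.diagonal b) hX.homog a v
  have h2 : extMat p * Matrix.diagonal b - Matrix.diagonal b * extMat p = 0 := by
    rw [extMat, Matrix.diagonal_mul_diagonal, Matrix.diagonal_mul_diagonal, sub_eq_zero]
    congr 1
    funext i
    ring
  have h3 : fieldAt a Y = (jac X a).mulVec ((Matrix.diagonal b).mulVec a) -
      (Matrix.diagonal b).mulVec (fieldAt a X) := by
    funext i
    simp only [fieldAt, Y, map_sub, map_sum, map_mul, MvPolynomial.eval_C, MvPolynomial.eval_X,
      Pi.sub_apply, Matrix.mulVec_diagonal]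
    congr 1
    rw [Matrix.mulVec, dotProduct]
    refine Finset.sum_congr rfl fun j _ => ?_
    rw [Matrix.mulVec_diagonal, jac, Matrix.of_apply]
    ring
  have h4 : vol3 a (fieldAt a X) (0 : Fin (q + 3) → ℂ) v = 0 := by
    have := vol3_smul₂ 0 a (fieldAt a X) (0 : Fin (q + 3) → ℂ) (q := q)
    rw [zero_smul, zero_smul] at this
    rw [this]
    rfl
  rw [h2, Matrix.zero_mulVec, h4, add_zero, ← h3] at h1
  refine h1.trans ?_
  rw [formAt_theta, fieldAt_add, fieldAt_smul, vol3_add₁, vol3_smul₁, AlternatingMap.add_apply,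
    AlternatingMap.smul_apply, smul_eq_mul]

theorem le_finrank_symMat {d : ℕ} {lam : ℤ} {u : twistedForms (q + 2) q (d + 1)}
    (hu : u ∈ weightForms p lam d) : q + 3 ≤ Module.finrank ℂ (symMat p lam u) := by
  have := Submodule.finrank_mono (diagMat_le_symMat hu)
  rwa [finrank_diagMat] at this

/-- The weight condition gives [A, M] = −λM, so the bracket term repeats the field M and vanishes;
[M, M] = 0 kills the middle term, leaving L_M u = tr(M) u. -/
theorem mem_symMat_self {lam : ℤ} {u : twistedForms (q + 2) q (1 + 1)}
    (hu : u ∈ weightForms p lam 1) {M : Matrix (Fin (q + 3)) (Fin (q + 3)) ℂ}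
    (hM : u.1 = thetaLin (extMat p) M) (hM' : ∀ i j, M i j ≠ 0 → (extW p j : ℤ) = lam + extW p i) :
    M ∈ symMat p lam u := by
  have h0 : (pullRep (q + 2) q (1 + 1)).lieDer u M = M.trace • u := by
    obtain rfl : u = thetaV (extMat p) (isHomogeneous_linMap M) := Subtype.ext hM
    refine Subtype.ext (form_ext_formAt fun a v => ?_)
    rw [formAt_lieDer_thetaV]
    have h1 : jac (linMap M) a = M := by
      ext i j
      rw [jac, Matrix.of_apply, pderiv_linMap, MvPolynomial.eval_C]
    have h2 : extMat p * M - M * extMat p = (-(lam : ℂ)) • M := by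
      ext i j
      rw [extMat_commutator, Matrix.smul_apply, smul_eq_mul]
      by_cases h : M i j = 0
      · rw [h, mul_zero, mul_zero]
      · have := congrArg (Int.cast : ℤ → ℂ) (hM' i j h)
        push_cast at this
        rw [this]
        ring
    have h3 : ∀ y : Fin (q + 3) → ℂ, vol3 a (0 : Fin (q + 3) → ℂ) y v = 0 := by
      intro y
      have := vol3_smul₁ 0 a (0 : Fin (q + 3) → ℂ) y (q := q)
      rw [zero_smul, zero_smul] at this
      rw [this]
      rfl
    rw [h1, h2, fieldAt_linMap, sub_self, h3, Matrix.smul_mulVec, vol3_smul₂, vol3_self₁₂, smul_zero,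
      AlternatingMap.zero_apply, add_zero, add_zero]
    change _ = formAt (M.trace • theta (extMat p) (linMap M)) a v
    rw [formAt_smul, formAt_theta, fieldAt_linMap]
  change _ ∈ weightForms p lam 1
  rw [h0]
  exact (weightForms p lam 1).smul_mem _ hu

theorem succ_le_finrank_of_lt {E : Type} [AddCommGroup E] [Module ℂ E] [FiniteDimensional ℂ E]
    {D K : Submodule ℂ E} (h : D ≤ K) {x : E} (hx : x ∈ K) (hx' : x ∉ D) :
    Module.finrank ℂ D + 1 ≤ Module.finrank ℂ K :=
  Submodule.finrank_lt_finrank_of_lt (lt_of_le_of_ne h fun e => hx' (e ▸ hx))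

/-- The bound is required at every u, including u = 0, because the upper estimate of the dimension
uses it at every form. A diagonal M of nonzero weight is zero, and then u = 0 and every matrix is a
symmetry; otherwise M itself is a symmetry outside the diagonal ones. -/
theorem succ_le_finrank_symMat {lam : ℤ} (hlam : lam ≠ 0) {u : twistedForms (q + 2) q (1 + 1)}
    (hu : u ∈ weightForms p lam 1) : q + 3 + 1 ≤ Module.finrank ℂ (symMat p lam u) := by
  refine le_of_eq_of_le (congrArg (· + 1) (finrank_diagMat (q + 3)).symm) ?_
  obtain ⟨M, hM, hM'⟩ := thetaLin_of_eq hu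
  by_cases h : M ∈ diagMat (q + 3)
  · have hM0 : M = 0 := by
      ext i j
      by_contra hij
      have h1 := hM' i j hij
      by_cases hne : i = j
      · subst hne
        exact hlam (by linarith)
      · exact hij (mem_diagMat_iff.1 h i j hne)
    have hu0 : u = 0 := Subtype.ext (by rw [hM, hM0, map_zero]; rfl)
    have hB : ∀ B : Matrix (Fin (q + 3)) (Fin (q + 3)) ℂ, B ∈ symMat p lam u := by
      intro B
      have h1 : (pullRep (q + 2) q (1 + 1)).lieDer u B = 0 := by
        have hz := isWeightField_zero (d := 1) (extW p) lam
        obtain rfl : u = thetaV (extMat p) hz.homog :=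
          hu0.trans (Subtype.ext (theta_zero _).symm)
        refine Subtype.ext (form_ext_formAt fun a v => ?_)
        rw [formAt_lieDer_thetaV]
        have e1 : fieldAt a (0 : VField (q + 3)) = 0 := by
          funext i
          simp [fieldAt]
        have e2 : jac (0 : VField (q + 3)) a = 0 := by
          ext i j
          simp [jac]
        have e3 : ∀ y : Fin (q + 3) → ℂ, vol3 a (0 : Fin (q + 3) → ℂ) y v = 0 := by
          intro y
          have := vol3_smul₁ 0 a (0 : Fin (q + 3) → ℂ) y (q := q)
          rw [zero_smul, zero_smul] at this
          rw [this]
          rfl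
        rw [e1, e2, Matrix.zero_mulVec, Matrix.mulVec_zero, sub_self, e3, e3]
        change _ = formAt (0 : Form (q + 3) q) a v
        rw [formAt_zero]
        ring
      change _ ∈ weightForms p lam 1
      rw [h1]
      exact Submodule.zero_mem _
    refine succ_le_finrank_of_lt (diagMat_le_symMat hu) (hB (Matrix.single 0 (Fin.last _) 1)) ?_
    intro h
    have := mem_diagMat_iff.1 h 0 (Fin.last _) (Fin.last_pos).ne
    simp at this
  · exact succ_le_finrank_of_lt (diagMat_le_symMat hu) (mem_symMat_self hu hM hM') h

end Commutator

/-! ### Diagonal linear fields -/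

section Reduction

theorem vol3_map_eq_zero {m q : ℕ} {R : Type*} [CommRing R] (φ : Poly m →+* R)
    {a b c : Fin (q + 3) → Poly m}
    (h : ∀ I : Fin q → Fin (q + 3), φ (vol3 a b c fun k => Pi.single (I k) 1) = 0) :
    vol3 (fun i => φ (a i)) (fun i => φ (b i)) (fun i => φ (c i)) = 0 := by
  refine alternatingMap_ext_of_strictMono fun I => ?_
  rw [AlternatingMap.zero_apply, ← h I, vol3_apply, vol3_apply]
  refine Eq.trans ?_ (RingHom.map_det φ (Matrix.of (Matrix.vecCons a (Matrix.vecCons b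
    (Matrix.vecCons c fun k => Pi.single (I k) 1))))).symm
  change Matrix.det _ = _
  congr 1
  ext i j
  refine Fin.cases rfl (fun i => ?_) i
  refine Fin.cases rfl (fun i => ?_) i
  refine Fin.cases rfl (fun i => ?_) i
  change (Pi.single (I i) 1 : Fin (q + 3) → R) j = φ ((Pi.single (I i) 1 : Fin (q + 3) → Poly m) j)
  rw [Pi.single_apply, Pi.single_apply]
  split_ifs <;> simp

variable {q : ℕ}

/-- The diagonal field with eigenvalues the squares of the weights. -/
def sqMat {n : ℕ} (p : Fin n → ℕ) : Matrix (Fin (n + 1)) (Fin (n + 1)) ℂ :=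
  Matrix.diagonal fun i => (extW p i : ℂ) ^ 2

theorem linMap_diagonal {m : ℕ} (b : Fin m → ℂ) (i : Fin m) :
    linMap (Matrix.diagonal b) i = MvPolynomial.C (b i) * MvPolynomial.X i := by
  rw [linMap, Finset.sum_eq_single i]
  · rw [Matrix.diagonal_apply_eq]
  · intro j _ hj
    rw [Matrix.diagonal_apply_ne _ hj.symm, map_zero, zero_mul]
  · simp

/-- Modulo π the fields x_i, s_i² x_i, s_i x_i have vanishing 3 × 3 minors, and such a minor is x_i
x_j x_k times, up to sign, a Vandermonde determinant in the distinct weights s, a nonzero constant.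
-/
theorem dvd_mul_of_dvd_coeffForm {p : Fin (q + 2) → ℕ} (hs : Function.Injective (extW p))
    {π : Poly (q + 3)} (h : ∀ I, π ∣ coeffForm (thetaLin (extMat p) (sqMat p)) I) {i j k : Fin (q + 3)} (hij : i ≠ j)
    (hik : i ≠ k) (hjk : j ≠ k) : π ∣ MvPolynomial.X i * MvPolynomial.X j * MvPolynomial.X k := by
  let φ := Ideal.Quotient.mk (Ideal.span {π})
  have h1 := vol3_map_eq_zero φ (a := radial (q + 3)) (b := linMap (sqMat p))
    (c := linMap (extMat p)) fun I =>
      Ideal.Quotient.eq_zero_iff_mem.2 (Ideal.mem_span_singleton.2 (h I))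
  have h2 := minor_three_eq_zero h1 hij hik hjk
  rw [Matrix.det_fin_three] at h2
  simp only [Matrix.of_apply, Matrix.cons_val', Matrix.cons_val_zero, Matrix.cons_val_one,
    Matrix.cons_val, sqMat, extMat, linMap_diagonal, radial, ← map_mul, ← map_sub, ← map_add] at h2
  rw [Ideal.Quotient.eq_zero_iff_mem, Ideal.mem_span_singleton] at h2
  have h3 : ∀ i j : Fin (q + 3), i ≠ j → ((extW p i : ℂ) - extW p j) ≠ 0 := by
    intro i j hij
    rw [sub_ne_zero]
    exact_mod_cast fun h => hij (hs h)
  have h4 : IsUnit (MvPolynomial.C (((extW p i : ℂ) - extW p j) * ((extW p i : ℂ) - extW p k) *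
      ((extW p j : ℂ) - extW p k)) : Poly (q + 3)) :=
    (isUnit_iff_ne_zero.2 (mul_ne_zero (mul_ne_zero (h3 i j hij) (h3 i k hik)) (h3 j k hjk))).map
      MvPolynomial.C
  rw [← h4.dvd_mul_left]
  refine h2.trans (dvd_of_eq ?_)
  simp only [map_mul, map_sub, map_pow]
  ring

/-- A prime common divisor π divides one coordinate out of any three, yet it can divide only one
coordinate altogether. With at least four coordinates, removing that one leaves three others, a
contradiction. -/
theorem isReducedForm_thetaLin_sqMat (hq : 1 ≤ q) {p : Fin (q + 2) → ℕ}
    (hs : Function.Injective (extW p)) : IsReducedForm (thetaLin (extMat p) (sqMat p)) := by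
  intro g hg
  by_contra hu
  obtain ⟨π, hπ, hπg⟩ : ∃ π : Poly (q + 3), Prime π ∧ π ∣ g := by
    by_cases h0 : g = 0
    · exact ⟨MvPolynomial.X 0, MvPolynomial.X_prime, h0 ▸ dvd_zero _⟩
    · obtain ⟨π, h1, h2⟩ := WfDvdMonoid.exists_irreducible_factor hu h0
      exact ⟨π, h1.prime, h2⟩
  have key : ∀ i j k : Fin (q + 3), i ≠ j → i ≠ k → j ≠ k →
      π ∣ MvPolynomial.X i ∨ π ∣ MvPolynomial.X j ∨ π ∣ MvPolynomial.X k := by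
    intro i j k hij hik hjk
    have h := dvd_mul_of_dvd_coeffForm hs (fun I => hπg.trans (hg I)) hij hik hjk
    rcases hπ.dvd_or_dvd h with h | h
    · exact (hπ.dvd_or_dvd h).imp id Or.inl
    · exact Or.inr (Or.inr h)
  have hne : ∀ i j : Fin (q + 3), π ∣ MvPolynomial.X i → π ∣ MvPolynomial.X j → i = j := by
    intro i j hi hj
    have h1 : (MvPolynomial.X i : Poly (q + 3)) ∣ π :=
      (hπ.irreducible.associated_of_dvd MvPolynomial.X_prime.irreducible hi).symm.dvd
    exact MvPolynomial.X_dvd_X.1 (h1.trans hj)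
  obtain ⟨r, rfl⟩ : ∃ r, q = r + 1 := ⟨q - 1, by omega⟩
  have h0 : (0 : Fin (r + 3)) ≠ 1 := zero_ne_one
  have h1 : (0 : Fin (r + 3)) ≠ ⟨2, by omega⟩ := Fin.ne_of_val_ne (by simp)
  have h2 : (1 : Fin (r + 3)) ≠ ⟨2, by omega⟩ := Fin.ne_of_val_ne (by simp)
  have avoid : ∀ a : Fin (r + 3 + 1), ∃ i, i ≠ a ∧ π ∣ MvPolynomial.X i := by
    intro a
    have hi := Fin.succAbove_right_injective (p := a)
    rcases key (a.succAbove 0) (a.succAbove 1) (a.succAbove ⟨2, by omega⟩) (hi.ne h0) (hi.ne h1) (hi.ne h2) with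
      h | h | h
    · exact ⟨_, Fin.succAbove_ne _ _, h⟩
    · exact ⟨_, Fin.succAbove_ne _ _, h⟩
    · exact ⟨_, Fin.succAbove_ne _ _, h⟩
  obtain ⟨i, -, hi⟩ := avoid 0
  obtain ⟨j, hj, hj'⟩ := avoid i
  exact hj (hne j i hj' hi)

end Reduction

section Weight

variable {q : ℕ}

theorem isWeightField_linMap_diagonal {m : ℕ} (p : Fin m → ℕ) (b : Fin m → ℂ) :
    IsWeightField p 0 1 (linMap (Matrix.diagonal b)) := by
  refine ⟨isHomogeneous_linMap _, fun i => ?_⟩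
  rw [linMap_diagonal, zero_add]
  exact (MvPolynomial.isWeightedHomogeneous_X ℂ (fun i => (p i : ℤ)) i).C_mul _

/-- The map `b ↦ i_A i_b i_R ν` on diagonal fields. -/
def thetaDiag (p : Fin (q + 2) → ℕ) : (Fin (q + 3) → ℂ) →ₗ[ℂ] Form (q + 3) q :=
  (thetaLin (extMat p)).comp (Matrix.diagonalLinearMap (Fin (q + 3)) ℂ ℂ)

theorem formAt_thetaDiag (p : Fin (q + 2) → ℕ) (b a : Fin (q + 3) → ℂ) (v : Fin q → Fin (q + 3) → ℂ) :
    formAt (thetaDiag p b) a v =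
      vol3 a (fun i => b i * a i) (fun i => extW p i * a i) v := by
  change formAt (theta (extMat p) (linMap (Matrix.diagonal b))) a v = _
  rw [formAt_theta, fieldAt_linMap]
  congr 2
  · funext i
    rw [Matrix.mulVec_diagonal]
  · funext i
    rw [extMat_mulVec]

/-- The two generators are the fields R and A. Evaluating at (1, …, 1) shows that nothing else is
killed: the minors on 0, 1, k express b_k as an affine function of the weight. -/
theorem ker_thetaDiag {p : Fin (q + 2) → ℕ} (hs : Function.Injective (extW p)) :
    LinearMap.ker (thetaDiag p) = Submodule.span ℂ (Set.range
      ![(fun _ => 1 : Fin (q + 3) → ℂ), fun i => (extW p i : ℂ)]) := by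
  apply le_antisymm
  · intro b hb
    have h1 : vol3 (fun _ => 1 : Fin (q + 3) → ℂ) b (fun i => (extW p i : ℂ)) = 0 := by
      refine AlternatingMap.ext fun v => ?_
      have h2 := formAt_thetaDiag p b (fun _ => 1) v
      simp only [mul_one] at h2
      rw [← h2, LinearMap.mem_ker.1 hb, formAt_zero]
      rfl
    have h01 : (0 : Fin (q + 3)) ≠ 1 := zero_ne_one
    have hne : ((extW p 0 : ℂ) - extW p 1) ≠ 0 := by
      rw [sub_ne_zero]
      exact_mod_cast fun h => h01 (hs h)
    obtain ⟨β, hβ⟩ : ∃ β, b 0 - b 1 = β * ((extW p 0 : ℂ) - extW p 1) :=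
      ⟨_, (div_mul_cancel₀ _ hne).symm⟩
    have h3 : b = (b 0 - β * extW p 0) • (fun _ => 1 : Fin (q + 3) → ℂ) +
        β • fun i => (extW p i : ℂ) := by
      funext k
      simp only [Pi.add_apply, Pi.smul_apply, smul_eq_mul, mul_one]
      by_cases hk0 : k = 0
      · rw [hk0]
        ring
      by_cases hk1 : k = 1
      · rw [hk1]
        linear_combination -hβ
      have h4 := minor_three_eq_zero h1 h01 (Ne.symm hk0) (Ne.symm hk1)
      rw [Matrix.det_fin_three] at h4
      simp only [Matrix.of_apply, Matrix.cons_val', Matrix.cons_val_zero, Matrix.cons_val_one,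
        Matrix.cons_val] at h4
      refine mul_left_cancel₀ hne ?_
      linear_combination h4 + ((extW p k : ℂ) - extW p 0) * hβ
    rw [h3]
    exact Submodule.add_mem _ (Submodule.smul_mem _ _ (Submodule.subset_span ⟨0, rfl⟩))
      (Submodule.smul_mem _ _ (Submodule.subset_span ⟨1, rfl⟩))
  · rw [Submodule.span_le]
    rintro _ ⟨i, rfl⟩
    refine LinearMap.mem_ker.2 (form_ext_formAt fun a v => ?_)
    rw [formAt_thetaDiag, formAt_zero]
    fin_cases i
    · change vol3 a (fun i => 1 * a i) (fun i => extW p i * a i) v = 0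
      simp only [one_mul]
      rw [vol3, AlternatingMap.curryLeft_same]
      simp
    · change vol3 a (fun i => extW p i * a i) (fun i => extW p i * a i) v = 0
      rw [vol3_self₁₂]
      rfl

theorem finrank_range_thetaDiag {p : Fin (q + 2) → ℕ} (hs : Function.Injective (extW p)) :
    Module.finrank ℂ (LinearMap.range (thetaDiag p)) = q + 1 := by
  have h1 := (thetaDiag p).finrank_range_add_finrank_ker
  have h01 : (0 : Fin (q + 3)) ≠ 1 := zero_ne_one
  have hne : ((extW p 0 : ℂ) - extW p 1) ≠ 0 := by
    rw [sub_ne_zero]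
    exact_mod_cast fun h => h01 (hs h)
  have h2 : LinearIndependent ℂ ![(fun _ => 1 : Fin (q + 3) → ℂ), fun i => (extW p i : ℂ)] := by
    rw [LinearIndependent.pair_iff]
    intro s t h
    have e0 := congrFun h 0
    have e1 := congrFun h 1
    simp only [Pi.add_apply, Pi.smul_apply, smul_eq_mul, mul_one, Pi.zero_apply] at e0 e1
    have ht : t = 0 := by
      refine (mul_eq_zero.1 ?_).resolve_right hne
      linear_combination e0 - e1
    exact ⟨by rw [ht, zero_mul, add_zero] at e0; exact e0, ht⟩
  have h3 := finrank_span_eq_card h2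
  rw [Fintype.card_fin] at h3
  rw [ker_thetaDiag hs, h3, Module.finrank_fin_fun] at h1
  omega

theorem finrank_weightForms_zero_one {p : Fin (q + 2) → ℕ} (hs : Function.Injective (extW p)) :
    Module.finrank ℂ (weightForms p 0 1) = q + 1 := by
  rw [← finrank_range_thetaDiag hs]
  refine finrank_eq_of_range_eq (V := twistedForms (q + 2) q (1 + 1)) (E := Form (q + 3) q)
    (W := LinearMap.range (thetaDiag p)) (f := (twistedForms (q + 2) q (1 + 1)).subtype) (g := (LinearMap.range (thetaDiag p)).subtype)
    Subtype.val_injective Subtype.val_injective ?_ ?_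
  · intro u hu
    obtain ⟨M, hM, hM'⟩ := thetaLin_of_eq hu
    obtain ⟨b, rfl⟩ := mem_diagMat_of_weight_zero hs hM'
    exact ⟨⟨_, b, rfl⟩, hM⟩
  · rintro ⟨_, b, rfl⟩
    have hX := isWeightField_linMap_diagonal (extW p) b
    exact ⟨thetaV (extMat p) hX.homog, ⟨_, hX, rfl⟩, rfl⟩

theorem exists_isReducedForm_mem_weightForms (hq : 1 ≤ q) {p : Fin (q + 2) → ℕ}
    (hs : Function.Injective (extW p)) : ∃ u ∈ weightForms p 0 1, IsReducedForm u.1 := by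
  have hX := isWeightField_linMap_diagonal (extW p) fun i => (extW p i : ℂ) ^ 2
  exact ⟨thetaV (extMat p) hX.homog, ⟨_, hX, rfl⟩, isReducedForm_thetaLin_sqMat hq hs⟩

end Weight

/-! ### Dimension of the families -/

/-- The lower bound differentiates at the first vector of a basis of U, so the basis must start with
the form without divisorial zeros. -/
theorem exists_family_span_eq {V : Type} [AddCommGroup V] [Module ℂ V] [FiniteDimensional ℂ V]
    (U : Submodule ℂ V) {u₀ : V} (hu : u₀ ∈ U) (h0 : u₀ ≠ 0) :
    ∃ (m : ℕ) (u : Fin (m + 1) → V), u 0 = u₀ ∧ LinearIndependent ℂ u ∧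
      Submodule.span ℂ (Set.range u) = U ∧ Module.finrank ℂ U = m + 1 := by
  obtain ⟨W, hW⟩ := (Submodule.span ℂ {(⟨u₀, hu⟩ : U)}).exists_isCompl
  have hne : (⟨u₀, hu⟩ : U) ≠ 0 := fun h => h0 (congrArg Subtype.val h)
  let b := Module.finBasis ℂ W
  have hr : Module.finrank ℂ U = Module.finrank ℂ W + 1 := by
    have := Submodule.finrank_add_eq_of_isCompl hW
    rw [finrank_span_singleton hne] at this
    omega
  let w : Fin (Module.finrank ℂ W + 1) → U := Fin.cons ⟨u₀, hu⟩ fun k => (b k : U)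
  have hw : LinearIndependent ℂ w := by
    rw [linearIndependent_finCons]
    refine ⟨b.linearIndependent.map' W.subtype W.ker_subtype, fun h => ?_⟩
    have h1 : (⟨u₀, hu⟩ : U) ∈ W := by
      refine Submodule.span_le.2 ?_ h
      rintro _ ⟨k, rfl⟩
      exact (b k).2
    exact hne (Submodule.disjoint_def.1 hW.disjoint _ (Submodule.mem_span_singleton_self _) h1)
  have hs : Submodule.span ℂ (Set.range w) = ⊤ :=
    hw.span_eq_top_of_card_eq_finrank (by rw [Fintype.card_fin, hr])
  refine ⟨Module.finrank ℂ W, fun k => (w k : V), rfl, hw.map' U.subtype U.ker_subtype, ?_, hr⟩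
  have h1 : Set.range (fun k => (w k : V)) = U.subtype '' Set.range w := by
    rw [← Set.range_comp]
    rfl
  rw [h1, Submodule.span_image, hs, Submodule.map_subtype_top]

section Family

variable {q d : ℕ} {p : Fin (q + 2) → ℕ} {lam : ℤ}

theorem IsReducedForm.ne_zero {n q e : ℕ} {Ω : twistedForms n q e} (h : IsReducedForm Ω.1) :
    Ω ≠ 0 := by
  rintro rfl
  obtain ⟨I, hI⟩ := IsReducedFamily.exists_ne_zero h
  exact hI rfl

theorem exists_smul_eq_of_mk_eq {V : Type} [AddCommGroup V] [Module ℂ V] {v w : V} (hv : v ≠ 0)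
    (hw : w ≠ 0) (h : Projectivization.mk ℂ v hv = Projectivization.mk ℂ w hw) :
    ∃ c : ℂ, c • w = v := (Projectivization.mk_eq_mk_iff' ℂ v w hv hw).1 h

/-- The members of the family are the pull-backs of the forms in `weightForms`. -/
theorem exists_of_mem_affFamily (hq : 1 ≤ q) (hp : Function.Injective p) (hpos : ∀ i, 0 < p i)
    {x : ℙ ℂ (twistedForms (q + 2) q (d + 1))} (hx : x ∈ affFamily p lam (d + 1)) :
    ∃ (T : Matrix (Fin (q + 3)) (Fin (q + 3)) ℂ), ∃ u ∈ weightForms p lam d, IsReducedForm u.1 ∧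
      ∃ h : linPull T u ≠ 0, x = Projectivization.mk ℂ (linPull T u) h := by
  obtain ⟨⟨Ω', hΩ', rfl, -, hh⟩, Ω, hΩ, hx, T, X, hX, hT⟩ := hx
  obtain ⟨c, rfl⟩ := exists_smul_eq_of_mk_eq (V := twistedForms (q + 2) q (d + 1)) hΩ' hΩ hx
  have hr : IsReducedForm Ω.1 := by
    intro g hg
    refine (two_le_height_singIdeal_iff _).1 hh g fun I => ?_
    have : coeffForm (c • Ω).1 I = MvPolynomial.C c * coeffForm Ω.1 I :=
      MvPolynomial.smul_eq_C_mul _ _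
    rw [this]
    exact (hg I).mul_left _
  have hdet : T.1.det ≠ 0 := by
    have := (Matrix.isUnit_iff_isUnit_det T.1).1 T.isUnit
    exact this.ne_zero
  have h1 : linPull T⁻¹.1 (linPull T.1 Ω) = Ω := by
    rw [linPull_linPull, ← Units.val_mul, mul_inv_cancel, Units.val_one, linPull_one]
  rw [pullback_affineChart_eq_restr] at hT
  refine ⟨T⁻¹.1, linPull T.1 Ω, (mem_weightForms_iff hq hp hpos).2 ⟨X, hX, hT⟩, hr.linPull hdet,
    ?_, ?_⟩
  · rw [h1]
    exact hΩ
  · rw [hx]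
    congr 1
    exact h1.symm

theorem mk_linPull_mem_affFamily (hq : 1 ≤ q) (hp : Function.Injective p) (hpos : ∀ i, 0 < p i)
    {u : twistedForms (q + 2) q (d + 1)} (hu : u ∈ weightForms p lam d) (hr : IsReducedForm u.1)
    {T : Matrix (Fin (q + 3)) (Fin (q + 3)) ℂ} (hT : T.det ≠ 0) :
    ∃ h : linPull T u ≠ 0, Projectivization.mk ℂ (linPull T u) h ∈ affFamily p lam (d + 1) := by
  have hr' := hr.linPull hT
  refine ⟨hr'.ne_zero, ⟨_, hr'.ne_zero, rfl, ?_, (two_le_height_singIdeal_iff _).2 hr'⟩,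
    _, hr'.ne_zero, rfl, ?_⟩
  · obtain ⟨X, hX, hX'⟩ := hu
    obtain rfl : u = thetaV (extMat p) hX.homog := Subtype.ext hX'
    exact isIntegrable_linPull_thetaV hX.isEigenField hT
  · obtain ⟨X, hX, hX'⟩ := (mem_weightForms_iff hq hp hpos).1 hu
    let S : GL (Fin (q + 2 + 1)) ℂ := Matrix.GeneralLinearGroup.mkOfDetNeZero T hT
    have hS : T * S⁻¹.1 = 1 := by
      have := S.mul_inv
      exact this
    refine ⟨S⁻¹, X, hX, ?_⟩
    rw [pullback_affineChart_eq_restr, linPull_linPull, hS, linPull_one, hX']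

/-- The upper bound needs at least κ symmetries at every form of U; the lower bound needs at most κ
at one form without divisorial zeros. Openness makes nearby forms members of the family, and the − 1
for projectivization is the `D + 1` in `hD`. -/
theorem zariskiDim_affFamilyClosure (hq : 1 ≤ q) (hp : Function.Injective p) (hpos : ∀ i, 0 < p i)
    {u₀ : twistedForms (q + 2) q (d + 1)} (hu : u₀ ∈ weightForms p lam d) (hr : IsReducedForm u₀.1)
    {κ D : ℕ} (h1 : ∀ u ∈ weightForms p lam d, κ ≤ Module.finrank ℂ (symMat p lam u))
    (h2 : Module.finrank ℂ (symMat p lam u₀) ≤ κ)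
    (hD : D + 1 + κ = (q + 3) * (q + 3) + Module.finrank ℂ (weightForms p lam d)) :
    zariskiDim (affFamilyClosure p lam (d + 1)) = (D : WithBot ℕ∞) := by
  obtain ⟨m, u, rfl, hli, hspan, hm⟩ := exists_family_span_eq
    (V := twistedForms (q + 2) q (d + 1)) (weightForms p lam d) hu hr.ne_zero
  apply le_antisymm
  · refine (pullRep (q + 2) q (d + 1)).zariskiDim_closureIn_le_of_family u (κ := κ) ?_ ?_ ?_
    · rw [hspan]
      exact h1
    · rw [hm] at hD
      exact hD.ge
    · intro x hx
      rw [hspan]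
      obtain ⟨T, v, hv, -, h, rfl⟩ := exists_of_mem_affFamily hq hp hpos hx
      exact ⟨T, v, hv, h, rfl⟩
  · obtain ⟨h, hh, hred⟩ := exists_polynomial_isReducedForm u hr
    refine (pullRep (q + 2) q (d + 1)).le_zariskiDim_of_family u hli (κ := κ) ?_ ?_ hh ?_
    · rw [hspan]
      exact h2
    · rw [hm] at hD
      exact hD.le
    · intro T hT z hz
      have hmem : ∑ k, z k • u k ∈ weightForms p lam d := by
        rw [← hspan]
        exact Submodule.sum_mem _ fun k _ =>
          Submodule.smul_mem _ _ (Submodule.subset_span ⟨k, rfl⟩)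
      obtain ⟨h0, hx⟩ := mk_linPull_mem_affFamily hq hp hpos hmem (hred z hz) hT
      refine ⟨h0, ?_, hx.1⟩
      let _ := zariskiTopology (twistedForms (q + 2) q (d + 1))
      exact subset_closure hx

end Family

end ProjFol

end

/-! ### The three dimension formulas -/

theorem proposition2p10 (n q d : ℕ) (hq : 1 ≤ q) (hn : n = q + 2)
    (p : Fin (q + 2) → ℕ) (hp : StrictAnti p) (hpos : ∀ i, 0 < p i)
    (hgcd : Finset.univ.gcd p = 1) (lam : ℤ) :
    (2 ≤ d → (ProjFol.affFamily p lam (d + 1)).Nonempty →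
      ProjFol.zariskiDim (ProjFol.affFamilyClosure p lam (d + 1)) =
        ((ProjFol.dimV₀ p lam d + n ^ 2 + n : ℕ) : WithBot ℕ∞)) ∧
    (d = 1 → lam ≠ 0 → (ProjFol.affFamily p lam (d + 1)).Nonempty →
      ProjFol.zariskiDim (ProjFol.affFamilyClosure p lam (d + 1)) =
        ((ProjFol.dimV₀ p lam d + n ^ 2 + n - 1 : ℕ) : WithBot ℕ∞)) ∧
    (d = 1 → lam = 0 →
      ProjFol.zariskiDim (ProjFol.affFamilyClosure p lam (d + 1)) =
        ((n ^ 2 + 2 * n - 2 : ℕ) : WithBot ℕ∞)) := by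
  have hs := ProjFol.extW_injective hp.injective hpos
  have key : (ProjFol.affFamily p lam (d + 1)).Nonempty →
      ∃ u ∈ ProjFol.weightForms p lam d, ProjFol.IsReducedForm u.1 := by
    rintro ⟨x, hx⟩
    obtain ⟨-, u, hu, hr, -⟩ := ProjFol.exists_of_mem_affFamily hq hp.injective hpos hx
    exact ⟨u, hu, hr⟩
  -- A nonzero form makes W₀ nonzero, so the truncated subtraction in `dimV₀` is exact.
  have hfin : ∀ u ∈ ProjFol.weightForms p lam d, u ≠ 0 →
      ProjFol.dimV₀ p lam d + 1 = Module.finrank ℂ (ProjFol.weightForms p lam d) := by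
    intro u hu h0
    obtain ⟨m, -, -, -, -, hm⟩ := ProjFol.exists_family_span_eq
      (V := ProjFol.twistedForms (q + 2) q (d + 1)) (ProjFol.weightForms p lam d) hu h0
    rw [ProjFol.dimV₀, ← ProjFol.finrank_weightForms hq hp.injective hpos]
    omega
  subst hn
  refine ⟨fun hd hne => ?_, fun hd hlam hne => ?_, fun hd hlam => ?_⟩
  · obtain ⟨u, hu, hr⟩ := key hne
    have hf := hfin u hu hr.ne_zero
    refine ProjFol.zariskiDim_affFamilyClosure hq hp.injective hpos hu hr (κ := q + 3)
      (fun v hv => ProjFol.le_finrank_symMat hv) ?_ ?_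
    · have := Submodule.finrank_mono (ProjFol.symMat_le_of_two_le hd hs hu hr)
      rwa [ProjFol.finrank_diagMat] at this
    · rw [← hf]
      ring
  · obtain ⟨u, hu, hr⟩ := key hne
    subst hd
    have hf := hfin u hu hr.ne_zero
    refine ProjFol.zariskiDim_affFamilyClosure hq hp.injective hpos hu hr (κ := q + 3 + 1)
      (fun v hv => ProjFol.succ_le_finrank_symMat hlam hv)
      (ProjFol.finrank_symMat_le hs hu hr) ?_
    rw [← hf]
    -- The truncated subtraction is harmless because n² + n ≥ 1.
    have : ProjFol.dimV₀ p lam 1 + (q + 2) ^ 2 + (q + 2) - 1 + 1 =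
        ProjFol.dimV₀ p lam 1 + (q + 2) ^ 2 + (q + 2) := Nat.sub_add_cancel (by omega)
    rw [this]
    ring
  · subst hd hlam
    -- Nonemptiness is not assumed in this case: the diagonal field with eigenvalues p_i² provides a
    -- form without divisorial zeros.
    obtain ⟨u, hu, hr⟩ := ProjFol.exists_isReducedForm_mem_weightForms hq hs
    refine ProjFol.zariskiDim_affFamilyClosure hq hp.injective hpos hu hr (κ := q + 3)
      (fun v hv => ProjFol.le_finrank_symMat hv) ?_ ?_
    · have := Submodule.finrank_mono (ProjFol.symMat_le_of_weight_zero hs hu hr)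
      rwa [ProjFol.finrank_diagMat] at this
    · rw [ProjFol.finrank_weightForms_zero_one hs]
      have : (q + 2) ^ 2 + 2 * (q + 2) - 2 = (q + 2) ^ 2 + 2 * q + 2 := by omega
      rw [this]
      ring
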